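/- Let $d\in\{3,4,5\}$. Let $\mu$ be a probability measure on $\mathbb N=\{0,1,2,\dots\}$ with mean $1$ and finite variance, $\mu\neq\delta_1$. Let $\eta$ and $\theta$ be probability measures on $\mathbb Z^d$ such that the random walk with jump law $\eta$ is aperiodic and irreducible, $\eta$ has mean $0$ and $\sum_{x}|x|^{d+1}\eta(x)<\infty$; and such that $\theta$ is symmetric ($\theta(-x)=\theta(x)$ for all $x$), the random walk with jump law $\theta$ is irreducible, and $\sum_x e^{c|x|}\theta(x)<\infty$ for some $c>0$. For a finite set $A\subset\mathbb Z^d$ let $$\mathrm{cap}_\eta(A)=\sum_{x\in A}\mathbf P^\eta_x\big(S_n\notin A\text{ for all }n\ge 1\big),$$ where under $\mathbf P^\eta_x$ the process $(S_n)_{n\ge0}$ is the random walk with jump law $\eta$ started at $x$. Let $(\mathcal T_j)_{j\ge0}$ be independent Galton–Watson trees with offspring law $\mu$. Take an infinite ray $(w_j)_{j\ge 0}$, let $w_{j-1}$ be the parent of $w_j$ for every $j\ge 1$, and identify the root of $\mathcal T_j$ with $w_j$ for every $j\ge 0$; this gives an infinite tree $\mathcal T^{IGW}$ rooted at $w_0$.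 Attach to the edges of $\mathcal T^{IGW}$ i.i.d. random variables of law $\theta$, independent of the tree, and for every vertex $u$ let $V_u\in\mathbb Z^d$ be the sum of the variables attached to the edges of the simple path from $w_0$ to $u$ (so $V_{w_0}=0$). For $n\ge 0$ let $R_n=\{V_u: u\in\bigcup_{j=0}^{n-1}\mathcal T_j\}$ be the set of points visited by the vertices of the first $n$ subtrees. Then, almost surely, the sets $R_n$ are all finite and $$\mathrm{cap}_\eta(R_n)=n^{\frac{d-2}{2}+o(1)}\qquad\text{as }n\to\infty,$$ that is, almost surely there is a sequence $\varepsilon_n\to0$ with $\mathrm{cap}_\eta(R_n)=n^{\frac{d-2}{2}+\varepsilon_n}$ for all sufficiently large $n$. -/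

import Mathlib

open MeasureTheory Filter Topology

namespace BRW

noncomputable section

/-- The integer lattice `ℤ^d`. -/
abbrev Lattice (d : ℕ) : Type := Fin d → ℤ

/-- The inclusion of `ℤ^d` in Euclidean space `ℝ^d`. -/
def toEuclidean {d : ℕ} (x : Lattice d) : EuclideanSpace ℝ (Fin d) :=
  WithLp.toLp 2 fun i => (x i : ℝ)

/-! ### Random walks and capacity -/

/-- The path `n ↦ x + ξ 0 + ⋯ + ξ (n - 1)` started at `x` with successive jumps `ξ 0, ξ 1, …`. -/
def walkPath {d : ℕ} (x : Lattice d) (ξ : ℕ → Lattice d) (n : ℕ) : Lattice d :=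
  x + ∑ k ∈ Finset.range n, ξ k

theorem measurable_walkPath {d : ℕ} (x : Lattice d) : Measurable (walkPath x) := by
  unfold walkPath
  fun_prop

/-- The law, on path space, of the random walk started at `x` with i.i.d. jumps of law `η`. -/
def walkLaw {d : ℕ} (η : Measure (Lattice d)) [IsProbabilityMeasure η] (x : Lattice d) :
    Measure (ℕ → Lattice d) :=
  (Measure.infinitePi fun _ : ℕ => η).map (walkPath x)

/-- Every point can be reached from every point with positive probability. -/
def IsIrreducible {d : ℕ} (η : Measure (Lattice d)) [IsProbabilityMeasure η] : Prop :=
  ∀ x y : Lattice d, ∃ n : ℕ, 0 < walkLaw η x {S | S n = y}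

/-- The possible return times to the origin have no common divisor other than `1`. -/
def IsAperiodic {d : ℕ} (η : Measure (Lattice d)) [IsProbabilityMeasure η] : Prop :=
  ∀ k : ℕ, (∀ n : ℕ, 1 ≤ n → 0 < walkLaw η 0 {S | S n = 0} → k ∣ n) → k = 1

/-- The `η`-capacity of a finite set `A`: the sum over `x ∈ A` of the probability that the
`η`-walk started at `x` never visits `A` at a time `n ≥ 1`. (Used for finite `A` only.) -/
def capacity {d : ℕ} (η : Measure (Lattice d)) [IsProbabilityMeasure η]
    (A : Set (Lattice d)) : ℝ :=
  ∑ᶠ x ∈ A, (walkLaw η x).real {S | ∀ n : ℕ, 1 ≤ n → S n ∉ A}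

/-! ### The Galton–Watson forest and the branching random walk on it -/

/-- The rooted plane tree in which the vertex `u` has `c u` children. Vertices are words read from
the vertex up to the root: `[]` is the root, and `i :: u` is the child number `i` of `u`. -/
inductive IsVertex (c : List ℕ → ℕ) : List ℕ → Prop
  | root : IsVertex c []
  | child (u : List ℕ) (i : ℕ) : IsVertex c u → i < c u → IsVertex c (i :: u)

/-- Labels for the vertices of the forest: `(j, u)` is the vertex `u` of the `j`-th subtree.
The spine is `w j = (j, [])`, and the root of the whole forest is `(0, [])`. The parent of
`(j, i :: u)` is `(j, u)`, and the parent of `(j + 1, [])` is `(j, [])`. -/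
abbrev Label : Type := ℕ × List ℕ

/-- A sample point: an offspring number for each label, and for each label other than `(0, [])`
the displacement on the edge to its parent (the value at `(0, [])` is never used). The offspring
number of `(j, u)` counts its children inside the `j`-th subtree, hence not `w (j + 1)`. -/
abbrev Sample (d : ℕ) : Type := (Label → ℕ) × (Label → Lattice d)

/-- The joint law: all offspring numbers have law `μ`, all displacements have law `θ`, and all of
these are independent. -/
def brwLaw {d : ℕ} (μ : Measure ℕ) [IsProbabilityMeasure μ]
    (θ : Measure (Lattice d)) [IsProbabilityMeasure θ] : Measure (Sample d) :=
  (Measure.infinitePi fun _ : Label => μ).prod (Measure.infinitePi fun _ : Label => θ)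

/-- The `j`-th subtree, the Galton–Watson tree attached to `w j`. -/
def subtree {d : ℕ} (ω : Sample d) (j : ℕ) : Set (List ℕ) :=
  {u | IsVertex (fun v => ω.1 (j, v)) u}

/-- The position of the spine vertex `w j`. -/
def spinePosition {d : ℕ} (ω : Sample d) : ℕ → Lattice d
  | 0 => 0
  | j + 1 => spinePosition ω j + ω.2 (j + 1, [])

/-- The position of the vertex `(j, u)`: the sum of the displacements on the edges of the path
from the root `(0, [])` to `(j, u)`. -/
def position {d : ℕ} (ω : Sample d) (j : ℕ) : List ℕ → Lattice d
  | [] => spinePosition ω j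
  | i :: u => position ω j u + ω.2 (j, i :: u)

/-- The set of points visited by the vertices of the first `n` subtrees. -/
def range {d : ℕ} (ω : Sample d) (n : ℕ) : Set (Lattice d) :=
  {x | ∃ j < n, ∃ u ∈ subtree ω j, position ω j u = x}

end

end BRW

open scoped ENNReal

namespace BRW

noncomputable section

/-! ### Convolution powers of a jump law -/

section

variable {d : ℕ}

/-! Put `a = (d - 2) / 2`. The first `n` subtrees have about `n ^ 2` vertices at generations up to
about `n`, and the displacement along a tree path of length `m` is that of a `θ`-walk of `m` steps.
The range therefore lives at spatial scale `√n`, and to leading exponent its capacity is that of a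
full box of radius `√n`, namely `(√n) ^ (d - 2) = n ^ a`.

Upper bound. A subset of a box of radius `r` has capacity `O(r ^ (d - 2))` (`exists_capacity_le`). A
critical tree reaches generation `h` with probability `O(1 / h)` (`survival_le`), so no subtree
exceeds height `n ^ (1 + δ)`, and exponential moments of `θ` then confine the range to a box of
radius `n ^ (1 / 2 + δ)` (`ae_eventually_range_subset_box`).

Lower bound. Capacity is at least mass squared over four times the energy
(`sq_tsum_le_energy_mul_capacity`). The charge counts vertices of generation below `h = n ^ (1 -
δ)`. Its mass has mean `n h` and variance `O(n h ^ 3)`, hence concentrates (`mass_lt_le`). Two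
vertices at tree distance `m` contribute to the energy the mean of the `η`-Green function at time
`m` of a `θ`-walk, which is `O(m ^ (-a))` by the heat kernel bounds of both walks
(`exists_lintegral_green_le`). Summed over pairs, with the last common ancestor accounted for inside
a single tree (`pairSum_self_le`), this gives expected energy `O(n ^ (4 - a))`
(`exists_lintegral_energy_le`); the pairs inside one tree obey this bound because `a < 2`, that is
`d < 6`. The capacity is thus at least of order `n ^ (2 (2 - δ) - (4 - a + δ)) = n ^ (a - 3 δ)`.

All error probabilities are small powers of `n`, so Borel–Cantelli applies along powers of two.
Intermediate `n` follow because the range is monotone in `n` and both bounds hold for every finite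
set containing, respectively contained in, the range at a power of two. -/

/-- The law of the sum of `n` independent jumps of law `η`. -/
def stepLaw (η : Measure (Lattice d)) : ℕ → Measure (Lattice d)
  | 0 => Measure.dirac 0
  | n + 1 => η ∗ stepLaw η n

instance isProbabilityMeasure_stepLaw (η : Measure (Lattice d)) [IsProbabilityMeasure η] (n : ℕ) :
    IsProbabilityMeasure (stepLaw η n) := by
  induction n with
  | zero => unfold stepLaw; infer_instance
  | succ n ih => unfold stepLaw; infer_instance

theorem lintegral_stepLaw_zero (η : Measure (Lattice d)) (f : Lattice d → ℝ≥0∞) :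
    ∫⁻ x, f x ∂stepLaw η 0 = f 0 := by
  simp [stepLaw]

theorem lintegral_stepLaw_succ (η : Measure (Lattice d)) [IsProbabilityMeasure η] (n : ℕ)
    (f : Lattice d → ℝ≥0∞) :
    ∫⁻ x, f x ∂stepLaw η (n + 1) = ∫⁻ x, ∫⁻ y, f (x + y) ∂stepLaw η n ∂η := by
  rw [stepLaw, Measure.lintegral_conv .of_discrete]

theorem stepLaw_add (η : Measure (Lattice d)) [IsProbabilityMeasure η] (m n : ℕ) :
    stepLaw η (m + n) = stepLaw η m ∗ stepLaw η n := by
  induction m with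
  | zero => simp [stepLaw]
  | succ m ih => rw [Nat.succ_add, stepLaw, ih, stepLaw, Measure.conv_assoc]

theorem lintegral_stepLaw_add (η : Measure (Lattice d)) [IsProbabilityMeasure η] (m n : ℕ)
    (f : Lattice d → ℝ≥0∞) :
    ∫⁻ x, f x ∂stepLaw η (m + n) = ∫⁻ x, ∫⁻ y, f (x + y) ∂stepLaw η n ∂stepLaw η m := by
  rw [stepLaw_add, Measure.lintegral_conv .of_discrete]

theorem lintegral_stepLaw_succ' (η : Measure (Lattice d)) [IsProbabilityMeasure η] (n : ℕ)
    (f : Lattice d → ℝ≥0∞) :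
    ∫⁻ x, f x ∂stepLaw η (n + 1) = ∫⁻ x, ∫⁻ y, f (x + y) ∂η ∂stepLaw η n := by
  rw [lintegral_stepLaw_add]
  simp [lintegral_stepLaw_succ, lintegral_stepLaw_zero]

theorem stepLaw_zero_singleton (η : Measure (Lattice d)) (x : Lattice d) :
    stepLaw η 0 {x} = if x = 0 then 1 else 0 := by
  classical
  simp [stepLaw, Set.indicator, eq_comm]

theorem stepLaw_add_singleton (η : Measure (Lattice d)) [IsProbabilityMeasure η] (m n : ℕ)
    (x : Lattice d) :
    stepLaw η (m + n) {x} = ∫⁻ y, stepLaw η n {x - y} ∂stepLaw η m := by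
  rw [← lintegral_indicator_one (.singleton x), lintegral_stepLaw_add]
  congr with y
  rw [← lintegral_indicator_one (.singleton _)]
  congr with z
  simp only [Set.indicator, Set.mem_singleton_iff, eq_sub_iff_add_eq, add_comm y z, Pi.one_apply]

theorem stepLaw_succ_singleton (η : Measure (Lattice d)) [IsProbabilityMeasure η] (n : ℕ)
    (x : Lattice d) :
    stepLaw η (n + 1) {x} = ∫⁻ y, stepLaw η n {x - y} ∂η := by
  rw [add_comm, stepLaw_add_singleton, lintegral_stepLaw_succ]
  simp [lintegral_stepLaw_zero]

theorem stepLaw_mul_le (η : Measure (Lattice d)) [IsProbabilityMeasure η] (m n : ℕ)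
    (x y : Lattice d) :
    stepLaw η m {x} * stepLaw η n {y} ≤ stepLaw η (m + n) {x + y} := by
  rw [stepLaw_add_singleton, mul_comm]
  calc stepLaw η n {y} * stepLaw η m {x}
      = ∫⁻ z in {x}, stepLaw η n {x + y - z} ∂stepLaw η m := by
        rw [lintegral_singleton, add_sub_cancel_left]
    _ ≤ _ := setLIntegral_le_lintegral _ _

/-! ### First-step decomposition of the path law -/

/-- The path with first point `a`, followed by the path `S`. -/
def consPath {α : Type*} (a : α) (S : ℕ → α) : ℕ → α
  | 0 => a
  | n + 1 => S n

theorem measurable_consPath {α : Type*} [MeasurableSpace α] :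
    Measurable fun p : α × (ℕ → α) => consPath p.1 p.2 := by
  refine measurable_pi_lambda _ fun n => ?_
  cases n with
  | zero => exact measurable_fst
  | succ n => exact (measurable_pi_apply n).comp measurable_snd

theorem infinitePi_map_consPath {α : Type*} [MeasurableSpace α] (η : Measure α)
    [IsProbabilityMeasure η] :
    (η.prod (Measure.infinitePi fun _ : ℕ => η)).map (fun p => consPath p.1 p.2) =
      Measure.infinitePi fun _ : ℕ => η := by
  classical
  apply Measure.eq_infinitePi
  intro s t ht
  rw [Measure.map_apply measurable_consPath (.pi (Finset.countable_toSet _) fun i _ => ht i)]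
  -- Padding with the full space turns the cylinder over `s` into a product over an initial segment,
  -- on which the shift of indices is transparent.
  set t' : ℕ → Set α := fun i => if i ∈ s then t i else Set.univ with ht'
  have hm : ∀ i, MeasurableSet (t' i) := by
    intro i; simp only [ht']; split_ifs; exacts [ht i, .univ]
  have hpre : (fun p : α × (ℕ → α) => consPath p.1 p.2) ⁻¹' (Set.pi (s : Set ℕ) t) =
      t' 0 ×ˢ Set.pi ((Finset.range (s.sup id)) : Set ℕ) fun i => t' (i + 1) := by
    ext ⟨a, S⟩
    simp only [Set.mem_preimage, Set.mem_pi, Finset.mem_coe, Set.mem_prod, Finset.mem_range, ht']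
    constructor
    · intro h
      refine ⟨?_, fun i _ => ?_⟩
      · split_ifs with h0
        · exact h 0 h0
        · trivial
      · split_ifs with h0
        · exact h (i + 1) h0
        · trivial
    · rintro ⟨h1, h2⟩ i hi
      cases i with
      | zero => simpa [hi, consPath] using h1
      | succ i =>
        have : i < s.sup id := Nat.lt_of_succ_le (Finset.le_sup (f := id) hi)
        simpa [hi, consPath] using h2 i this
  rw [hpre, Measure.prod_prod, Measure.infinitePi_pi _ (fun i _ => hm _), mul_comm,
    ← Finset.prod_range_succ' (fun i => η (t' i))]
  have hsub : s ⊆ Finset.range (s.sup id + 1) := fun i hi =>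
    Finset.mem_range.2 (Nat.lt_succ_of_le (Finset.le_sup (f := id) hi))
  rw [← Finset.prod_subset hsub]
  · exact Finset.prod_congr rfl fun i hi => by simp [ht', hi]
  · intro i _ hi; simp [ht', hi]

theorem walkPath_consPath (x y : Lattice d) (ξ : ℕ → Lattice d) :
    walkPath x (consPath y ξ) = consPath x (walkPath (x + y) ξ) := by
  funext n
  cases n with
  | zero => simp [walkPath, consPath]
  | succ n =>
    simp only [walkPath, consPath, Finset.sum_range_succ']
    abel

instance (η : Measure (Lattice d)) [IsProbabilityMeasure η] (x : Lattice d) :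
    IsProbabilityMeasure (walkLaw η x) :=
  Measure.isProbabilityMeasure_map (measurable_walkPath x).aemeasurable

/-- The Markov property at time one, which drives the inductions on time. -/
theorem walkLaw_apply (η : Measure (Lattice d)) [IsProbabilityMeasure η] (x : Lattice d)
    {E : Set (ℕ → Lattice d)} (hE : MeasurableSet E) :
    walkLaw η x E = ∫⁻ y, walkLaw η (x + y) (consPath x ⁻¹' E) ∂η := by
  have hc : Measurable (consPath x : (ℕ → Lattice d) → ℕ → Lattice d) :=
    measurable_consPath.comp (measurable_const.prodMk measurable_id)
  have hcy : ∀ y, Measurable (consPath y : (ℕ → Lattice d) → ℕ → Lattice d) := fun y =>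
    measurable_consPath.comp (measurable_const.prodMk measurable_id)
  rw [walkLaw, ← infinitePi_map_consPath, Measure.map_map (measurable_walkPath x)
    measurable_consPath, Measure.map_apply ((measurable_walkPath x).comp measurable_consPath) hE,
    Measure.prod_apply (((measurable_walkPath x).comp measurable_consPath) hE)]
  congr with y
  rw [walkLaw, Measure.map_apply (measurable_walkPath _) (hc hE)]
  congr 1
  ext ξ
  simp [walkPath_consPath]

theorem walkLaw_start (η : Measure (Lattice d)) [IsProbabilityMeasure η] (x : Lattice d) :
    ∀ᵐ S ∂walkLaw η x, S 0 = x := by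
  rw [walkLaw, ae_map_iff (measurable_walkPath x).aemeasurable
    (measurableSet_eq_fun (measurable_pi_apply 0) measurable_const)]
  exact ae_of_all _ fun ξ => by simp [walkPath]

theorem walkLaw_apply_zero (η : Measure (Lattice d)) [IsProbabilityMeasure η] (x y : Lattice d) :
    walkLaw η x {S | S 0 = y} = if y = x then 1 else 0 := by
  have h := walkLaw_start η x
  split_ifs with hxy
  · subst hxy; exact (prob_compl_eq_zero_iff (measurableSet_eq_fun (measurable_pi_apply 0)
      measurable_const)).1 h
  · refine measure_mono_null ?_ h
    intro S hS hS'
    exact hxy (hS.symm.trans hS')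

theorem measurableSet_eval (n : ℕ) (A : Set (Lattice d)) :
    MeasurableSet {S : ℕ → Lattice d | S n ∈ A} :=
  measurable_pi_apply n (MeasurableSet.of_discrete (s := A))

theorem walkLaw_eval (η : Measure (Lattice d)) [IsProbabilityMeasure η] (n : ℕ)
    (x y : Lattice d) :
    walkLaw η x {S | S n = y} = stepLaw η n {y - x} := by
  induction n generalizing x with
  | zero => simp only [walkLaw_apply_zero, stepLaw_zero_singleton, sub_eq_zero]
  | succ n ih =>
    have h := walkLaw_apply η x (measurableSet_eval (n + 1) {y})
    simp only [Set.mem_singleton_iff] at h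
    rw [h, stepLaw_succ_singleton]
    congr with z
    rw [sub_sub, ← ih]
    rfl

/-! ### Last-exit decomposition and capacity -/

/-- The probability that the `η`-walk started at `x` never visits `A` at a time `n ≥ 1`. -/
def escape (η : Measure (Lattice d)) [IsProbabilityMeasure η] (A : Set (Lattice d))
    (x : Lattice d) : ℝ≥0∞ :=
  walkLaw η x {S | ∀ n : ℕ, 1 ≤ n → S n ∉ A}

/-- The paths whose last visit to `A` is at time `n`. -/
def lastExit (A : Set (Lattice d)) (n : ℕ) : Set (ℕ → Lattice d) :=
  {S | S n ∈ A ∧ ∀ m, n < m → S m ∉ A}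

theorem measurableSet_lastExit (A : Set (Lattice d)) (n : ℕ) :
    MeasurableSet (lastExit A n) := by
  refine (measurableSet_eval n A).inter ?_
  show MeasurableSet {S : ℕ → Lattice d | ∀ m, n < m → S m ∉ A}
  simp only [Set.ofPred_forall]
  exact .iInter fun m => .iInter fun _ => (measurableSet_eval m A).compl

/-- Induction by the first step: a last exit at time `n + 1` does not look at time zero, so the
shifted path has its last exit at time `n`. -/
theorem walkLaw_lastExit (η : Measure (Lattice d)) [IsProbabilityMeasure η]
    (A : Finset (Lattice d)) (n : ℕ) (x : Lattice d) :
    walkLaw η x (lastExit A n) = ∑ z ∈ A, stepLaw η n {z - x} * escape η A z := by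
  classical
  induction n generalizing x with
  | zero =>
    simp only [stepLaw_zero_singleton, sub_eq_zero, ite_mul, one_mul, zero_mul,
      Finset.sum_ite_eq']
    split_ifs with hx
    · refine measure_congr ?_
      filter_upwards [walkLaw_start η x] with S hS
      refine propext ⟨fun h n hn => h.2 n hn, fun h => ⟨?_, fun m hm => h m hm⟩⟩
      rw [hS]; exact hx
    · refine measure_mono_null ?_ (walkLaw_start η x)
      intro S hS hS'
      have hS'' : S 0 = x := hS'
      have := hS.1
      rw [hS''] at this; exact hx this
  | succ n ih =>
    rw [walkLaw_apply η x (measurableSet_lastExit _ _)]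
    have : consPath x ⁻¹' lastExit (A : Set (Lattice d)) (n + 1) = lastExit A n := by
      ext S
      refine ⟨fun h => ⟨h.1, fun m hm => h.2 (m + 1) (by omega)⟩, fun h => ⟨h.1, fun m hm => ?_⟩⟩
      obtain ⟨m, rfl⟩ : ∃ k, m = k + 1 := ⟨m - 1, by omega⟩
      exact h.2 m (by omega)
    simp only [this, ih]
    rw [lintegral_finsetSum _ fun _ _ => .of_discrete]
    refine Finset.sum_congr rfl fun z _ => ?_
    rw [lintegral_mul_const _ .of_discrete, stepLaw_succ_singleton]
    simp only [sub_sub]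

theorem pairwise_disjoint_lastExit (A : Set (Lattice d)) :
    Pairwise (Function.onFun Disjoint (lastExit A)) := by
  intro m n hmn
  refine Set.disjoint_left.2 fun S hm hn => ?_
  rcases lt_or_gt_of_ne hmn with h | h
  · exact hm.2 n h hn.1
  · exact hn.2 m h hm.1

/-- The expected number of visits of the `η`-walk to a point at displacement `x`. -/
def green (η : Measure (Lattice d)) (x : Lattice d) : ℝ≥0∞ := ∑' n, stepLaw η n {x}

/-- The right side is the probability that `A` is visited, but only finitely often. -/
theorem sum_green_mul_escape (η : Measure (Lattice d)) [IsProbabilityMeasure η]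
    (A : Finset (Lattice d)) (x : Lattice d) :
    ∑ z ∈ A, green η (z - x) * escape η A z = walkLaw η x (⋃ n, lastExit A n) := by
  rw [measure_iUnion (pairwise_disjoint_lastExit _) (measurableSet_lastExit _)]
  simp only [walkLaw_lastExit, green, ← ENNReal.tsum_mul_right]
  rw [Summable.tsum_finsetSum fun _ _ => ENNReal.summable]

theorem sum_green_mul_escape_le_one (η : Measure (Lattice d)) [IsProbabilityMeasure η]
    (A : Finset (Lattice d)) (x : Lattice d) :
    ∑ z ∈ A, green η (z - x) * escape η A z ≤ 1 := by
  rw [sum_green_mul_escape]; exact prob_le_one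

/-- With a finite Green function the expected number of visits to `A` is finite, so by
Borel–Cantelli there is a last one; a start in `A` ensures there is at least one. -/
theorem sum_green_mul_escape_eq_one (η : Measure (Lattice d)) [IsProbabilityMeasure η]
    (hη : ∀ x, green η x ≠ ∞) (A : Finset (Lattice d)) {x : Lattice d} (hx : x ∈ A) :
    ∑ z ∈ A, green η (z - x) * escape η A z = 1 := by
  rw [sum_green_mul_escape, ← prob_compl_eq_zero_iff (.iUnion (measurableSet_lastExit _))]
  have hfin : ∑' n, walkLaw η x {S | S n ∈ (A : Set (Lattice d))} ≠ ∞ := by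
    have h1 : ∀ n, walkLaw η x {S | S n ∈ (A : Set (Lattice d))} ≤
        ∑ z ∈ A, stepLaw η n {z - x} := by
      intro n
      have : {S : ℕ → Lattice d | S n ∈ (A : Set (Lattice d))} = ⋃ z ∈ A, {S | S n = z} := by
        ext S; simp
      rw [this]
      refine (measure_biUnion_finset_le _ _).trans (le_of_eq ?_)
      simp only [walkLaw_eval]
    refine ne_top_of_le_ne_top ?_ (ENNReal.tsum_le_tsum h1)
    rw [Summable.tsum_finsetSum fun _ _ => ENNReal.summable]
    exact ENNReal.sum_ne_top.2 fun z _ => hη _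
  have h0 := measure_limsup_atTop_eq_zero hfin
  refine measure_mono_null ?_ (measure_union_null h0 (walkLaw_start η x))
  intro S hS
  by_contra hcon
  simp only [Set.mem_union, not_or, Filter.mem_limsup_iff_frequently_mem] at hcon
  obtain ⟨h1, h2⟩ := hcon
  have hS0 : S 0 = x := by by_contra h; exact h2 h
  have h1' : ∀ᶠ n in atTop, S n ∉ (A : Set (Lattice d)) := by
    simpa [Filter.not_frequently] using h1
  obtain ⟨N, hN⟩ := eventually_atTop.1 h1'
  apply hS
  let P : ℕ → Prop := fun n => S n ∈ (A : Set (Lattice d))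
  have hP0 : P 0 := by show S 0 ∈ _; rw [hS0]; exact hx
  classical
  refine Set.mem_iUnion.2 ⟨Nat.findGreatest P N, Nat.findGreatest_spec (Nat.zero_le N) hP0, ?_⟩
  intro m hm hmA
  by_cases hmN : m ≤ N
  · exact Nat.findGreatest_is_greatest hm hmN hmA
  · exact hN m (by omega) hmA

theorem ofReal_capacity (η : Measure (Lattice d)) [IsProbabilityMeasure η]
    (A : Finset (Lattice d)) :
    ENNReal.ofReal (capacity η A) = ∑ z ∈ A, escape η A z := by
  unfold capacity
  rw [finsum_mem_coe_finset, ENNReal.ofReal_sum_of_nonneg fun _ _ => measureReal_nonneg]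
  refine Finset.sum_congr rfl fun z _ => ?_
  rw [ofReal_measureReal]; rfl

theorem capacity_nonneg (η : Measure (Lattice d)) [IsProbabilityMeasure η]
    (A : Finset (Lattice d)) : 0 ≤ capacity η A := by
  unfold capacity
  rw [finsum_mem_coe_finset]
  exact Finset.sum_nonneg fun _ _ => measureReal_nonneg

end

section

variable {d : ℕ}

/-! ### A lower bound for the capacity by the energy -/

/-- The maximum principle for the Green function truncated at `N` steps. Off the support the
time-zero term vanishes, and what remains is at most an average over the first jump of the potential
truncated at one step less. No hitting times are needed. -/
theorem sum_range_potential_le (η : Measure (Lattice d)) [IsProbabilityMeasure η] {I : Type*}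
    (w : I → ℝ≥0∞) (z : I → Lattice d) (K : ℝ≥0∞)
    (h : ∀ p, w p ≠ 0 → ∑' q, w q * green η (z p - z q) ≤ K) (N : ℕ) (x : Lattice d) :
    ∑ n ∈ Finset.range N, ∑' q, w q * stepLaw η n {x - z q} ≤ K := by
  induction N generalizing x with
  | zero => simp
  | succ N ih =>
    by_cases hx : ∃ p, w p ≠ 0 ∧ z p = x
    · obtain ⟨p, hp, rfl⟩ := hx
      refine le_trans ?_ (h p hp)
      simp only [green, ← ENNReal.tsum_mul_left]
      rw [ENNReal.tsum_comm]
      exact ENNReal.sum_le_tsum _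
    · push Not at hx
      rw [Finset.sum_range_succ']
      have h0 : ∑' q, w q * stepLaw η 0 {x - z q} = 0 := by
        refine ENNReal.tsum_eq_zero.2 fun q => ?_
        by_cases hq : w q = 0
        · simp [hq]
        · rw [stepLaw_zero_singleton, if_neg, mul_zero]
          rw [sub_eq_zero]; exact fun h => hx q hq h.symm
      have hI : ∀ n, ∑' q, w q * stepLaw η (n + 1) {x - z q} ≤
          ∫⁻ y, ∑' q, w q * stepLaw η n {x - y - z q} ∂η := by
        intro n
        simp only [stepLaw_succ_singleton]
        have : ∀ q, w q * ∫⁻ y, stepLaw η n {x - z q - y} ∂η =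
            ∫⁻ y, w q * stepLaw η n {x - y - z q} ∂η := by
          intro q
          rw [lintegral_const_mul _ .of_discrete]
          simp only [sub_right_comm]
        simp only [this]
        rw [ENNReal.tsum_eq_iSup_sum]
        refine iSup_le fun s => ?_
        rw [← lintegral_finsetSum _ fun _ _ => .of_discrete]
        exact lintegral_mono fun y => ENNReal.sum_le_tsum _
      rw [h0, add_zero]
      calc ∑ n ∈ Finset.range N, ∑' q, w q * stepLaw η (n + 1) {x - z q}
          ≤ ∑ n ∈ Finset.range N, ∫⁻ y, ∑' q, w q * stepLaw η n {x - y - z q} ∂η :=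
            Finset.sum_le_sum fun n _ => hI n
        _ = ∫⁻ y, ∑ n ∈ Finset.range N, ∑' q, w q * stepLaw η n {x - y - z q} ∂η :=
            (lintegral_finsetSum _ fun _ _ => .of_discrete).symm
        _ ≤ ∫⁻ _, K ∂η := lintegral_mono fun y => ih (x - y)
        _ = K := by simp

/-- Maximum principle: a potential that is at most `K` on the support of its charge is at most
`K` everywhere. -/
theorem potential_le (η : Measure (Lattice d)) [IsProbabilityMeasure η] {I : Type*}
    (w : I → ℝ≥0∞) (z : I → Lattice d) (K : ℝ≥0∞)
    (h : ∀ p, w p ≠ 0 → ∑' q, w q * green η (z p - z q) ≤ K) (x : Lattice d) :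
    ∑' q, w q * green η (x - z q) ≤ K := by
  simp only [green, ← ENNReal.tsum_mul_left]
  rw [ENNReal.tsum_comm]
  exact ENNReal.tsum_le_of_sum_range_le fun N => sum_range_potential_le η w z K h N x

/-- Pair the potential of `w` with the equilibrium charge `escape`: by the last-exit identity each
point of the charge `w` counts exactly once, while the maximum principle bounds the potential by `K`
on all of `A`. -/
theorem tsum_le_mul_capacity (η : Measure (Lattice d)) [IsProbabilityMeasure η]
    (hη : ∀ x, green η x ≠ ∞) (A : Finset (Lattice d)) {I : Type*}
    (w : I → ℝ≥0∞) (z : I → Lattice d) (hz : ∀ p, w p ≠ 0 → z p ∈ A) (K : ℝ≥0∞)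
    (h : ∀ p, w p ≠ 0 → ∑' q, w q * green η (z p - z q) ≤ K) :
    ∑' p, w p ≤ K * ENNReal.ofReal (capacity η A) := by
  calc ∑' p, w p = ∑' p, ∑ x ∈ A, w p * green η (x - z p) * escape η A x := by
        refine tsum_congr fun p => ?_
        by_cases hp : w p = 0
        · simp [hp]
        · simp only [mul_assoc]
          rw [← Finset.mul_sum, sum_green_mul_escape_eq_one η hη A (hz p hp), mul_one]
    _ = ∑ x ∈ A, (∑' p, w p * green η (x - z p)) * escape η A x := by
        rw [Summable.tsum_finsetSum fun _ _ => ENNReal.summable]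
        simp only [ENNReal.tsum_mul_right]
    _ ≤ ∑ x ∈ A, K * escape η A x :=
        Finset.sum_le_sum fun x _ => mul_le_mul_left (potential_le η w z K h x) _
    _ = K * ENNReal.ofReal (capacity η A) := by rw [ofReal_capacity, Finset.mul_sum]

/-- The capacity of a set is at least a quarter of the square of the mass of a measure
carried by it, divided by the energy of this measure. -/
theorem sq_tsum_le_energy_mul_capacity (η : Measure (Lattice d)) [IsProbabilityMeasure η]
    (hη : ∀ x, green η x ≠ ∞) (A : Finset (Lattice d)) {I : Type*}
    (w : I → ℝ≥0∞) (z : I → Lattice d) (hz : ∀ p, w p ≠ 0 → z p ∈ A)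
    (hw : ∑' p, w p ≠ ∞) {E : ℝ≥0∞} (hE0 : E ≠ 0) (hE : E ≠ ∞)
    (h : ∑' p, ∑' q, w p * w q * green η (z q - z p) ≤ E) :
    (∑' p, w p) ^ 2 ≤ 4 * E * ENNReal.ofReal (capacity η A) := by
  classical
  set M := ∑' p, w p with hM
  by_cases hM0 : M = 0
  · simp [hM0]
  set U : I → ℝ≥0∞ := fun q => ∑' p, w p * green η (z q - z p) with hU
  -- The energy controls the potential only on average. By Markov's inequality the points with
  -- potential above `2E / M` carry at most half of the mass; the charge restricted to the others
  -- has potential at most `K` on its support.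
  set K : ℝ≥0∞ := 2 * E / M with hK
  have hK0 : K ≠ 0 := ENNReal.div_ne_zero.2 ⟨mul_ne_zero two_ne_zero hE0, hw⟩
  have hKt : K ≠ ∞ := ENNReal.div_ne_top (ENNReal.mul_ne_top ENNReal.ofNat_ne_top hE) hM0
  set w' : I → ℝ≥0∞ := fun p => if U p ≤ K then w p else 0 with hw'
  set b : I → ℝ≥0∞ := fun p => if U p ≤ K then 0 else w p with hb
  have hsum : M = ∑' p, w' p + ∑' p, b p := by
    rw [hM, ← ENNReal.tsum_add]
    refine tsum_congr fun p => ?_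
    simp only [hw', hb]; split_ifs <;> simp
  have hwE : ∑' q, w q * U q ≤ E := by
    refine le_trans (le_of_eq ?_) h
    rw [ENNReal.tsum_comm]
    refine tsum_congr fun q => ?_
    rw [← ENNReal.tsum_mul_left]
    exact tsum_congr fun p => by ring
  have hbK : K * ∑' p, b p ≤ E := by
    refine le_trans ?_ hwE
    rw [← ENNReal.tsum_mul_left]
    refine ENNReal.tsum_le_tsum fun p => ?_
    simp only [hb]
    split_ifs with hp
    · simp
    · rw [mul_comm]; exact mul_le_mul_right (not_le.1 hp).le _
  have hKM : K * M = 2 * E := ENNReal.div_mul_cancel hM0 hw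
  have hgood : K * M ≤ 2 * (K * ∑' p, w' p) := by
    have h1 : 2 * (K * M) ≤ 2 * (K * ∑' p, w' p) + K * M := by
      calc 2 * (K * M) = 2 * (K * ∑' p, w' p) + 2 * (K * ∑' p, b p) := by
            rw [hsum]; ring
        _ ≤ 2 * (K * ∑' p, w' p) + 2 * E := by gcongr
        _ = _ := by rw [hKM]
    rw [two_mul (K * M)] at h1
    exact (ENNReal.add_le_add_iff_right (ENNReal.mul_ne_top hKt hw)).1 h1
  have hgood' : M ≤ 2 * ∑' p, w' p := by
    rw [mul_left_comm] at hgood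
    exact (ENNReal.mul_le_mul_iff_right hK0 hKt).1 hgood
  have hw'le : ∀ p, w' p ≤ w p := fun p => by simp only [hw']; split_ifs <;> simp
  have hcap := tsum_le_mul_capacity η hη A w' z
    (fun p hp => hz p fun h0 => hp (le_antisymm (h0 ▸ hw'le p) (zero_le))) K
    (fun p hp => by
      have hpK : U p ≤ K := by
        by_contra hc; apply hp; simp [hw', hc]
      exact (ENNReal.tsum_le_tsum fun q => mul_le_mul_left (hw'le q) _).trans hpK)
  calc M ^ 2 = M * M := sq M
    _ ≤ M * (2 * (K * ENNReal.ofReal (capacity η A))) := by gcongr; exact hgood'.trans (by gcongr)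
    _ = 2 * (K * M) * ENNReal.ofReal (capacity η A) := by ring
    _ = 4 * E * ENNReal.ofReal (capacity η A) := by rw [hKM]; ring

/-! ### An upper bound for the capacity of a subset of a box -/

/-- The points all of whose coordinates are at most `r` in absolute value. -/
def box (d r : ℕ) : Finset (Lattice d) := Fintype.piFinset fun _ => Finset.Icc (-(r : ℤ)) r

theorem mem_box {r : ℕ} {x : Lattice d} : x ∈ box d r ↔ ∀ i, |x i| ≤ r := by
  simp [box, abs_le]

theorem card_box (d r : ℕ) : (box d r).card = (2 * r + 1) ^ d := by
  simp only [box, Fintype.card_piFinset, Int.card_Icc, Finset.prod_const, Finset.card_univ,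
    Fintype.card_fin]
  congr 1; omega

/-- Sum the last-exit inequality over starting points in the double box. That box contains `z - box
d r` for each `z ∈ A`, and each of the first `N` step laws puts mass at least one half on `box d r`,
so `escape η A z` is counted with weight at least `N / 2`. -/
theorem capacity_mul_le_card_box (η : Measure (Lattice d)) [IsProbabilityMeasure η] {r N : ℕ}
    (hN : ∀ n < N, 2⁻¹ ≤ stepLaw η n (box d r)) (A : Finset (Lattice d)) (hA : A ⊆ box d r) :
    ENNReal.ofReal (capacity η A) * N ≤ 2 * ((4 * r + 1 : ℕ) : ℝ≥0∞) ^ d := by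
  have h1 : ∑ x ∈ box d (2 * r), ∑ z ∈ A, green η (z - x) * escape η A z ≤
      ((4 * r + 1 : ℕ) : ℝ≥0∞) ^ d := by
    calc _ ≤ ∑ x ∈ box d (2 * r), (1 : ℝ≥0∞) :=
          Finset.sum_le_sum fun x _ => sum_green_mul_escape_le_one η A x
      _ = _ := by
        rw [Finset.sum_const, card_box, nsmul_eq_mul, mul_one, ← mul_assoc]; norm_num
  have h2 : ∀ z ∈ A, (N : ℝ≥0∞) * 2⁻¹ ≤ ∑ x ∈ box d (2 * r), green η (z - x) := by
    intro z hz
    have h3 : ∀ n < N, (2⁻¹ : ℝ≥0∞) ≤ ∑ x ∈ box d (2 * r), stepLaw η n {z - x} := by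
      intro n hn
      refine (hN n hn).trans ?_
      have hsub : (box d r : Set (Lattice d)) ⊆ ⋃ x ∈ box d (2 * r), {z - x} := by
        intro y hy
        simp only [Set.mem_iUnion, Set.mem_singleton_iff, exists_prop]
        refine ⟨z - y, ?_, by abel⟩
        have hy' := mem_box.1 hy
        have hz' := mem_box.1 (hA hz)
        refine mem_box.2 fun i => ?_
        have := (abs_sub (z i) (y i)).trans (add_le_add (hz' i) (hy' i))
        push_cast; simp only [Pi.sub_apply]; linarith
      exact (measure_mono hsub).trans (measure_biUnion_finset_le _ _)
    calc (N : ℝ≥0∞) * 2⁻¹ = ∑ n ∈ Finset.range N, 2⁻¹ := by simp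
      _ ≤ ∑ n ∈ Finset.range N, ∑ x ∈ box d (2 * r), stepLaw η n {z - x} :=
        Finset.sum_le_sum fun n hn => h3 n (Finset.mem_range.1 hn)
      _ = ∑ x ∈ box d (2 * r), ∑ n ∈ Finset.range N, stepLaw η n {z - x} := Finset.sum_comm
      _ ≤ _ := Finset.sum_le_sum fun x _ => ENNReal.sum_le_tsum _
  rw [ofReal_capacity, Finset.sum_mul]
  calc ∑ z ∈ A, escape η A z * N
      = 2 * ∑ z ∈ A, escape η A z * (N * 2⁻¹) := by
        rw [Finset.mul_sum]
        refine Finset.sum_congr rfl fun z _ => ?_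
        rw [mul_comm (N : ℝ≥0∞), mul_left_comm 2, ← mul_assoc 2,
          ENNReal.mul_inv_cancel two_ne_zero ENNReal.ofNat_ne_top, one_mul]
    _ ≤ 2 * ∑ z ∈ A, escape η A z * ∑ x ∈ box d (2 * r), green η (z - x) := by
        gcongr with z hz; exact h2 z hz
    _ = 2 * ∑ x ∈ box d (2 * r), ∑ z ∈ A, green η (z - x) * escape η A z := by
        rw [Finset.sum_comm]
        simp only [Finset.mul_sum, mul_comm]
    _ ≤ _ := by gcongr

theorem toEuclidean_add (x y : Lattice d) : toEuclidean (x + y) = toEuclidean x + toEuclidean y := by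
  ext i; simp [toEuclidean]

theorem abs_le_norm_toEuclidean (x : Lattice d) (i : Fin d) : |(x i : ℝ)| ≤ ‖toEuclidean x‖ := by
  simpa [toEuclidean] using PiLp.norm_apply_le (toEuclidean x) i

theorem lintegral_sq_norm_stepLaw (η : Measure (Lattice d)) [IsProbabilityMeasure η]
    (h2 : Integrable (fun x => ‖toEuclidean x‖ ^ 2) η) (hmean : ∫ x, toEuclidean x ∂η = 0)
    (n : ℕ) :
    ∫⁻ x, ENNReal.ofReal (‖toEuclidean x‖ ^ 2) ∂stepLaw η n =
      ENNReal.ofReal (n * ∫ x, ‖toEuclidean x‖ ^ 2 ∂η) := by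
  set s := ∫ x, ‖toEuclidean x‖ ^ 2 ∂η with hs
  have hs0 : 0 ≤ s := integral_nonneg fun _ => by positivity
  have hInt : Integrable (fun x : Lattice d => toEuclidean x) η := by
    refine (h2.add (integrable_const 1)).mono' (Measurable.of_discrete).aestronglyMeasurable ?_
    exact ae_of_all _ fun x => by
      simp only [Pi.add_apply]; nlinarith [sq_nonneg (‖toEuclidean x‖ - 1)]
  -- The cross term vanishes as the jumps are centred. The free constant `c` lets the induction on
  -- time collect the second moments of the jumps.
  have key : ∀ c : ℝ, 0 ≤ c → ∀ x : Lattice d,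
      ∫⁻ y, ENNReal.ofReal (‖toEuclidean (x + y)‖ ^ 2 + c) ∂η =
        ENNReal.ofReal (‖toEuclidean x‖ ^ 2 + (c + s)) := by
    intro c hc x
    have hin : Integrable (fun y : Lattice d => inner ℝ (toEuclidean x) (toEuclidean y)) η :=
      hInt.const_inner _
    have heq : (fun y => ‖toEuclidean (x + y)‖ ^ 2 + c) = fun y : Lattice d =>
        (‖toEuclidean x‖ ^ 2 + c) + (2 * inner ℝ (toEuclidean x) (toEuclidean y) +
          ‖toEuclidean y‖ ^ 2) := by
      funext y; rw [toEuclidean_add, norm_add_sq_real]; ring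
    have hi2 : Integrable (fun y : Lattice d => 2 * inner ℝ (toEuclidean x) (toEuclidean y) +
          ‖toEuclidean y‖ ^ 2) η := (hin.const_mul 2).add h2
    rw [← ofReal_integral_eq_lintegral_ofReal]
    · rw [heq, integral_add (integrable_const _) hi2, integral_add (hin.const_mul 2) h2,
        integral_const_mul, integral_inner hInt, hmean, inner_zero_right, integral_const]
      simp only [probReal_univ, one_smul, mul_zero, zero_add]
      congr 1; ring
    · rw [heq]; exact (integrable_const _).add hi2
    · exact ae_of_all _ fun y => by positivity
  have main : ∀ n : ℕ, ∀ c : ℝ, 0 ≤ c →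
      ∫⁻ x, ENNReal.ofReal (‖toEuclidean x‖ ^ 2 + c) ∂stepLaw η n =
        ENNReal.ofReal (n * s + c) := by
    intro n
    induction n with
    | zero =>
      intro c hc
      have : toEuclidean (0 : Lattice d) = 0 := by ext i; simp [toEuclidean]
      simp [lintegral_stepLaw_zero, this]
    | succ n ih =>
      intro c hc
      rw [lintegral_stepLaw_succ']
      simp only [key c hc]
      rw [ih (c + s) (by positivity)]
      congr 1; push_cast; ring
  simpa using main n 0 le_rfl

/-- The capacity of a subset of a box of radius `r` is at most of order `r ^ (d - 2)`. -/
theorem exists_capacity_le (η : Measure (Lattice d)) [IsProbabilityMeasure η]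
    (h2 : Integrable (fun x => ‖toEuclidean x‖ ^ 2) η) (hmean : ∫ x, toEuclidean x ∂η = 0) :
    ∃ C : ℝ, 0 < C ∧ ∀ r : ℕ, 1 ≤ r → ∀ A : Finset (Lattice d), A ⊆ box d r →
      capacity η A ≤ C * ((r : ℝ) ^ d / (r : ℝ) ^ 2) := by
  set s := ∫ x, ‖toEuclidean x‖ ^ 2 ∂η with hs
  have hs0 : 0 ≤ s := integral_nonneg fun _ => by positivity
  refine ⟨2 * 5 ^ d * (2 * s + 1), by positivity, fun r hr A hA => ?_⟩
  have hr' : (1 : ℝ) ≤ r := by exact_mod_cast hr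
  -- For `n < N` the second moment `n * s` is at most `r ^ 2 / 2`, so Chebyshev leaves mass at least
  -- one half in the box. The `+ 1` in the denominator keeps it positive.
  set N := ⌊(r : ℝ) ^ 2 / (2 * s + 1)⌋₊ + 1 with hN
  have hNr : (r : ℝ) ^ 2 / (2 * s + 1) ≤ N := by
    rw [hN]; push_cast; exact (Nat.lt_floor_add_one _).le
  have hstep : ∀ n < N, 2⁻¹ ≤ stepLaw η n (box d r) := by
    intro n hn
    have hn' : (n : ℝ) ≤ (r : ℝ) ^ 2 / (2 * s + 1) :=
      (Nat.le_floor_iff (by positivity)).1 (Nat.lt_succ_iff.1 hn)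
    have hns : n * s ≤ (r : ℝ) ^ 2 * 2⁻¹ := by
      rw [le_div_iff₀ (by positivity)] at hn'
      nlinarith [(Nat.cast_nonneg n : (0 : ℝ) ≤ n)]
    have hc : stepLaw η n (box d r : Set (Lattice d))ᶜ ≤ 2⁻¹ := by
      have hm := mul_meas_ge_le_lintegral (μ := stepLaw η n)
        (f := fun x : Lattice d => ENNReal.ofReal (‖toEuclidean x‖ ^ 2)) .of_discrete
        (ENNReal.ofReal ((r : ℝ) ^ 2))
      rw [lintegral_sq_norm_stepLaw η h2 hmean, ← hs] at hm
      have hsub : (box d r : Set (Lattice d))ᶜ ⊆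
          {x | ENNReal.ofReal ((r : ℝ) ^ 2) ≤ ENNReal.ofReal (‖toEuclidean x‖ ^ 2)} := by
        intro x hx
        have hx' : ¬ ∀ i, |x i| ≤ r := fun h => hx (mem_box.2 h)
        push Not at hx'
        obtain ⟨i, hi⟩ := hx'
        have hi' : (r : ℝ) < |(x i : ℝ)| := by exact_mod_cast hi
        exact ENNReal.ofReal_le_ofReal (pow_le_pow_left₀ (by positivity)
          (hi'.le.trans (abs_le_norm_toEuclidean x i)) 2)
      have h3 : ENNReal.ofReal ((r : ℝ) ^ 2) * stepLaw η n (box d r : Set (Lattice d))ᶜ ≤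
          ENNReal.ofReal ((r : ℝ) ^ 2) * 2⁻¹ := by
        refine (mul_le_mul_right (measure_mono hsub) _).trans (hm.trans ?_)
        refine (ENNReal.ofReal_le_ofReal hns).trans (le_of_eq ?_)
        rw [ENNReal.ofReal_mul (by positivity), ENNReal.ofReal_inv_of_pos two_pos]; norm_num
      exact (ENNReal.mul_le_mul_iff_right (by simp; omega) ENNReal.ofReal_ne_top).1 h3
    have hadd := prob_add_prob_compl (μ := stepLaw η n) (s := (box d r : Set (Lattice d)))
      .of_discrete
    have h4 : (2⁻¹ : ℝ≥0∞) + 2⁻¹ ≤ stepLaw η n (box d r) + 2⁻¹ := by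
      rw [ENNReal.inv_two_add_inv_two, ← hadd]; gcongr
    exact (ENNReal.add_le_add_iff_right (by simp)).1 h4
  have hmain := capacity_mul_le_card_box η hstep A hA
  have hcap0 := capacity_nonneg η A
  have hreal : capacity η A * N ≤ 2 * (4 * r + 1) ^ d := by
    have := ENNReal.toReal_mono (by finiteness) hmain
    simp only [ENNReal.toReal_mul, ENNReal.toReal_ofReal hcap0, ENNReal.toReal_natCast,
      ENNReal.toReal_pow, ENNReal.toReal_ofNat] at this
    exact_mod_cast this
  have h5 : (2 * (4 * r + 1) ^ d : ℝ) ≤ 2 * 5 ^ d * r ^ d := by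
    rw [mul_assoc, ← mul_pow]; gcongr; linarith
  have h6 : capacity η A * ((r : ℝ) ^ 2 / (2 * s + 1)) ≤ 2 * 5 ^ d * r ^ d :=
    ((mul_le_mul_of_nonneg_left hNr hcap0).trans hreal).trans h5
  rw [mul_div_assoc', div_le_iff₀ (by positivity)] at h6
  rw [mul_div_assoc', le_div_iff₀ (by positivity)]
  linarith

end

section

variable {d : ℕ}

/-! ### Fourier analysis on the lattice -/

/-- The character `x ↦ exp (2πi t·x)` of the lattice. -/
def character (t : Fin d → ℝ) (x : Lattice d) : ℂ :=
  Complex.exp ((2 * Real.pi * ∑ j, t j * x j : ℝ) * Complex.I)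

theorem norm_character (t : Fin d → ℝ) (x : Lattice d) : ‖character t x‖ = 1 :=
  Complex.norm_exp_ofReal_mul_I _

theorem character_add (t : Fin d → ℝ) (x y : Lattice d) :
    character t (x + y) = character t x * character t y := by
  rw [character, character, character, ← Complex.exp_add]
  congr 1
  simp only [Pi.add_apply, Int.cast_add, mul_add, Finset.sum_add_distrib]
  push_cast; ring

theorem character_zero (t : Fin d → ℝ) : character t (0 : Lattice d) = 1 := by
  simp [character]

theorem continuous_character (x : Lattice d) : Continuous fun t => character t x := by
  unfold character; fun_prop

theorem integrable_character (ρ : Measure (Lattice d)) [IsFiniteMeasure ρ] (t : Fin d → ℝ) :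
    Integrable (character t) ρ :=
  (integrable_const (1 : ℝ)).mono' Measurable.of_discrete.aestronglyMeasurable
    (ae_of_all _ fun x => (norm_character t x).le)

/-- The Fourier transform of a measure on the lattice. -/
def fourierTransform (ρ : Measure (Lattice d)) (t : Fin d → ℝ) : ℂ := ∫ x, character t x ∂ρ

theorem fourierTransform_conv (ρ σ : Measure (Lattice d)) [IsFiniteMeasure ρ] [IsFiniteMeasure σ]
    (t : Fin d → ℝ) :
    fourierTransform (ρ ∗ σ) t = fourierTransform ρ t * fourierTransform σ t := by
  unfold fourierTransform
  rw [integral_conv (integrable_character _ t)]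
  simp only [character_add, integral_const_mul, integral_mul_const]

theorem fourierTransform_stepLaw_mul (η : Measure (Lattice d)) [IsProbabilityMeasure η]
    (N q : ℕ) (t : Fin d → ℝ) :
    fourierTransform (stepLaw η (N * q)) t = fourierTransform (stepLaw η N) t ^ q := by
  induction q with
  | zero => simp [stepLaw, fourierTransform, character_zero]
  | succ q ih => rw [Nat.mul_succ, stepLaw_add, fourierTransform_conv, ih, pow_succ]

/-- Lebesgue measure on the unit cube. -/
def cubeMeasure (d : ℕ) : Measure (Fin d → ℝ) :=
  Measure.pi fun _ => volume.restrict (Set.Ioc 0 1)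

instance : IsProbabilityMeasure (volume.restrict (Set.Ioc (0 : ℝ) 1)) := ⟨by simp⟩

instance : IsProbabilityMeasure (cubeMeasure d) := by unfold cubeMeasure; infer_instance

theorem integral_exp_int (n : ℤ) :
    ∫ t in Set.Ioc (0 : ℝ) 1, Complex.exp ((2 * Real.pi * (t * n) : ℝ) * Complex.I) =
      if n = 0 then 1 else 0 := by
  split_ifs with hn
  · simp [hn]
  · rw [← intervalIntegral.integral_of_le zero_le_one]
    have hc : (2 * Real.pi * n * Complex.I : ℂ) ≠ 0 := by
      simp [Real.pi_ne_zero, hn]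
    have : ∀ t : ℝ, Complex.exp ((2 * Real.pi * (t * n) : ℝ) * Complex.I) =
        Complex.exp ((2 * Real.pi * n * Complex.I) * t) := by
      intro t; congr 1; push_cast; ring
    simp only [this]
    rw [integral_exp_mul_complex hc]
    have h1 : Complex.exp (2 * Real.pi * n * Complex.I * (1 : ℝ)) = 1 := by
      rw [Complex.exp_eq_one_iff]; exact ⟨n, by push_cast; ring⟩
    rw [h1]; simp

theorem integral_character (x : Lattice d) :
    ∫ t, character t x ∂cubeMeasure d = if x = 0 then 1 else 0 := by
  have h : ∀ t : Fin d → ℝ, character t x =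
      ∏ j, Complex.exp ((2 * Real.pi * (t j * x j) : ℝ) * Complex.I) := by
    intro t
    rw [character, ← Complex.exp_sum]
    congr 1
    rw [Finset.mul_sum]; push_cast; rw [Finset.sum_mul]
  simp only [h]
  rw [cubeMeasure, integral_fintype_prod_eq_prod (𝕜 := ℂ)
    (f := fun j (s : ℝ) => Complex.exp ((2 * Real.pi * (s * x j) : ℝ) * Complex.I))]
  simp only [integral_exp_int]
  rw [Finset.prod_ite_zero]
  simp [funext_iff]

/-- Fourier inversion; the phase at `z` disappears in the norm. -/
theorem measureReal_singleton_le_integral (ρ : Measure (Lattice d)) [IsProbabilityMeasure ρ]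
    (z : Lattice d) :
    ρ.real {z} ≤ ∫ t, ‖fourierTransform ρ t‖ ∂cubeMeasure d := by
  have hmeas : AEStronglyMeasurable (Function.uncurry fun (t : Fin d → ℝ) (x : Lattice d) =>
      character t (x - z)) ((cubeMeasure d).prod ρ) := by
    refine Measurable.aestronglyMeasurable ?_
    exact measurable_from_prod_countable_left fun x => (continuous_character (x - z)).measurable
  have hInt : Integrable (Function.uncurry fun (t : Fin d → ℝ) (x : Lattice d) =>
      character t (x - z)) ((cubeMeasure d).prod ρ) :=
    (integrable_const (1 : ℝ)).mono' hmeas (ae_of_all _ fun p => (norm_character _ _).le)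
  have h1 : ((ρ.real {z} : ℝ) : ℂ) =
      ∫ t, ∫ x, character t (x - z) ∂ρ ∂cubeMeasure d := by
    rw [integral_integral_swap hInt]
    simp only [integral_character, sub_eq_zero]
    have : (fun x : Lattice d => if x = z then (1 : ℂ) else 0) = Set.indicator {z} 1 := by
      funext x; simp [Set.indicator]
    rw [this, integral_indicator (.singleton z)]
    simp [Measure.real]
  have h2 : ∀ t : Fin d → ℝ, ‖∫ x, character t (x - z) ∂ρ‖ = ‖fourierTransform ρ t‖ := by
    intro t
    simp only [sub_eq_add_neg, character_add, integral_mul_const, norm_mul, norm_character, mul_one]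
    rfl
  calc ρ.real {z} = ‖((ρ.real {z} : ℝ) : ℂ)‖ := by
        rw [Complex.norm_real, Real.norm_of_nonneg measureReal_nonneg]
    _ ≤ ∫ t, ‖∫ x, character t (x - z) ∂ρ‖ ∂cubeMeasure d := by
        rw [h1]; exact norm_integral_le_integral_norm _
    _ = _ := by simp only [h2]

/-- Two atoms of mass at least `p` at `0` and at `k e_j` keep the Fourier transform away from the
unit circle. -/
theorem norm_fourierTransform_le (ρ : Measure (Lattice d)) [IsProbabilityMeasure ρ] {p : ℝ}
    (k : ℕ) (hk : 1 ≤ k) (j : Fin d) (h0 : p ≤ ρ.real {0})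
    (h1 : p ≤ ρ.real {Pi.single j (k : ℤ)}) (t : Fin d → ℝ) :
    ‖fourierTransform ρ t‖ ≤ Real.exp (-p * Real.sin (Real.pi * (k * t j)) ^ 2) := by
  by_cases hp : p ≤ 0
  · refine le_trans (b := 1) ?_ (Real.one_le_exp (by nlinarith [sq_nonneg (Real.sin (Real.pi * (k * t j)))]))
    refine (norm_integral_le_integral_norm _).trans ?_
    simp [norm_character]
  push Not at hp
  set a : Lattice d := Pi.single j (k : ℤ) with ha
  have ha0 : (0 : Lattice d) ≠ a := by
    intro h
    have := congrFun h j
    simp [ha] at this; omega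
  -- The phase `u` rotates the transform onto the nonnegative reals. Then `1 - ‖fourierTransform ρ
  -- t‖` is the integral of the nonnegative function `F`, which the two atoms bound from below.
  obtain ⟨u, hu, hφ⟩ : ∃ u : ℂ, ‖u‖ = 1 ∧ (‖fourierTransform ρ t‖ : ℂ) = u * fourierTransform ρ t := by
    by_cases h : fourierTransform ρ t = 0
    · exact ⟨1, by simp, by simp [h]⟩
    · refine ⟨‖fourierTransform ρ t‖ / fourierTransform ρ t, ?_, by field_simp⟩
      rw [norm_div, Complex.norm_real, norm_norm, div_self (norm_ne_zero_iff.2 h)]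
  set F : Lattice d → ℝ := fun x => 1 - (u * character t x).re with hF
  have hF0 : ∀ x, 0 ≤ F x := fun x => by
    have := Complex.re_le_norm (u * character t x)
    rw [norm_mul, hu, norm_character, one_mul] at this
    simp only [hF]; linarith
  have hIu : Integrable (fun x => u * character t x) ρ := (integrable_character ρ t).const_mul u
  have hIre : Integrable (fun x => (u * character t x).re) ρ := hIu.re
  have hFi : Integrable F ρ := (integrable_const 1).sub hIre
  have hInt : ∫ x, F x ∂ρ = 1 - ‖fourierTransform ρ t‖ := by
    have hre : ∫ x, (u * character t x).re ∂ρ = ‖fourierTransform ρ t‖ := by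
      have : ∫ x, (u * character t x).re ∂ρ = (∫ x, u * character t x ∂ρ).re := integral_re hIu
      rw [this, integral_const_mul]
      rw [← Complex.ofReal_re ‖fourierTransform ρ t‖, hφ]; rfl
    simp only [hF]
    rw [integral_sub (integrable_const 1) hIre, hre]; simp
  have hlow : ρ.real {0} * F 0 + ρ.real {a} * F a ≤ ∫ x, F x ∂ρ := by
    have : ∫ x in (({0, a} : Finset (Lattice d)) : Set (Lattice d)), F x ∂ρ ≤ ∫ x, F x ∂ρ :=
      setIntegral_le_integral hFi (ae_of_all _ hF0)
    rw [setIntegral_finset _ hFi.integrableOn, Finset.sum_pair ha0] at this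
    simpa using this
  -- Uniform in the unknown phase `u`; the left side equals `2 - 2|cos|`, which dominates `sin ^ 2`.
  have hFF : 2 - ‖1 + character t a‖ ≤ F 0 + F a := by
    have := Complex.re_le_norm (u * (1 + character t a))
    rw [norm_mul, hu, one_mul, mul_add, Complex.add_re] at this
    simp only [hF, character_zero]; linarith
  have hcos : ‖1 + character t a‖ = 2 * |Real.cos (Real.pi * (k * t j))| := by
    set s := Real.pi * (k * t j) with hs
    have hch : character t a = Complex.exp ((2 * s : ℝ) * Complex.I) := by
      rw [character]; congr 3
      rw [Finset.sum_eq_single j]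
      · simp [ha, hs]; ring
      · intro b _ hb; simp [ha, hb]
      · simp
    have : 1 + character t a = Complex.exp (s * Complex.I) * (2 * Real.cos s : ℝ) := by
      rw [hch]
      push_cast
      rw [Complex.two_cos, mul_add, ← Complex.exp_add, ← Complex.exp_add]
      simp only [neg_mul, add_neg_cancel, Complex.exp_zero]
      rw [add_comm]; congr 2; ring
    rw [this, norm_mul, Complex.norm_exp_ofReal_mul_I, one_mul, Complex.norm_real, Real.norm_eq_abs,
      abs_mul, abs_two]
  have hsin : Real.sin (Real.pi * (k * t j)) ^ 2 ≤ 2 - 2 * |Real.cos (Real.pi * (k * t j))| := by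
    rw [Real.sin_sq, ← sq_abs (Real.cos _)]
    nlinarith [sq_nonneg (1 - |Real.cos (Real.pi * (k * t j))|)]
  have hfin : p * Real.sin (Real.pi * (k * t j)) ^ 2 ≤ 1 - ‖fourierTransform ρ t‖ := by
    rw [← hInt]
    refine le_trans ?_ hlow
    rw [hcos] at hFF
    calc p * Real.sin (Real.pi * (k * t j)) ^ 2 ≤ p * (F 0 + F a) :=
          mul_le_mul_of_nonneg_left (hsin.trans hFF) hp.le
      _ = p * F 0 + p * F a := by ring
      _ ≤ _ := add_le_add (mul_le_mul_of_nonneg_right h0 (hF0 0))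
          (mul_le_mul_of_nonneg_right h1 (hF0 a))
  have := Real.add_one_le_exp (-p * Real.sin (Real.pi * (k * t j)) ^ 2)
  linarith

/-- Periodicity removes `k` and moves the interval to `[-1/2, 1/2]`, where Jordan's inequality `|sin
(πt)| ≥ 2|t|` gives a Gaussian majorant. -/
theorem setIntegral_exp_sin_sq_le {b : ℝ} (hb : 0 < b) (k : ℕ) (hk : 1 ≤ k) :
    ∫ t in Set.Ioc (0 : ℝ) 1, Real.exp (-b * Real.sin (Real.pi * (k * t)) ^ 2) ≤
      √(Real.pi / (4 * b)) := by
  set f : ℝ → ℝ := fun s => Real.exp (-b * Real.sin (Real.pi * s) ^ 2) with hf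
  have hper : Function.Periodic f 1 := by
    intro s; simp only [hf, mul_add, mul_one, Real.sin_add_pi, neg_sq]
  have hcont : Continuous f := by simp only [hf]; fun_prop
  have hk' : (k : ℝ) ≠ 0 := by positivity
  have h1 : ∫ t in Set.Ioc (0 : ℝ) 1, Real.exp (-b * Real.sin (Real.pi * (k * t)) ^ 2) =
      ∫ t in (0 : ℝ)..1, f t := by
    rw [← intervalIntegral.integral_of_le zero_le_one]
    have : ∫ t in (0 : ℝ)..1, f (k * t) = (k : ℝ)⁻¹ • ∫ t in (k : ℝ) * 0..k * 1, f t :=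
      intervalIntegral.integral_comp_mul_left f hk'
    change ∫ t in (0 : ℝ)..1, f (k * t) = _
    rw [this, mul_zero, mul_one]
    have h2 := hper.intervalIntegral_add_zsmul_eq k 0 fun _ _ => hcont.intervalIntegrable _ _
    simp only [zero_add, zsmul_eq_mul, Int.cast_natCast, mul_one] at h2
    rw [h2, smul_eq_mul, ← mul_assoc, inv_mul_cancel₀ hk', one_mul]
  have h2 : ∫ t in (0 : ℝ)..1, f t = ∫ t in (-(1 / 2) : ℝ)..1 / 2, f t := by
    have := hper.intervalIntegral_add_eq 0 (-(1 / 2))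
    rw [zero_add] at this
    rw [this]; norm_num
  have hg : Integrable (fun s : ℝ => Real.exp (-(4 * b) * s ^ 2)) :=
    integrable_exp_neg_mul_sq (by positivity)
  have h3 : ∫ t in (-(1 / 2) : ℝ)..1 / 2, f t ≤
      ∫ t in (-(1 / 2) : ℝ)..1 / 2, Real.exp (-(4 * b) * t ^ 2) := by
    refine intervalIntegral.integral_mono_on (by norm_num) (hcont.intervalIntegrable _ _)
      hg.intervalIntegrable fun t ht => ?_
    refine Real.exp_le_exp.2 ?_
    have hab : |Real.pi * t| ≤ Real.pi / 2 := by
      rw [abs_mul, abs_of_pos Real.pi_pos]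
      have : |t| ≤ 1 / 2 := abs_le.2 ht
      nlinarith [Real.pi_pos]
    have hs := Real.mul_abs_le_abs_sin hab
    have he : 2 / Real.pi * |Real.pi * t| = 2 * |t| := by
      rw [abs_mul, abs_of_pos Real.pi_pos]; field_simp
    rw [he] at hs
    have hsq : 4 * t ^ 2 ≤ Real.sin (Real.pi * t) ^ 2 := by
      rw [← sq_abs t, ← sq_abs (Real.sin _)]; nlinarith [abs_nonneg t]
    nlinarith
  rw [h1, h2]
  refine h3.trans ?_
  rw [intervalIntegral.integral_of_le (by norm_num), ← integral_gaussian]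
  exact setIntegral_le_integral hg (ae_of_all _ fun _ => (Real.exp_pos _).le)

/-! ### Heat kernel bound for irreducible walks -/

theorem stepLaw_singleton_le_of_le (η : Measure (Lattice d)) [IsProbabilityMeasure η]
    {n m : ℕ} (h : n ≤ m) {B : ℝ≥0∞} (hB : ∀ x, stepLaw η n {x} ≤ B) (x : Lattice d) :
    stepLaw η m {x} ≤ B := by
  obtain ⟨j, rfl⟩ := Nat.exists_eq_add_of_le' h
  rw [stepLaw_add_singleton]
  calc _ ≤ ∫⁻ _, B ∂stepLaw η j := lintegral_mono fun y => hB _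
    _ = B := by simp

theorem stepLaw_mul_pos (η : Measure (Lattice d)) [IsProbabilityMeasure η] {n : ℕ}
    {x : Lattice d} (h : 0 < stepLaw η n {x}) (q : ℕ) : 0 < stepLaw η (q * n) {q • x} := by
  induction q with
  | zero => simp [stepLaw]
  | succ q ih =>
    rw [Nat.succ_mul, succ_nsmul]
    exact lt_of_lt_of_le (ENNReal.mul_pos ih.ne' h.ne') (stepLaw_mul_le η _ _ _ _)

/-- At some time an irreducible walk can be at the origin, and on each of the coordinate axes at
a common distance from the origin. -/
theorem IsIrreducible.exists_atoms (η : Measure (Lattice d)) [IsProbabilityMeasure η]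
    (hd : 0 < d) (hη : IsIrreducible η) :
    ∃ N k : ℕ, 1 ≤ N ∧ 1 ≤ k ∧ 0 < stepLaw η N {0} ∧
      ∀ j, 0 < stepLaw η N {Pi.single j (k : ℤ)} := by
  have hirr : ∀ x : Lattice d, ∃ n, 0 < stepLaw η n {x} := by
    intro x
    obtain ⟨n, hn⟩ := hη 0 x
    exact ⟨n, by simpa [walkLaw_eval] using hn⟩
  have hne : ∀ n, ∀ x : Lattice d, x ≠ 0 → 0 < stepLaw η n {x} → 1 ≤ n := by
    intro n x hx h
    by_contra hn
    obtain rfl : n = 0 := by omega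
    rw [stepLaw_zero_singleton, if_neg hx] at h
    exact lt_irrefl _ h
  have hs : ∀ j : Fin d, (Pi.single j 1 : Lattice d) ≠ 0 := fun j h => by
    have := congrFun h j; simp at this
  choose m hm using fun j : Fin d => hirr (Pi.single j 1)
  have hm1 : ∀ j, 1 ≤ m j := fun j => hne _ _ (hs j) (hm j)
  obtain ⟨k, hk1, hk⟩ : ∃ k, 1 ≤ k ∧ 0 < stepLaw η k {0} := by
    let j : Fin d := ⟨0, hd⟩
    obtain ⟨n, hn⟩ := hirr (-Pi.single j 1)
    refine ⟨m j + n, by have := hm1 j; omega, ?_⟩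
    have := stepLaw_mul_le η (m j) n (Pi.single j 1) (-Pi.single j 1)
    rw [add_neg_cancel] at this
    exact lt_of_lt_of_le (ENNReal.mul_pos (hm j).ne' hn.ne') this
  -- The point `k e_j` is reached in `k * m j` steps. Since the distance `k` is also the length of a
  -- loop at the origin, the time missing up to `(∏ j, m j) * k` is a multiple of `k` and is filled
  -- by `∏ j, m j - m j` loops.
  refine ⟨(∏ j, m j) * k, k, Nat.mul_pos (Finset.prod_pos fun j _ => hm1 j) hk1, hk1,
    by simpa using stepLaw_mul_pos η hk (∏ j, m j), fun j => ?_⟩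
  have hle : m j ≤ ∏ j, m j :=
    Nat.le_of_dvd (Finset.prod_pos fun j _ => hm1 j) (Finset.dvd_prod_of_mem m (Finset.mem_univ j))
  have h1 := stepLaw_mul_pos η (hm j) k
  have h2 := stepLaw_mul_pos η hk (∏ j, m j - m j)
  have h3 := lt_of_lt_of_le (ENNReal.mul_pos h1.ne' h2.ne') (stepLaw_mul_le η _ _ _ _)
  have h4 : k * m j + (∏ j, m j - m j) * k = (∏ j, m j) * k := by
    rw [mul_comm k, ← add_mul, Nat.add_sub_cancel' hle]
  rw [h4] at h3
  convert h3 using 3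
  ext i
  by_cases hi : i = j
  · subst hi; simp
  · simp [hi]

/-- On-diagonal heat kernel bound for an irreducible walk. -/
theorem IsIrreducible.exists_stepLaw_le (η : Measure (Lattice d)) [IsProbabilityMeasure η]
    (hd : 0 < d) (hη : IsIrreducible η) :
    ∃ C : ℝ, 0 < C ∧ ∀ (n : ℕ) (x : Lattice d),
      stepLaw η n {x} ≤ ENNReal.ofReal (C * ((n : ℝ) + 1) ^ (-((d : ℝ) / 2))) := by
  obtain ⟨N, k, hN, hk, h0, h1⟩ := hη.exists_atoms η hd
  obtain ⟨p, hp, hp0, hp1⟩ : ∃ p : ℝ, 0 < p ∧ p ≤ (stepLaw η N).real {0} ∧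
      ∀ j, p ≤ (stepLaw η N).real {Pi.single j (k : ℤ)} := by
    have hd' : Nonempty (Fin d) := ⟨⟨0, hd⟩⟩
    obtain ⟨j0, hj0⟩ := Finite.exists_min fun j : Fin d => (stepLaw η N).real {Pi.single j (k : ℤ)}
    refine ⟨min ((stepLaw η N).real {0}) ((stepLaw η N).real {Pi.single j0 (k : ℤ)}),
      lt_min ?_ ?_, min_le_left _ _, fun j => (min_le_right _ _).trans (hj0 j)⟩
    · exact ENNReal.toReal_pos h0.ne' (measure_ne_top _ _)
    · exact ENNReal.toReal_pos (h1 j0).ne' (measure_ne_top _ _)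
  -- Of the `d * q` factors of the transform, `q` are assigned to each coordinate and bounded by the
  -- decay in that coordinate, so that the integral over the cube factorises.
  have hmain : ∀ q : ℕ, 1 ≤ q → ∀ x, (stepLaw η (N * (d * q))).real {x} ≤
      √(Real.pi / (4 * (p * q))) ^ d := by
    intro q hq x
    have hq' : (0 : ℝ) < q := by exact_mod_cast hq
    refine (measureReal_singleton_le_integral _ x).trans ?_
    have hb : ∀ t : Fin d → ℝ, ‖fourierTransform (stepLaw η (N * (d * q))) t‖ ≤
        ∏ j, Real.exp (-(p * q) * Real.sin (Real.pi * (k * t j)) ^ 2) := by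
      intro t
      rw [fourierTransform_stepLaw_mul, norm_pow]
      calc ‖fourierTransform (stepLaw η N) t‖ ^ (d * q)
          = ∏ _j : Fin d, ‖fourierTransform (stepLaw η N) t‖ ^ q := by
            rw [Finset.prod_const, Finset.card_univ, Fintype.card_fin, ← pow_mul, mul_comm]
        _ ≤ ∏ j, Real.exp (-(p * q) * Real.sin (Real.pi * (k * t j)) ^ 2) := by
            refine Finset.prod_le_prod (fun _ _ => by positivity) fun j _ => ?_
            refine (pow_le_pow_left₀ (norm_nonneg _)
              (norm_fourierTransform_le _ k hk j hp0 (hp1 j) t) q).trans (le_of_eq ?_)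
            rw [← Real.exp_nat_mul]; congr 1; ring
    have hInt : Integrable (fun t : Fin d → ℝ =>
        ∏ j, Real.exp (-(p * q) * Real.sin (Real.pi * (k * t j)) ^ 2)) (cubeMeasure d) := by
      refine (integrable_const (1 : ℝ)).mono' (Continuous.aestronglyMeasurable (by fun_prop)) ?_
      refine ae_of_all _ fun t => ?_
      rw [Real.norm_of_nonneg (Finset.prod_nonneg fun _ _ => (Real.exp_pos _).le)]
      refine Finset.prod_le_one (fun _ _ => (Real.exp_pos _).le) fun j _ => Real.exp_le_one_iff.2 ?_
      have : 0 ≤ p * q * Real.sin (Real.pi * (k * t j)) ^ 2 := by positivity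
      linarith
    calc _ ≤ ∫ t, ∏ j, Real.exp (-(p * q) * Real.sin (Real.pi * (k * t j)) ^ 2) ∂cubeMeasure d :=
          integral_mono_of_nonneg (ae_of_all _ fun _ => norm_nonneg _) hInt (ae_of_all _ hb)
      _ = ∏ _j : Fin d, ∫ s in Set.Ioc (0 : ℝ) 1,
            Real.exp (-(p * q) * Real.sin (Real.pi * (k * s)) ^ 2) := by
          rw [cubeMeasure, integral_fintype_prod_eq_prod (𝕜 := ℝ)
            (f := fun _ (s : ℝ) => Real.exp (-(p * q) * Real.sin (Real.pi * (k * s)) ^ 2))]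
      _ ≤ ∏ _j : Fin d, √(Real.pi / (4 * (p * q))) := by
          refine Finset.prod_le_prod (fun _ _ => integral_nonneg fun _ => (Real.exp_pos _).le)
            fun _ _ => setIntegral_exp_sin_sq_le (by positivity) k hk
      _ = _ := by simp
  -- The summand `1` covers `n < N * d`, where the bound must exceed one; the other covers the rest,
  -- where `n + 1 ≤ 2 * N * d * q`.
  set D : ℝ := N * d * (1 + Real.pi / (2 * p)) with hD
  have hNd : (1 : ℝ) ≤ N * d := by exact_mod_cast Nat.mul_pos hN hd
  have hDpos : 0 < D := by positivity
  refine ⟨D ^ ((d : ℝ) / 2), by positivity, fun n x => ?_⟩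
  have hCeq : D ^ ((d : ℝ) / 2) * ((n : ℝ) + 1) ^ (-((d : ℝ) / 2)) =
      (D / (n + 1)) ^ ((d : ℝ) / 2) := by
    rw [Real.div_rpow hDpos.le (by positivity), Real.rpow_neg (by positivity)]; rfl
  rw [hCeq]
  have hn0 : (0 : ℝ) < (n : ℝ) + 1 := by positivity
  have hπp : 0 < Real.pi / (2 * p) := by positivity
  by_cases hq : n / (N * d) = 0
  · have hlt : n < N * d := by
      rcases Nat.div_eq_zero_iff.1 hq with h | h
      · exact absurd h (Nat.mul_pos hN hd).ne'
      · exact h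
    refine prob_le_one.trans ?_
    rw [← ENNReal.ofReal_one]
    refine ENNReal.ofReal_le_ofReal (Real.one_le_rpow ?_ (by positivity))
    rw [le_div_iff₀ hn0, one_mul]
    have : (n : ℝ) + 1 ≤ N * d := by exact_mod_cast hlt
    nlinarith
  · set q := n / (N * d) with hqdef
    have hq1 : 1 ≤ q := Nat.one_le_iff_ne_zero.2 hq
    have hq' : (1 : ℝ) ≤ q := by exact_mod_cast hq1
    have hle : N * (d * q) ≤ n := by rw [← mul_assoc]; exact Nat.mul_div_le n (N * d)
    refine stepLaw_singleton_le_of_le η hle (fun y => ?_) x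
    rw [← ENNReal.ofReal_toReal (measure_ne_top (stepLaw η (N * (d * q))) {y})]
    refine ENNReal.ofReal_le_ofReal ((hmain q hq1 y).trans ?_)
    have hup : (n : ℝ) + 1 ≤ N * d * (2 * q) := by
      have h3 : n < N * d * (q + 1) := Nat.lt_mul_div_succ n (Nat.mul_pos hN hd)
      have h4 : (n : ℝ) + 1 ≤ N * d * (q + 1) := by exact_mod_cast h3
      nlinarith
    rw [Real.sqrt_eq_rpow, ← Real.rpow_natCast, ← Real.rpow_mul (by positivity)]
    have : (1 / 2 * (d : ℝ)) = d / 2 := by ring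
    rw [this]
    refine Real.rpow_le_rpow (by positivity) ?_ (by positivity)
    rw [div_le_div_iff₀ (by positivity) hn0]
    have h5 : Real.pi * (n + 1) ≤ Real.pi * (N * d * (2 * q)) :=
      mul_le_mul_of_nonneg_left hup Real.pi_pos.le
    have h6 : D * (4 * (p * q)) = N * d * (2 * q) * (2 * p) + Real.pi * (N * d * (2 * q)) := by
      rw [hD]; field_simp; ring
    rw [h6]
    have : 0 ≤ N * d * (2 * q) * (2 * p) := by positivity
    linarith

end

section

variable {d : ℕ}

/-! ### Sums of powers -/

/-- Makes the tail sum in `tsum_tail_rpow_le` telescope; the mean value estimate comes from `1 + s ≤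
exp s`, used twice. -/
theorem mul_rpow_le_rpow_sub_rpow {a x : ℝ} (ha : 0 ≤ a) (hx : 0 < x) :
    a * (x + 1) ^ (-(1 + a)) ≤ x ^ (-a) - (x + 1) ^ (-a) := by
  have hx1 : 0 < x + 1 := by positivity
  have h1 : x ≤ (x + 1) * Real.exp (-(x + 1)⁻¹) := by
    have := Real.add_one_le_exp (-(x + 1)⁻¹)
    calc x = (x + 1) * (-(x + 1)⁻¹ + 1) := by field_simp; ring
      _ ≤ _ := by gcongr
  have h2 : (x + 1) ^ (-a) * Real.exp (a * (x + 1)⁻¹) ≤ x ^ (-a) := by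
    calc (x + 1) ^ (-a) * Real.exp (a * (x + 1)⁻¹) =
        ((x + 1) * Real.exp (-(x + 1)⁻¹)) ^ (-a) := by
          rw [Real.mul_rpow hx1.le (Real.exp_pos _).le, ← Real.exp_mul]; congr 2; ring
      _ ≤ x ^ (-a) := Real.rpow_le_rpow_of_nonpos hx h1 (by linarith)
  have h3 := Real.add_one_le_exp (a * (x + 1)⁻¹)
  have h4 : a * (x + 1) ^ (-(1 + a)) = (x + 1) ^ (-a) * (a * (x + 1)⁻¹) := by
    rw [neg_add, Real.rpow_add hx1, Real.rpow_neg_one]; ring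
  have h5 : 0 < (x + 1) ^ (-a) := Real.rpow_pos_of_pos hx1 _
  rw [h4]
  nlinarith

theorem tsum_tail_rpow_le {a : ℝ} (ha : 0 < a) (m : ℕ) :
    ∑' n : ℕ, ENNReal.ofReal (((n + m : ℕ) + 2 : ℝ) ^ (-(1 + a))) ≤
      ENNReal.ofReal (a⁻¹ * ((m : ℝ) + 1) ^ (-a)) := by
  refine ENNReal.tsum_le_of_sum_range_le fun N => ?_
  rw [← ENNReal.ofReal_sum_of_nonneg fun _ _ => by positivity]
  refine ENNReal.ofReal_le_ofReal ?_
  rw [← div_eq_inv_mul, le_div_iff₀' ha, Finset.mul_sum]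
  calc ∑ n ∈ Finset.range N, a * ((n + m : ℕ) + 2 : ℝ) ^ (-(1 + a))
      ≤ ∑ n ∈ Finset.range N, (((n : ℝ) + m + 1) ^ (-a) - (((n + 1 : ℕ) : ℝ) + m + 1) ^ (-a)) := by
        refine Finset.sum_le_sum fun n _ => ?_
        have := mul_rpow_le_rpow_sub_rpow ha.le (x := (n : ℝ) + m + 1) (by positivity)
        have e : (n : ℝ) + m + 1 + 1 = (n + m : ℕ) + 2 := by push_cast; ring
        have e' : ((n + 1 : ℕ) : ℝ) + m + 1 = (n + m : ℕ) + 2 := by push_cast; ring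
        rw [e']
        rwa [e] at this
    _ = (((0 : ℕ) : ℝ) + m + 1) ^ (-a) - ((N : ℝ) + m + 1) ^ (-a) :=
        Finset.sum_range_sub' (fun n : ℕ => ((n : ℝ) + m + 1) ^ (-a)) N
    _ ≤ _ := by
        have : 0 ≤ ((N : ℝ) + m + 1) ^ (-a) := by positivity
        simp only [Nat.cast_zero, zero_add]; linarith

/-- By Bernoulli's inequality for the exponent `1 - b ≤ 1`, each term is at most an increment of `n
^ (1 - b) / (1 - b)`. -/
theorem sum_range_rpow_le {b : ℝ} (hb0 : 0 ≤ b) (hb : b < 1) (n : ℕ) :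
    ∑ k ∈ Finset.range n, ((k : ℝ) + 1) ^ (-b) ≤ (1 - b)⁻¹ * (n : ℝ) ^ (1 - b) := by
  have hb' : 0 < 1 - b := by linarith
  rw [← div_eq_inv_mul, le_div_iff₀' hb']
  induction n with
  | zero => simp [Real.zero_rpow hb'.ne']
  | succ n ih =>
    rw [Finset.sum_range_succ, mul_add]
    have hx : (0 : ℝ) < (n : ℝ) + 1 := by positivity
    have h1 := rpow_one_add_le_one_add_mul_self (s := -((n : ℝ) + 1)⁻¹) (p := 1 - b)
      (by rw [neg_le_neg_iff]; exact inv_le_one_of_one_le₀ (by linarith [(Nat.cast_nonneg n : (0:ℝ) ≤ n)]))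
      hb'.le (by linarith)
    have h2 : (n : ℝ) ^ (1 - b) ≤ ((n : ℝ) + 1) ^ (1 - b) - (1 - b) * ((n : ℝ) + 1) ^ (-b) := by
      have e1 : (n : ℝ) = ((n : ℝ) + 1) * (1 + -((n : ℝ) + 1)⁻¹) := by field_simp; ring
      have e2 : ((n : ℝ) + 1) ^ (-b) = ((n : ℝ) + 1) ^ (1 - b) * ((n : ℝ) + 1)⁻¹ := by
        rw [← Real.rpow_neg_one, ← Real.rpow_add hx]; congr 1; ring
      have hnn : 0 ≤ 1 + -((n : ℝ) + 1)⁻¹ := by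
        have : ((n : ℝ) + 1)⁻¹ ≤ 1 := inv_le_one_of_one_le₀ (by linarith [(Nat.cast_nonneg n : (0:ℝ) ≤ n)])
        linarith
      conv_lhs => rw [e1]
      rw [Real.mul_rpow hx.le hnn, e2]
      have := mul_le_mul_of_nonneg_left h1 (Real.rpow_nonneg hx.le (1 - b))
      linarith
    push_cast
    linarith

/-! ### The Green function evaluated along another walk -/

theorem lintegral_stepLaw_singleton_le_left (η θ : Measure (Lattice d)) [IsProbabilityMeasure θ]
    {n m : ℕ} {B : ℝ≥0∞} (h : ∀ x, stepLaw η n {x} ≤ B) :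
    ∫⁻ x, stepLaw η n {x} ∂stepLaw θ m ≤ B := by
  calc _ ≤ ∫⁻ _, B ∂stepLaw θ m := lintegral_mono h
    _ = B := by simp

theorem lintegral_stepLaw_singleton_le_right (η θ : Measure (Lattice d)) [IsProbabilityMeasure η]
    [IsProbabilityMeasure θ] {n m : ℕ} {B : ℝ≥0∞} (h : ∀ x, stepLaw θ m {x} ≤ B) :
    ∫⁻ x, stepLaw η n {x} ∂stepLaw θ m ≤ B := by
  calc _ = ∑' x, stepLaw η n {x} * stepLaw θ m {x} := lintegral_countable' _
    _ ≤ ∑' x, B * stepLaw η n {x} := by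
        refine ENNReal.tsum_le_tsum fun x => ?_
        rw [mul_comm]; exact mul_le_mul_left (h x) _
    _ = B * ∫⁻ _, 1 ∂stepLaw η n := by rw [ENNReal.tsum_mul_left, lintegral_countable']; simp
    _ = B := by simp

/-- In `∑ x, P(S_n = x) P(S'_m = x)`, with `S` the `η`-walk and `S'` the `θ`-walk, either factor may
be replaced by its maximum. For `n ≤ m` use that of `θ`: there are `m + 1` terms of order `m ^
(-d/2)`. For `n > m` use that of `η`, whose tail sum has the same order. On-diagonal bounds thus
suffice, and no asymptotics of the Green function are required. -/
theorem exists_lintegral_green_le (η θ : Measure (Lattice d)) [IsProbabilityMeasure η]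
    [IsProbabilityMeasure θ] (hd : 3 ≤ d) (hη : IsIrreducible η) (hθ : IsIrreducible θ) :
    ∃ C : ℝ, 0 < C ∧ ∀ m : ℕ, ∫⁻ x, green η x ∂stepLaw θ m ≤
      ENNReal.ofReal (C * ((m : ℝ) + 1) ^ (-(((d : ℝ) - 2) / 2))) := by
  obtain ⟨C₁, hC₁, h₁⟩ := hη.exists_stepLaw_le η (by omega)
  obtain ⟨C₂, hC₂, h₂⟩ := hθ.exists_stepLaw_le θ (by omega)
  set a : ℝ := ((d : ℝ) - 2) / 2 with ha
  have hd' : (3 : ℝ) ≤ d := by exact_mod_cast hd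
  have ha0 : 0 < a := by rw [ha]; linarith
  have hda : -((d : ℝ) / 2) = -(1 + a) := by rw [ha]; ring
  refine ⟨C₂ + C₁ * a⁻¹, by positivity, fun m => ?_⟩
  have hm : (0 : ℝ) < (m : ℝ) + 1 := by positivity
  unfold green
  rw [lintegral_tsum fun _ => Measurable.of_discrete.aemeasurable,
    ← ENNReal.summable.sum_add_tsum_nat_add' (k := m + 1)]
  rw [add_mul, ENNReal.ofReal_add (by positivity) (by positivity)]
  refine add_le_add ?_ ?_
  · calc _ ≤ ∑ _n ∈ Finset.range (m + 1),
          ENNReal.ofReal (C₂ * ((m : ℝ) + 1) ^ (-((d : ℝ) / 2))) :=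
          Finset.sum_le_sum fun n _ => lintegral_stepLaw_singleton_le_right η θ (h₂ m)
      _ = _ := by
        rw [Finset.sum_const, Finset.card_range, nsmul_eq_mul, ← ENNReal.ofReal_natCast,
          ← ENNReal.ofReal_mul (by positivity), hda, neg_add, Real.rpow_add hm, Real.rpow_neg_one]
        congr 1; push_cast; field_simp
  · calc _ ≤ ∑' n : ℕ, ENNReal.ofReal C₁ * ENNReal.ofReal (((n + m : ℕ) + 2 : ℝ) ^ (-(1 + a))) := by
          refine ENNReal.tsum_le_tsum fun n => ?_
          refine (lintegral_stepLaw_singleton_le_left η θ (h₁ (n + (m + 1)))).trans (le_of_eq ?_)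
          rw [hda, ENNReal.ofReal_mul hC₁.le]
          congr 3; push_cast; ring
      _ ≤ ENNReal.ofReal C₁ * ENNReal.ofReal (a⁻¹ * ((m : ℝ) + 1) ^ (-a)) := by
          rw [ENNReal.tsum_mul_left]
          exact mul_le_mul_right (tsum_tail_rpow_le ha0 m) _
      _ = _ := by rw [← ENNReal.ofReal_mul hC₁.le]; congr 1; ring

theorem green_ne_top (η : Measure (Lattice d)) [IsProbabilityMeasure η] (hd : 3 ≤ d)
    (hη : IsIrreducible η) (x : Lattice d) : green η x ≠ ∞ := by
  obtain ⟨C, hC, h⟩ := hη.exists_stepLaw_le η (by omega)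
  have hd' : (3 : ℝ) ≤ d := by exact_mod_cast hd
  have ha0 : 0 < ((d : ℝ) - 2) / 2 := by linarith
  have hda : -((d : ℝ) / 2) = -(1 + ((d : ℝ) - 2) / 2) := by ring
  unfold green
  rw [← ENNReal.summable.sum_add_tsum_nat_add' (k := 1)]
  refine ENNReal.add_ne_top.2 ⟨by simp, ne_top_of_le_ne_top (b := ENNReal.ofReal C *
    ENNReal.ofReal ((((d : ℝ) - 2) / 2)⁻¹ * (((0 : ℕ) : ℝ) + 1) ^ (-(((d : ℝ) - 2) / 2)))) (by finiteness) ?_⟩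
  refine le_trans ?_ (mul_le_mul_right (tsum_tail_rpow_le ha0 0) _)
  rw [← ENNReal.tsum_mul_left]
  refine ENNReal.tsum_le_tsum fun n => (h (n + 1) x).trans (le_of_eq ?_)
  rw [hda, ENNReal.ofReal_mul hC.le]
  congr 3; push_cast; ring

end

section

variable {d : ℕ}

/-! ### Averages over the steps of a walk -/

/-- The expectation of `f` at time `m` for the `θ`-walk started at `x`. -/
def avg (θ : Measure (Lattice d)) (m : ℕ) (f : Lattice d → ℝ≥0∞) (x : Lattice d) : ℝ≥0∞ :=
  ∫⁻ y, f (x + y) ∂stepLaw θ m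

theorem avg_zero (θ : Measure (Lattice d)) (f : Lattice d → ℝ≥0∞) : avg θ 0 f = f := by
  funext x; simp [avg, lintegral_stepLaw_zero]

theorem avg_avg (θ : Measure (Lattice d)) [IsProbabilityMeasure θ] (m n : ℕ)
    (f : Lattice d → ℝ≥0∞) : avg θ m (avg θ n f) = avg θ (m + n) f := by
  funext x; simp only [avg, lintegral_stepLaw_add, add_assoc]

theorem avg_one (θ : Measure (Lattice d)) [IsProbabilityMeasure θ] (f : Lattice d → ℝ≥0∞)
    (x : Lattice d) : avg θ 1 f x = ∫⁻ y, f (x + y) ∂θ := by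
  rw [avg, show 1 = 0 + 1 from rfl, lintegral_stepLaw_succ]
  simp [lintegral_stepLaw_zero]

theorem avg_const (θ : Measure (Lattice d)) [IsProbabilityMeasure θ] (m : ℕ) (c : ℝ≥0∞) :
    avg θ m (fun _ => c) = fun _ => c := by
  funext x; simp [avg]

theorem avg_zero_eq (θ : Measure (Lattice d)) (m : ℕ) (f : Lattice d → ℝ≥0∞) :
    avg θ m f 0 = ∫⁻ y, f y ∂stepLaw θ m := by simp [avg]

theorem lintegral_neg_eq (θ : Measure (Lattice d)) (hθ : ∀ x : Lattice d, θ {-x} = θ {x})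
    (f : Lattice d → ℝ≥0∞) : ∫⁻ y, f (-y) ∂θ = ∫⁻ y, f y ∂θ := by
  rw [lintegral_countable', lintegral_countable', ← (Equiv.neg (Lattice d)).tsum_eq]
  simp [hθ]

theorem avg_one_comp_neg (θ : Measure (Lattice d)) [IsProbabilityMeasure θ]
    (hθ : ∀ x : Lattice d, θ {-x} = θ {x}) (f : Lattice d → ℝ≥0∞) :
    avg θ 1 (fun x => f (-x)) = fun x => avg θ 1 f (-x) := by
  funext x
  rw [avg_one, avg_one, ← lintegral_neg_eq θ hθ]
  simp [neg_add_rev, add_comm]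

theorem avg_comp_neg (θ : Measure (Lattice d)) [IsProbabilityMeasure θ]
    (hθ : ∀ x : Lattice d, θ {-x} = θ {x}) (m : ℕ) (f : Lattice d → ℝ≥0∞) :
    avg θ m (fun x => f (-x)) = fun x => avg θ m f (-x) := by
  induction m with
  | zero => simp [avg_zero]
  | succ m ih =>
    rw [add_comm, ← avg_avg, ih, avg_one_comp_neg θ hθ, avg_avg]

/-! ### Resampling coordinates -/

theorem measurable_update_prod {ι X : Type*} [DecidableEq ι] [MeasurableSpace X] (a : ι) :
    Measurable fun p : (ι → X) × X => Function.update p.1 a p.2 := by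
  refine measurable_pi_lambda _ fun i => ?_
  by_cases h : i = a
  · subst h; simpa using measurable_snd
  · have : Measurable fun p : (ι → X) × X => p.1 i := by fun_prop
    simpa [h] using this

/-- Stands in for conditioning on all the other coordinates. -/
theorem infinitePi_map_update {ι X : Type*} [DecidableEq ι] [MeasurableSpace X] (μ : Measure X)
    [IsProbabilityMeasure μ] (a : ι) :
    ((Measure.infinitePi fun _ : ι => μ).prod μ).map (fun p => Function.update p.1 a p.2) =
      Measure.infinitePi fun _ : ι => μ := by
  have hmeas := measurable_update_prod (X := X) a
  apply Measure.eq_infinitePi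
  intro s t ht
  rw [Measure.map_apply hmeas (.pi (Finset.countable_toSet _) fun i _ => ht i)]
  have hpre : (fun p : (ι → X) × X => Function.update p.1 a p.2) ⁻¹' (Set.pi (s : Set ι) t) =
      (Set.pi ((s.erase a : Finset ι) : Set ι) t) ×ˢ (if a ∈ s then t a else Set.univ) := by
    ext ⟨c, k⟩
    simp only [Set.mem_preimage, Set.mem_pi, Finset.mem_coe, Set.mem_prod, Finset.mem_erase]
    constructor
    · intro h
      refine ⟨fun i hi => by simpa [hi.1] using h i hi.2, ?_⟩
      split_ifs with ha
      · simpa using h a ha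
      · trivial
    · rintro ⟨h1, h2⟩ i hi
      by_cases hia : i = a
      · subst hia; simpa [hi] using h2
      · simpa [hia] using h1 i ⟨hia, hi⟩
  rw [hpre, Measure.prod_prod, Measure.infinitePi_pi _ fun i _ => ht i]
  split_ifs with ha
  · exact Finset.prod_erase_mul _ _ ha
  · rw [Finset.erase_eq_of_notMem ha]; simp

theorem lintegral_infinitePi_update {ι X : Type*} [DecidableEq ι] [MeasurableSpace X]
    (μ : Measure X) [IsProbabilityMeasure μ] (a : ι) {F : (ι → X) → ℝ≥0∞} (hF : Measurable F) :
    ∫⁻ c, F c ∂(Measure.infinitePi fun _ : ι => μ) =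
      ∫⁻ c, ∫⁻ k, F (Function.update c a k) ∂μ ∂(Measure.infinitePi fun _ : ι => μ) := by
  have hmeas := measurable_update_prod (X := X) a
  conv_lhs => rw [← infinitePi_map_update μ a]
  rw [lintegral_map hF hmeas]
  exact lintegral_prod _ (hF.comp hmeas).aemeasurable

variable (μ : Measure ℕ) [IsProbabilityMeasure μ] (θ : Measure (Lattice d)) [IsProbabilityMeasure θ]

instance : IsProbabilityMeasure (brwLaw μ θ) := by unfold brwLaw; infer_instance

/-- Integrating out one offspring number and one displacement. -/
theorem lintegral_brwLaw_resample (p q : Label) (a : Sample d → ℝ≥0∞) (ha : Measurable a)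
    (X : Sample d → Lattice d) (hX : Measurable X) (b : ℕ → ℝ≥0∞) (f : Lattice d → ℝ≥0∞)
    (ha1 : ∀ c x k y, a (Function.update c p k, Function.update x q y) = a (c, x))
    (hX1 : ∀ c x k y, X (Function.update c p k, Function.update x q y) = X (c, x)) :
    ∫⁻ ω, a ω * b (ω.1 p) * f (X ω + ω.2 q) ∂brwLaw μ θ =
      (∫⁻ k, b k ∂μ) * ∫⁻ ω, a ω * avg θ 1 f (X ω) ∂brwLaw μ θ := by
  have hf : Measurable f := .of_discrete
  have hf1 : Measurable (avg θ 1 f) := .of_discrete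
  have hb : Measurable b := .of_discrete
  have ha0 : ∀ c x k, a (Function.update c p k, x) = a (c, x) := fun c x k => by
    simpa using ha1 c x k (x q)
  have hX0 : ∀ c x k, X (Function.update c p k, x) = X (c, x) := fun c x k => by
    simpa using hX1 c x k (x q)
  have ha2 : ∀ c x y, a (c, Function.update x q y) = a (c, x) := fun c x y => by
    simpa using ha1 c x (c p) y
  have hX2 : ∀ c x y, X (c, Function.update x q y) = X (c, x) := fun c x y => by
    simpa using hX1 c x (c p) y
  have hfull : Measurable fun ω : Sample d => a ω * b (ω.1 p) * f (X ω + ω.2 q) := by fun_prop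
  have hpart : Measurable fun ω : Sample d => a ω * b (ω.1 p) * avg θ 1 f (X ω) := by fun_prop
  have hrest : Measurable fun ω : Sample d => a ω * avg θ 1 f (X ω) := by fun_prop
  unfold brwLaw
  calc ∫⁻ ω, a ω * b (ω.1 p) * f (X ω + ω.2 q)
        ∂((Measure.infinitePi fun _ : Label => μ).prod (Measure.infinitePi fun _ : Label => θ))
      = ∫⁻ ω, a ω * b (ω.1 p) * avg θ 1 f (X ω)
        ∂((Measure.infinitePi fun _ : Label => μ).prod (Measure.infinitePi fun _ : Label => θ)) := by
        rw [lintegral_prod _ hfull.aemeasurable, lintegral_prod _ hpart.aemeasurable]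
        refine lintegral_congr fun c => ?_
        have hc : Measurable fun x => a (c, x) * b ((c, x).1 p) * f (X (c, x) + (c, x).2 q) :=
          hfull.comp measurable_prodMk_left
        rw [lintegral_infinitePi_update θ q hc]
        refine lintegral_congr fun x => ?_
        simp only [ha2, hX2, Function.update_self]
        rw [lintegral_const_mul _ .of_discrete, avg_one]
    _ = _ := by
        rw [lintegral_prod_symm _ hpart.aemeasurable, lintegral_prod_symm _ hrest.aemeasurable,
          ← lintegral_const_mul]
        · refine lintegral_congr fun x => ?_
          have hx : Measurable fun c => a (c, x) * b ((c, x).1 p) * avg θ 1 f (X (c, x)) :=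
            hpart.comp measurable_prodMk_right
          rw [lintegral_infinitePi_update μ p hx, ← lintegral_const_mul]
          · refine lintegral_congr fun c => ?_
            simp only [ha0, hX0, Function.update_self, mul_right_comm _ _ (avg θ 1 f _)]
            rw [lintegral_const_mul _ .of_discrete, mul_comm]
          · exact hrest.comp measurable_prodMk_right
        · exact hrest.lintegral_prod_left'

/-! ### Vertices and positions -/

theorem isVertex_nil (c : List ℕ → ℕ) : IsVertex c [] := .root

theorem isVertex_cons_iff {c : List ℕ → ℕ} {i : ℕ} {u : List ℕ} :
    IsVertex c (i :: u) ↔ IsVertex c u ∧ i < c u :=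
  ⟨fun h => by cases h with | child _ _ h1 h2 => exact ⟨h1, h2⟩, fun h => .child _ _ h.1 h.2⟩

open Classical in
/-- The indicator of the event that `u` is a vertex of the `j`-th subtree. -/
def alive (ω : Sample d) (j : ℕ) (u : List ℕ) : ℝ≥0∞ := if u ∈ subtree ω j then 1 else 0

theorem alive_nil (ω : Sample d) (j : ℕ) : alive ω j [] = 1 := if_pos (isVertex_nil _)

theorem alive_cons (ω : Sample d) (j i : ℕ) (u : List ℕ) :
    alive ω j (i :: u) = alive ω j u * if i < ω.1 (j, u) then 1 else 0 := by
  simp only [alive, subtree, Set.mem_ofPred_eq]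
  by_cases h1 : IsVertex (fun v => ω.1 (j, v)) u <;> by_cases h2 : i < ω.1 (j, u) <;>
    simp [h1, h2, isVertex_cons_iff]

theorem alive_ne_zero_iff (ω : Sample d) (j : ℕ) (u : List ℕ) :
    alive ω j u ≠ 0 ↔ u ∈ subtree ω j := by
  simp [alive]

theorem alive_mul_self (ω : Sample d) (j : ℕ) (u : List ℕ) :
    alive ω j u * alive ω j u = alive ω j u := by
  unfold alive; split_ifs <;> simp

theorem measurable_alive (j : ℕ) (u : List ℕ) :
    Measurable fun ω : Sample d => alive ω j u := by
  induction u with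
  | nil => simp only [alive_nil]; exact measurable_const
  | cons i u ih =>
    simp only [alive_cons]
    have h : Measurable fun k : ℕ => if i < k then (1 : ℝ≥0∞) else 0 := .of_discrete
    have hω : Measurable fun ω : Sample d => ω.1 (j, u) := by fun_prop
    exact ih.mul (h.comp hω)

theorem measurable_spinePosition (j : ℕ) :
    Measurable fun ω : Sample d => spinePosition ω j := by
  induction j with
  | zero => exact measurable_const
  | succ j ih =>
    have hω : Measurable fun ω : Sample d => ω.2 (j + 1, []) := by fun_prop
    exact ih.add hω

theorem measurable_position (j : ℕ) (u : List ℕ) :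
    Measurable fun ω : Sample d => position ω j u := by
  induction u with
  | nil => exact measurable_spinePosition j
  | cons i u ih =>
    have hω : Measurable fun ω : Sample d => ω.2 (j, i :: u) := by fun_prop
    exact ih.add hω

theorem alive_congr {ω ω' : Sample d} {j : ℕ} {u : List ℕ}
    (h : ∀ w, w <:+ u → w ≠ u → ω.1 (j, w) = ω'.1 (j, w)) : alive ω j u = alive ω' j u := by
  induction u with
  | nil => simp [alive_nil]
  | cons i u ih =>
    rw [alive_cons, alive_cons, h u (List.suffix_cons i u) (by simp), ih]
    intro w hw _
    exact h w (hw.trans (List.suffix_cons i u)) fun h' => by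
      have := hw.length_le; rw [h'] at this; simp at this

theorem spinePosition_congr {ω ω' : Sample d} {j : ℕ}
    (h : ∀ k ≤ j, ω.2 (k, []) = ω'.2 (k, [])) : spinePosition ω j = spinePosition ω' j := by
  induction j with
  | zero => rfl
  | succ j ih =>
    rw [spinePosition, spinePosition, h (j + 1) le_rfl, ih fun k hk => h k (by omega)]

theorem position_congr {ω ω' : Sample d} {j : ℕ} {u : List ℕ}
    (h0 : ∀ k, ω.2 (k, []) = ω'.2 (k, []))
    (h : ∀ w, w <:+ u → ω.2 (j, w) = ω'.2 (j, w)) : position ω j u = position ω' j u := by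
  induction u with
  | nil => exact spinePosition_congr fun k _ => h0 k
  | cons i u ih =>
    rw [position, position, h _ List.suffix_rfl, ih fun w hw => h w (hw.trans (List.suffix_cons i u))]

/-- Being a vertex depends only on the offspring numbers of proper ancestors, which are the proper
suffixes of the word. The hypothesis says that `(j, v)` is not a proper ancestor of `(i, u)` within
a subtree. -/
theorem alive_update {c : Label → ℕ} {x y : Label → Lattice d} {i j k : ℕ} {u v : List ℕ}
    (h : i = j → v <:+ u → v = u) :
    alive (Function.update c (j, v) k, y) i u = alive (c, x) i u := by
  refine alive_congr fun w hw hwu => ?_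
  refine Function.update_of_ne (fun h' => ?_) _ _
  obtain ⟨h1, h2⟩ := Prod.ext_iff.1 h'
  dsimp only at h1 h2
  subst h2
  exact hwu (h h1 hw)

theorem position_update {c c' : Label → ℕ} {x : Label → Lattice d} {i j a : ℕ} {y : Lattice d}
    {u v : List ℕ} (h : i = j → v <:+ u → v = u) :
    position (c', Function.update x (j, a :: v) y) i u = position (c, x) i u := by
  refine position_congr (fun k => Function.update_of_ne (by simp) _ _) fun w hw => ?_
  refine Function.update_of_ne (fun h' => ?_) _ _
  obtain ⟨h1, h2⟩ := Prod.ext_iff.1 h'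
  dsimp only at h1 h2
  subst h2
  have h3 := h h1 ((List.suffix_cons a v).trans hw)
  have h4 := hw.length_le
  rw [h3] at h4; simp at h4

/-! ### Two-point functions -/

/-- The expectation of `f` at the displacement between two vertices, on the event that both are
present. -/
def pairE (i : ℕ) (u : List ℕ) (j : ℕ) (v : List ℕ) (f : Lattice d → ℝ≥0∞) : ℝ≥0∞ :=
  ∫⁻ ω, alive ω i u * alive ω j v * f (position ω j v - position ω i u) ∂brwLaw μ θ

theorem measurable_pair (i : ℕ) (u : List ℕ) (j : ℕ) (v : List ℕ) (f : Lattice d → ℝ≥0∞) :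
    Measurable fun ω : Sample d =>
      alive ω i u * alive ω j v * f (position ω j v - position ω i u) := by
  have hf : Measurable f := .of_discrete
  exact ((measurable_alive i u).mul (measurable_alive j v)).mul
    (hf.comp ((measurable_position j v).sub (measurable_position i u)))

theorem pairE_swap (i : ℕ) (u : List ℕ) (j : ℕ) (v : List ℕ) (f : Lattice d → ℝ≥0∞) :
    pairE μ θ i u j v f = pairE μ θ j v i u fun x => f (-x) := by
  unfold pairE
  refine lintegral_congr fun ω => ?_
  simp only [neg_sub, mul_comm (alive ω i u)]

/-- The probability that a vertex has a child number `i`. -/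
def childProb (μ : Measure ℕ) (i : ℕ) : ℝ≥0∞ := ∫⁻ k, (if i < k then 1 else 0) ∂μ

theorem tsum_ite_lt (k : ℕ) : ∑' i : ℕ, (if i < k then (1 : ℝ≥0∞) else 0) = k := by
  rw [tsum_eq_sum (s := Finset.range k) fun i hi => by simpa using hi]
  rw [Finset.sum_congr rfl fun i hi => if_pos (Finset.mem_range.1 hi)]
  simp

theorem tsum_childProb (μ : Measure ℕ) : ∑' i, childProb μ i = ∫⁻ k, (k : ℝ≥0∞) ∂μ := by
  unfold childProb
  rw [← lintegral_tsum fun _ => Measurable.of_discrete.aemeasurable]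
  simp only [tsum_ite_lt]

/-- As `v` is no proper ancestor of `u`, the offspring number at `v` and the displacement on the
edge to its child `a` are independent of everything else in the integrand and can be integrated out.
-/
theorem pairE_cons_right {i : ℕ} {u : List ℕ} {j : ℕ} {v : List ℕ} (a : ℕ)
    (f : Lattice d → ℝ≥0∞) (h : i = j → v <:+ u → v = u) :
    pairE μ θ i u j (a :: v) f = childProb μ a * pairE μ θ i u j v (avg θ 1 f) := by
  have := lintegral_brwLaw_resample μ θ (j, v) (j, a :: v)
    (fun ω => alive ω i u * alive ω j v) ((measurable_alive i u).mul (measurable_alive j v))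
    (fun ω => position ω j v - position ω i u)
    ((measurable_position j v).sub (measurable_position i u)) (fun k => if a < k then 1 else 0) f
    (fun c x k y => by
      rw [alive_update (x := x) h, alive_update (x := x) fun _ _ => rfl])
    (fun c x k y => by
      rw [position_update (c := c) h, position_update (c := c) fun _ _ => rfl])
  rw [pairE, pairE, childProb, ← this]
  refine lintegral_congr fun ω => ?_
  rw [alive_cons, position, ← mul_assoc, sub_add_eq_add_sub]

theorem pairE_cons_left (hθ : ∀ x : Lattice d, θ {-x} = θ {x}) {i : ℕ} {u : List ℕ} {j : ℕ} {v : List ℕ} (a : ℕ)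
    (f : Lattice d → ℝ≥0∞) (h : i = j → u <:+ v → u = v) :
    pairE μ θ i (a :: u) j v f = childProb μ a * pairE μ θ i u j v (avg θ 1 f) := by
  rw [pairE_swap, pairE_cons_right μ θ a _ (fun e => h e.symm), avg_one_comp_neg θ hθ, ← pairE_swap]

end

section

variable {d : ℕ}

/-! ### Sums over the vertices of two generations -/

/-- The words of length `k`, that is the possible vertices of generation `k`. -/
abbrev Level (k : ℕ) : Type := {u : List ℕ // u.length = k}

/-- A vertex of generation `k + 1` is a child of a vertex of generation `k`. -/
def levelSuccEquiv (k : ℕ) : Level k × ℕ ≃ Level (k + 1) where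
  toFun p := ⟨p.2 :: p.1.1, by simp [p.1.2]⟩
  invFun u := (⟨u.1.tail, by simp [u.2]⟩, u.1.head (by
    intro h; have := u.2; rw [h] at this; simp at this))
  left_inv p := by simp
  right_inv u := by
    apply Subtype.ext
    simp

theorem tsum_level_zero (F : List ℕ → ℝ≥0∞) : ∑' u : Level 0, F u = F [] := by
  rw [tsum_eq_single ⟨[], rfl⟩]
  rintro ⟨u, hu⟩ h
  exact absurd (Subtype.ext (List.eq_nil_of_length_eq_zero hu)) h

theorem tsum_level_succ (k : ℕ) (F : List ℕ → ℝ≥0∞) :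
    ∑' u : Level (k + 1), F u = ∑' u : Level k, ∑' a : ℕ, F (a :: u.1) := by
  rw [← (levelSuccEquiv k).tsum_eq, ENNReal.tsum_prod']
  rfl

variable (μ : Measure ℕ) [IsProbabilityMeasure μ] (θ : Measure (Lattice d)) [IsProbabilityMeasure θ]

/-- The expected sum of `f` over the displacements between the vertices of generation `k` of the
`i`-th subtree and the vertices of generation `l` of the `j`-th subtree. -/
def pairSum (i j k l : ℕ) (f : Lattice d → ℝ≥0∞) : ℝ≥0∞ :=
  ∑' u : Level k, ∑' v : Level l, pairE μ θ i u j v f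

theorem pairSum_swap (i j k l : ℕ) (f : Lattice d → ℝ≥0∞) :
    pairSum μ θ i j k l f = pairSum μ θ j i l k fun x => f (-x) := by
  unfold pairSum
  rw [ENNReal.tsum_comm]
  simp only [pairE_swap μ θ i]

/-- With `k ≤ l`, no vertex of generation `l` is a proper ancestor of one of generation `k`. One
more generation then multiplies by the mean offspring number, which is one, and lengthens the
connecting path by one step. -/
theorem pairSum_succ_right (hμ : ∫⁻ k, (k : ℝ≥0∞) ∂μ = 1) {i j k l : ℕ} (h : i = j → k ≤ l)
    (f : Lattice d → ℝ≥0∞) :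
    pairSum μ θ i j k (l + 1) f = pairSum μ θ i j k l (avg θ 1 f) := by
  unfold pairSum
  refine tsum_congr fun u => ?_
  rw [tsum_level_succ l fun v => pairE μ θ i u j v f]
  refine tsum_congr fun v => ?_
  have hc : ∀ a, pairE μ θ i u j (a :: v.1) f =
      childProb μ a * pairE μ θ i u j v (avg θ 1 f) := fun a =>
    pairE_cons_right μ θ a f fun hij hs => by
      refine hs.eq_of_length (le_antisymm hs.length_le ?_)
      rw [u.2, v.2]; exact h hij
  simp only [hc, ENNReal.tsum_mul_right, tsum_childProb, hμ, one_mul]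

theorem pairSum_add_right (hμ : ∫⁻ k, (k : ℝ≥0∞) ∂μ = 1) {i j k l : ℕ} (h : i = j → k ≤ l) (m : ℕ)
    (f : Lattice d → ℝ≥0∞) :
    pairSum μ θ i j k (l + m) f = pairSum μ θ i j k l (avg θ m f) := by
  induction m generalizing f with
  | zero => rw [avg_zero, add_zero]
  | succ m ih =>
    rw [← add_assoc, pairSum_succ_right μ θ hμ (fun e => (h e).trans (Nat.le_add_right _ _)), ih,
      avg_avg]

/-- Both ends retreat to the roots of their subtrees; symmetry of `θ` makes steps towards and away
from the root alike. -/
theorem pairSum_cross (hμ : ∫⁻ k, (k : ℝ≥0∞) ∂μ = 1) (hθ : ∀ x : Lattice d, θ {-x} = θ {x})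
    {i j : ℕ} (h : i ≠ j) (k l : ℕ) (f : Lattice d → ℝ≥0∞) :
    pairSum μ θ i j k l f = pairSum μ θ i j 0 0 (avg θ (k + l) f) := by
  have h1 := pairSum_add_right μ θ hμ (i := i) (j := j) (k := k) (l := 0) (fun e => absurd e h) l f
  have h2 := pairSum_add_right μ θ hμ (i := j) (j := i) (k := 0) (l := 0)
    (fun e => absurd e.symm h) k fun x => avg θ l f (-x)
  rw [zero_add] at h1 h2
  rw [h1, pairSum_swap, h2, avg_comp_neg θ hθ, avg_avg, ← pairSum_swap]

theorem lintegral_spine (i m : ℕ) (f : Lattice d → ℝ≥0∞) :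
    ∫⁻ ω, f (spinePosition ω (i + m) - spinePosition ω i) ∂brwLaw μ θ = avg θ m f 0 := by
  induction m generalizing f with
  | zero => simp [avg_zero]
  | succ m ih =>
    -- The offspring label is a dummy, its weight being constantly one.
    have := lintegral_brwLaw_resample μ θ (0, []) (i + m + 1, []) (fun _ => 1) measurable_const
      (fun ω => spinePosition ω (i + m) - spinePosition ω i)
      ((measurable_spinePosition _).sub (measurable_spinePosition _)) (fun _ => 1) f
      (fun _ _ _ _ => rfl) (fun c x k y => by
        congr 1 <;>
        exact spinePosition_congr fun k' hk' => Function.update_of_ne (by simp; omega) _ _)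
    simp only [one_mul, lintegral_one, measure_univ] at this
    rw [ih, avg_avg] at this
    rw [← this]
    refine lintegral_congr fun ω => ?_
    rw [← add_assoc, spinePosition, sub_add_eq_add_sub]

theorem pairSum_zero_zero_add (i m : ℕ) (f : Lattice d → ℝ≥0∞) :
    pairSum μ θ i (i + m) 0 0 f = avg θ m f 0 := by
  unfold pairSum
  rw [tsum_level_zero fun u => ∑' v : Level 0, pairE μ θ i u (i + m) v f,
    tsum_level_zero fun v => pairE μ θ i [] (i + m) v f, ← lintegral_spine μ θ i m, pairE]
  simp only [alive_nil, one_mul, position]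

theorem pairSum_zero_zero (hθ : ∀ x : Lattice d, θ {-x} = θ {x}) (i j : ℕ)
    (f : Lattice d → ℝ≥0∞) :
    pairSum μ θ i j 0 0 f = avg θ (Nat.dist i j) f 0 := by
  rcases le_total i j with h | h
  · obtain ⟨m, rfl⟩ := Nat.exists_eq_add_of_le h
    rw [pairSum_zero_zero_add, Nat.dist_eq_sub_of_le h, Nat.add_sub_cancel_left]
  · obtain ⟨m, rfl⟩ := Nat.exists_eq_add_of_le h
    rw [pairSum_swap, pairSum_zero_zero_add, Nat.dist_comm, Nat.dist_eq_sub_of_le h,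
      Nat.add_sub_cancel_left, avg_comp_neg θ hθ]
    simp only [neg_zero]

theorem pairSum_of_ne (hμ : ∫⁻ k, (k : ℝ≥0∞) ∂μ = 1) (hθ : ∀ x : Lattice d, θ {-x} = θ {x})
    {i j : ℕ} (h : i ≠ j) (k l : ℕ) (f : Lattice d → ℝ≥0∞) :
    pairSum μ θ i j k l f = avg θ (Nat.dist i j + (k + l)) f 0 := by
  rw [pairSum_cross μ θ hμ hθ h, pairSum_zero_zero μ θ hθ, avg_avg]

/-- First moment formula for a generation of a subtree. -/
theorem tsum_lintegral_alive_mul (hμ : ∫⁻ k, (k : ℝ≥0∞) ∂μ = 1) (j k : ℕ)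
    (f : Lattice d → ℝ≥0∞) :
    ∑' u : Level k, ∫⁻ ω, alive ω j u * f (position ω j u) ∂brwLaw μ θ = avg θ (j + k) f 0 := by
  -- A one-point function is a two-point function with the root of the forest, which is always
  -- present and sits at the origin.
  have h := pairSum_add_right μ θ hμ (i := 0) (j := j) (k := 0) (l := 0) (fun _ => le_rfl) k f
  have h' := pairSum_zero_zero_add μ θ 0 j (avg θ k f)
  rw [zero_add] at h h'
  rw [h', avg_avg] at h
  rw [← h, pairSum, tsum_level_zero fun u => ∑' v : Level k, pairE μ θ 0 u j v f]
  simp only [pairE, alive_nil, one_mul, position, spinePosition, sub_zero]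

theorem tsum_lintegral_alive (hμ : ∫⁻ k, (k : ℝ≥0∞) ∂μ = 1) (j k : ℕ) :
    ∑' u : Level k, ∫⁻ ω, alive ω j u ∂brwLaw μ θ = 1 := by
  have := tsum_lintegral_alive_mul μ θ hμ j k fun _ => 1
  simpa [avg_const] using this

/-- The probability that a vertex has children number `a` and `b`. -/
def childProb₂ (μ : Measure ℕ) (a b : ℕ) : ℝ≥0∞ :=
  ∫⁻ k, (if a < k then 1 else 0) * (if b < k then 1 else 0) ∂μ

theorem tsum_tsum_childProb₂ (μ : Measure ℕ) :
    ∑' a, ∑' b, childProb₂ μ a b = ∫⁻ k, (k : ℝ≥0∞) ^ 2 ∂μ := by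
  unfold childProb₂
  simp_rw [← lintegral_tsum fun _ => Measurable.of_discrete.aemeasurable,
    ENNReal.tsum_mul_left, ENNReal.tsum_mul_right, tsum_ite_lt, sq]

/-- Siblings share one offspring number, hence `childProb₂`, but have independent displacements,
whose difference is a two-step walk by symmetry. -/
theorem pairE_siblings (hθ : ∀ x : Lattice d, θ {-x} = θ {x}) (j : ℕ) (w : List ℕ) {a b : ℕ}
    (hab : a ≠ b) (f : Lattice d → ℝ≥0∞) :
    pairE μ θ j (a :: w) j (b :: w) f =
      (∫⁻ ω, alive ω j w ∂brwLaw μ θ) * (childProb₂ μ a b * avg θ 2 f 0) := by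
  have h1 := lintegral_brwLaw_resample μ θ (j, w) (j, b :: w) (fun ω => alive ω j w)
    (measurable_alive j w) (fun ω => -ω.2 (j, a :: w)) (by fun_prop)
    (fun k => (if a < k then 1 else 0) * (if b < k then 1 else 0)) f
    (fun c x k y => alive_update fun _ _ => rfl)
    (fun c x k y => by
      simp only [neg_inj]
      exact Function.update_of_ne (by simpa using hab) _ _)
  have h2 := lintegral_brwLaw_resample μ θ (j, w) (j, a :: w) (fun ω => alive ω j w)
    (measurable_alive j w) (fun _ => 0) measurable_const (fun _ => 1)
    (fun x => avg θ 1 f (-x))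
    (fun c x k y => alive_update fun _ _ => rfl) (fun _ _ _ _ => rfl)
  simp only [mul_one, zero_add, lintegral_one, measure_univ, one_mul, avg_one_comp_neg θ hθ,
    avg_avg, neg_zero] at h2
  rw [h2, lintegral_mul_const _ (measurable_alive j w)] at h1
  rw [pairE, childProb₂, mul_left_comm]
  refine Eq.trans (lintegral_congr fun ω => ?_) h1
  rw [alive_cons, alive_cons, position, position, mul_mul_mul_comm, alive_mul_self]
  congr 2
  abel

/-- Three cases: distinct parents, distinct siblings, equal vertices. When `v = u` the first summand
is superfluous but harmless, and keeping it lets the sum over all pairs of parents factorise. -/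
theorem pairE_cons_cons_le (hθ : ∀ x : Lattice d, θ {-x} = θ {x}) (j : ℕ)
    {k : ℕ} (u v : Level k) (a b : ℕ) (f : Lattice d → ℝ≥0∞) :
    pairE μ θ j (a :: u.1) j (b :: v.1) f ≤
      childProb μ a * (childProb μ b * pairE μ θ j u j v (avg θ 2 f)) +
      if v = u then (if b = a then (∫⁻ ω, alive ω j (a :: u.1) ∂brwLaw μ θ) * f 0 else 0) +
        (∫⁻ ω, alive ω j u ∂brwLaw μ θ) * (childProb₂ μ a b * avg θ 2 f 0) else 0 := by
  by_cases huv : v = u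
  · subst huv
    rw [if_pos rfl]
    by_cases hab : b = a
    · subst hab
      rw [if_pos rfl]
      refine le_trans (le_of_eq ?_) ((le_add_right le_rfl).trans (le_add_left le_rfl))
      rw [pairE, ← lintegral_mul_const _ (measurable_alive _ _)]
      exact lintegral_congr fun ω => by rw [alive_mul_self, sub_self]
    · rw [if_neg hab, zero_add, pairE_siblings μ θ hθ j v.1 (Ne.symm hab)]
      exact le_add_left le_rfl
  · rw [if_neg huv, add_zero, pairE_cons_right μ θ b f, pairE_cons_left μ θ hθ a, avg_avg,
      mul_left_comm]
    · intro _ hs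
      exact hs.eq_of_length (by rw [u.2, v.2])
    · intro _ hs
      rcases List.suffix_cons_iff.1 hs with h | h
      · exact h
      · exact absurd (Subtype.ext (h.eq_of_length (by rw [u.2, v.2]))) huv

/-- Pairs with distinct parents pass to generation `k` with two more steps; equal vertices give `f
0`, as a generation has mean size one; siblings give at most the second moment of `μ`. -/
theorem pairSum_diag_succ_le (hμ : ∫⁻ k, (k : ℝ≥0∞) ∂μ = 1)
    (hθ : ∀ x : Lattice d, θ {-x} = θ {x}) (j k : ℕ) (f : Lattice d → ℝ≥0∞) :
    pairSum μ θ j j (k + 1) (k + 1) f ≤ pairSum μ θ j j k k (avg θ 2 f) +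
      (f 0 + (∫⁻ k, (k : ℝ≥0∞) ^ 2 ∂μ) * avg θ 2 f 0) := by
  have hexp : pairSum μ θ j j (k + 1) (k + 1) f =
      ∑' u : Level k, ∑' a, ∑' v : Level k, ∑' b, pairE μ θ j (a :: u.1) j (b :: v.1) f := by
    unfold pairSum
    rw [tsum_level_succ k fun u => ∑' v : Level (k + 1), pairE μ θ j u j v f]
    refine tsum_congr fun u => tsum_congr fun a => ?_
    rw [tsum_level_succ k fun v => pairE μ θ j (a :: u.1) j v f]
  have hdiag : ∀ (u : Level k) (a : ℕ), ∑' v : Level k, ∑' b, (if v = u then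
      (if b = a then (∫⁻ ω, alive ω j (a :: u.1) ∂brwLaw μ θ) * f 0 else 0) +
        (∫⁻ ω, alive ω j u ∂brwLaw μ θ) * (childProb₂ μ a b * avg θ 2 f 0) else 0) =
      (∫⁻ ω, alive ω j (a :: u.1) ∂brwLaw μ θ) * f 0 + (∫⁻ ω, alive ω j u ∂brwLaw μ θ) *
        ((∑' b, childProb₂ μ a b) * avg θ 2 f 0) := by
    intro u a
    rw [tsum_eq_single u]
    · simp only [if_true]
      rw [ENNReal.tsum_add, tsum_ite_eq, ENNReal.tsum_mul_left, ENNReal.tsum_mul_right]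
    · intro v hv; simp [hv]
  rw [hexp]
  calc _ ≤ ∑' u : Level k, ∑' a, ∑' v : Level k, ∑' b,
        (childProb μ a * (childProb μ b * pairE μ θ j u j v (avg θ 2 f)) +
        if v = u then (if b = a then (∫⁻ ω, alive ω j (a :: u.1) ∂brwLaw μ θ) * f 0 else 0) +
          (∫⁻ ω, alive ω j u ∂brwLaw μ θ) * (childProb₂ μ a b * avg θ 2 f 0) else 0) := by
        gcongr with u a v b
        exact pairE_cons_cons_le μ θ hθ j u v a b f
    _ = _ := by
        simp only [ENNReal.tsum_add, hdiag, ENNReal.tsum_mul_left, ENNReal.tsum_mul_right,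
          tsum_childProb, hμ, one_mul, tsum_tsum_childProb₂]
        have h1 := tsum_lintegral_alive μ θ hμ j (k + 1)
        rw [tsum_level_succ k fun u => ∫⁻ ω, alive ω j u ∂brwLaw μ θ] at h1
        rw [h1, tsum_lintegral_alive μ θ hμ j k, one_mul, one_mul]
        rfl

theorem pairSum_diag_le (hμ : ∫⁻ k, (k : ℝ≥0∞) ∂μ = 1)
    (hθ : ∀ x : Lattice d, θ {-x} = θ {x}) (j k : ℕ) (f : Lattice d → ℝ≥0∞) :
    pairSum μ θ j j k k f ≤ (1 + ∫⁻ k, (k : ℝ≥0∞) ^ 2 ∂μ) *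
      ∑ m ∈ Finset.range (k + 1), avg θ (2 * m) f 0 := by
  set K := ∫⁻ k, (k : ℝ≥0∞) ^ 2 ∂μ with hK
  -- The term `f 0` must keep coefficient one: in the next generation it becomes `avg θ 2 f 0` and
  -- gains `K` from the siblings. The distance `2 * m` corresponds to a last common ancestor `m`
  -- generations back.
  have hstrong : pairSum μ θ j j k k f ≤
      f 0 + (1 + K) * ∑ m ∈ Finset.range k, avg θ (2 * (m + 1)) f 0 := by
    induction k generalizing f with
    | zero =>
      have := pairSum_zero_zero_add μ θ j 0 f
      rw [avg_zero, add_zero] at this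
      simp [this]
    | succ k ih =>
      refine (pairSum_diag_succ_le μ θ hμ hθ j k f).trans
        ((add_le_add_left (ih (avg θ 2 f)) _).trans (le_of_eq ?_))
      simp only [avg_avg]
      rw [Finset.sum_range_succ']
      have : ∀ m, 2 * (m + 1) + 2 = 2 * (m + 1 + 1) := fun m => by ring
      simp only [this, zero_add, mul_one, ← hK]
      ring
  refine hstrong.trans ?_
  rw [Finset.sum_range_succ', mul_add, add_comm, mul_zero, avg_zero]
  gcongr
  exact le_mul_of_one_le_left zero_le (le_add_right le_rfl)

/-- Second moment bound for two generations of the same subtree. -/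
theorem pairSum_self_le (hμ : ∫⁻ k, (k : ℝ≥0∞) ∂μ = 1)
    (hθ : ∀ x : Lattice d, θ {-x} = θ {x}) (j k l : ℕ) (f : Lattice d → ℝ≥0∞) :
    pairSum μ θ j j k l f ≤ (1 + ∫⁻ k, (k : ℝ≥0∞) ^ 2 ∂μ) *
      ∑ m ∈ Finset.range (min k l + 1), avg θ (Nat.dist k l + 2 * m) f 0 := by
  have hle : ∀ k l f, k ≤ l → pairSum μ θ j j k l f ≤ (1 + ∫⁻ k, (k : ℝ≥0∞) ^ 2 ∂μ) *
      ∑ m ∈ Finset.range (k + 1), avg θ (Nat.dist k l + 2 * m) f 0 := by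
    intro k l f h
    obtain ⟨m, rfl⟩ := Nat.exists_eq_add_of_le h
    rw [pairSum_add_right μ θ hμ fun _ => le_rfl]
    refine (pairSum_diag_le μ θ hμ hθ j k _).trans (le_of_eq ?_)
    simp only [avg_avg, Nat.dist_eq_sub_of_le h, Nat.add_sub_cancel_left, add_comm]
  rcases le_total k l with h | h
  · rw [min_eq_left h]; exact hle k l f h
  · rw [min_eq_right h, pairSum_swap, Nat.dist_comm]
    refine (hle l k _ h).trans (le_of_eq ?_)
    simp only [avg_comp_neg θ hθ, neg_zero]

end

section

variable {d : ℕ}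

/-! ### The height of a critical Galton–Watson tree -/

/-- The offspring functions whose tree has no vertex of generation `h`. -/
def extinctBy (h : ℕ) : Set (List ℕ → ℕ) := {c | ∀ u : List ℕ, u.length = h → ¬ IsVertex c u}

theorem measurableSet_isVertex (u : List ℕ) :
    MeasurableSet {c : List ℕ → ℕ | IsVertex c u} := by
  induction u with
  | nil => simp [isVertex_nil]
  | cons i u ih =>
    have : {c : List ℕ → ℕ | IsVertex c (i :: u)} = {c | IsVertex c u} ∩ {c | i < c u} := by
      ext c; exact isVertex_cons_iff
    rw [this]
    exact ih.inter (measurableSet_lt measurable_const (measurable_pi_apply u))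

theorem measurableSet_extinctBy (h : ℕ) : MeasurableSet (extinctBy h) := by
  unfold extinctBy
  simp only [Set.ofPred_forall]
  exact .iInter fun u => .iInter fun _ => (measurableSet_isVertex u).compl

/-- Words are read up to the root, so the last letter names a child of the root and the remaining
ones a vertex of its subtree. -/
theorem isVertex_append_singleton {c : List ℕ → ℕ} {u : List ℕ} {i : ℕ} :
    IsVertex c (u ++ [i]) ↔ i < c [] ∧ IsVertex (fun w => c (w ++ [i])) u := by
  induction u with
  | nil => simp [isVertex_cons_iff, isVertex_nil]
  | cons a u ih => rw [List.cons_append, isVertex_cons_iff, isVertex_cons_iff, ih, and_assoc]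

theorem mem_extinctBy_succ_iff {c : List ℕ → ℕ} {h : ℕ} :
    c ∈ extinctBy (h + 1) ↔ ∀ i < c [], (fun w => c (w ++ [i])) ∈ extinctBy h := by
  constructor
  · intro hc i hi u hu hv
    exact hc (u ++ [i]) (by simp [hu]) (isVertex_append_singleton.2 ⟨hi, hv⟩)
  · intro hc u hu hv
    have hne : u ≠ [] := by rintro rfl; simp at hu
    rw [← List.dropLast_append_getLast hne, isVertex_append_singleton] at hv
    exact hc _ hv.1 _ (by simp [hu]) hv.2

variable (μ : Measure ℕ) [IsProbabilityMeasure μ]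

/-- The subtrees of distinct children of the root use disjoint families of labels `w ++ [i]`, hence
are independent copies of the whole tree. -/
theorem infinitePi_forall_extinctBy (h k : ℕ) :
    (Measure.infinitePi fun _ : List ℕ => μ) {c | ∀ i < k, (fun w => c (w ++ [i])) ∈ extinctBy h} =
      (Measure.infinitePi fun _ : List ℕ => μ) (extinctBy h) ^ k := by
  have hinj : Function.Injective fun p : ℕ × List ℕ => p.2 ++ [p.1] := by
    rintro ⟨a, u⟩ ⟨b, v⟩ huv
    simp only at huv
    obtain ⟨h1, h2⟩ := List.append_inj' huv rfl
    simp_all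
  have h1 := Measure.map_infinitePi_infinitePi_of_inj (P := fun _ : List ℕ => μ) hinj
  have h2 := Measure.infinitePi_map_curry (fun (_ : ℕ) (_ : List ℕ) => μ)
  rw [← h1, Measure.map_map (by fun_prop) (by fun_prop)] at h2
  have h3 := Measure.infinitePi_pi (fun _ : ℕ => Measure.infinitePi fun _ : List ℕ => μ)
    (s := Finset.range k) (t := fun _ => extinctBy h) fun _ _ => measurableSet_extinctBy h
  rw [← h2, Measure.map_apply (by fun_prop)
    (.pi (Finset.countable_toSet _) fun _ _ => measurableSet_extinctBy h)] at h3
  simp only [Finset.prod_const, Finset.card_range] at h3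
  rw [← h3]
  congr 1
  ext c
  simp only [Set.mem_preimage, Set.mem_pi, Finset.coe_range, Set.mem_Iio]
  rfl

/-- Iteration of the generating function of `μ`, obtained by resampling the offspring number of the
root. -/
theorem extinctBy_succ (h : ℕ) :
    (Measure.infinitePi fun _ : List ℕ => μ) (extinctBy (h + 1)) =
      ∫⁻ k, (Measure.infinitePi fun _ : List ℕ => μ) (extinctBy h) ^ k ∂μ := by
  have hm := measurableSet_extinctBy (h + 1)
  have hmk : ∀ k : ℕ, MeasurableSet
      {c : List ℕ → ℕ | ∀ i < k, (fun w => c (w ++ [i])) ∈ extinctBy h} := by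
    intro k
    simp only [Set.ofPred_forall]
    refine .iInter fun i => .iInter fun _ => ?_
    have : Measurable fun (c : List ℕ → ℕ) (w : List ℕ) => c (w ++ [i]) := by fun_prop
    exact this (measurableSet_extinctBy h)
  rw [← lintegral_indicator_one hm, lintegral_infinitePi_update μ [] (measurable_one.indicator hm)]
  have hup : ∀ (c : List ℕ → ℕ) (k : ℕ),
      (extinctBy (h + 1)).indicator (1 : (List ℕ → ℕ) → ℝ≥0∞) (Function.update c [] k) =
      {c : List ℕ → ℕ | ∀ i < k, (fun w => c (w ++ [i])) ∈ extinctBy h}.indicator 1 c := by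
    intro c k
    have : Function.update c [] k ∈ extinctBy (h + 1) ↔
        ∀ i < k, (fun w => c (w ++ [i])) ∈ extinctBy h := by
      rw [mem_extinctBy_succ_iff]
      simp
    by_cases hc : ∀ i < k, (fun w => c (w ++ [i])) ∈ extinctBy h
    · rw [Set.indicator_of_mem (this.2 hc), Set.indicator_of_mem (by exact hc)]; rfl
    · rw [Set.indicator_of_notMem (fun h' => hc (this.1 h')),
        Set.indicator_of_notMem (by exact hc)]
  simp only [hup]
  rw [lintegral_lintegral_swap]
  · refine lintegral_congr fun k => ?_
    rw [lintegral_indicator_one (hmk k), infinitePi_forall_extinctBy]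
  · refine Measurable.aemeasurable ?_
    refine measurable_from_prod_countable_left fun k => ?_
    exact measurable_one.indicator (hmk k)

/-- A second-order lower bound on the generating function. It is affine in `k` apart from the
indicator of zero, so integrating it under mean one kills `q ^ 2 * (k - 1)` and leaves a gain of `μ
{0} * q ^ 2`. -/
theorem one_sub_pow_ge {q : ℝ} (h1 : q ≤ 1) (k : ℕ) :
    1 - k * q + q ^ 2 * (k - 1) + q ^ 2 * (if k = 0 then 1 else 0) ≤ (1 - q) ^ k := by
  induction k with
  | zero => simp
  | succ k ih =>
    rw [pow_succ]
    have h2 := mul_le_mul_of_nonneg_right ih (sub_nonneg.2 h1)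
    refine le_trans ?_ h2
    simp only [Nat.add_eq_zero_iff, one_ne_zero, and_false, if_false]
    by_cases hk : k = 0
    · subst hk; simp
    · have hk1 : (1 : ℝ) ≤ k := by exact_mod_cast Nat.one_le_iff_ne_zero.2 hk
      simp only [hk, if_false]
      push_cast
      have : 0 ≤ q ^ 2 * (k - 1) * (1 - q) := by
        have := sub_nonneg.2 hk1; have := sub_nonneg.2 h1; positivity
      nlinarith

/-- The probability of having a vertex of generation `h` is at most of order `1 / h`. -/
theorem survival_le (hInt : Integrable (fun k : ℕ => (k : ℝ)) μ) (hmean : ∫ k, (k : ℝ) ∂μ = 1)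
    (h : ℕ) :
    μ.real {0} * (Measure.infinitePi fun _ : List ℕ => μ).real (extinctBy h)ᶜ * (h + 1) ≤ 1 := by
  set P := (Measure.infinitePi fun _ : List ℕ => μ) with hP
  set c := μ.real {0} with hc
  have hc0 : 0 ≤ c := measureReal_nonneg
  have hc1 : c ≤ 1 := measureReal_le_one
  set q : ℕ → ℝ := fun h => P.real (extinctBy h)ᶜ with hq
  have hq0 : ∀ h, 0 ≤ q h := fun h => measureReal_nonneg
  have hq1 : ∀ h, q h ≤ 1 := fun h => measureReal_le_one
  have hqe : ∀ h, P.real (extinctBy h) = 1 - q h := fun h => by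
    have := probReal_compl_eq_one_sub (μ := P) (measurableSet_extinctBy h)
    simp only [hq]; linarith
  -- A discrete form of `q' = -c q ^ 2`, whose solutions decay like `1 / (c h)`.
  have hrec : ∀ h, q (h + 1) ≤ q h - c * q h ^ 2 := by
    intro h
    have h1 : P.real (extinctBy (h + 1)) = ∫ k, (1 - q h) ^ k ∂μ := by
      rw [← hqe, Measure.real, extinctBy_succ, integral_eq_lintegral_of_nonneg_ae
        (ae_of_all _ fun _ => by positivity) Measurable.of_discrete.aestronglyMeasurable]
      congr 1
      refine lintegral_congr fun k => ?_
      rw [ENNReal.ofReal_pow measureReal_nonneg, ofReal_measureReal]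
    have hi2 : Integrable (fun k : ℕ => if k = 0 then (1 : ℝ) else 0) μ := by
      refine (integrable_const (1 : ℝ)).mono' Measurable.of_discrete.aestronglyMeasurable ?_
      exact ae_of_all _ fun k => by split_ifs <;> simp
    have hi3 : Integrable (fun k : ℕ => (1 - q h) ^ k) μ := by
      refine (integrable_const (1 : ℝ)).mono' Measurable.of_discrete.aestronglyMeasurable ?_
      refine ae_of_all _ fun k => ?_
      rw [Real.norm_of_nonneg (by have := sub_nonneg.2 (hq1 h); positivity)]
      exact pow_le_one₀ (sub_nonneg.2 (hq1 h)) (by linarith [hq0 h])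
    have hI : ∫ k : ℕ, (if k = 0 then (1 : ℝ) else 0) ∂μ = c := by
      have : (fun k : ℕ => if k = 0 then (1 : ℝ) else 0) = Set.indicator {0} 1 := by
        funext k; simp [Set.indicator]
      rw [this, integral_indicator_one (.singleton 0)]
    have h2 : 1 - q h + c * q h ^ 2 ≤ ∫ k, (1 - q h) ^ k ∂μ := by
      calc 1 - q h + c * q h ^ 2 = ∫ k : ℕ, ((1 - q h ^ 2) + (k : ℝ) * (q h ^ 2 - q h) +
            (if k = 0 then (1 : ℝ) else 0) * q h ^ 2) ∂μ := by
            have hi4 : Integrable (fun k : ℕ => (1 - q h ^ 2) + (k : ℝ) * (q h ^ 2 - q h)) μ :=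
              (integrable_const _).add (hInt.mul_const _)
            rw [integral_add hi4 (hi2.mul_const _),
              integral_add (integrable_const _) (hInt.mul_const _), integral_mul_const,
              integral_mul_const, hmean, hI]
            simp
        _ ≤ _ := by
            refine integral_mono (((integrable_const _).add (hInt.mul_const _)).add
              (hi2.mul_const _)) hi3 fun k => ?_
            refine le_trans (le_of_eq ?_) (one_sub_pow_ge (hq1 h) k)
            ring
    have := hqe (h + 1)
    linarith
  show c * q h * (h + 1) ≤ 1
  induction h with
  | zero => simpa using mul_le_one₀ hc1 (hq0 0) (hq1 0)
  | succ h ih =>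
    set a := c * q h with ha
    have ha0 : 0 ≤ a := mul_nonneg hc0 (hq0 h)
    have h1 : c * q (h + 1) ≤ a * (1 - a) := by
      have := mul_le_mul_of_nonneg_left (hrec h) hc0
      rw [ha]; nlinarith
    -- This yields `c * q (h + 1) ≤ a / (1 + a)`, and the increasing map `x ↦ x / (1 + x)` sends `1
    -- / (h + 1)` to `1 / (h + 2)`.
    have h2 : a * (1 - a) * (1 + a) ≤ a := by nlinarith [mul_nonneg ha0 (sq_nonneg a)]
    have h3 : c * q (h + 1) * (1 + a) ≤ a :=
      (mul_le_mul_of_nonneg_right h1 (by linarith)).trans h2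
    have h4 : 0 ≤ c * q (h + 1) := mul_nonneg hc0 (hq0 _)
    push_cast
    by_contra hcon
    push Not at hcon
    set b := c * q (h + 1) with hb
    have hhn : (0 : ℝ) ≤ h := Nat.cast_nonneg h
    have hb1 : b ≤ a * (1 - b) := by nlinarith
    have hb2 : b * (h + 1) ≤ a * (h + 1) * (1 - b) := by nlinarith
    have hb3 : 0 ≤ 1 - b := by
      have : b ≤ 1 := mul_le_one₀ hc1 (hq0 _) (hq1 _)
      linarith
    nlinarith

/-- Without mass at zero, `k - 1` is nonnegative with mean zero, which forces the Dirac mass at one.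
-/
theorem measure_zero_pos (hInt : Integrable (fun k : ℕ => (k : ℝ)) μ)
    (hmean : ∫ k, (k : ℝ) ∂μ = 1) (hne : μ ≠ Measure.dirac 1) : 0 < μ.real {0} := by
  by_contra hcon
  have h0 : μ {0} = 0 := by
    have : μ.real {0} = 0 := le_antisymm (not_lt.1 hcon) measureReal_nonneg
    rwa [measureReal_eq_zero_iff] at this
  have hpos : ∀ᵐ k ∂μ, k ≠ 0 := by
    rw [ae_iff]; simpa using h0
  have hz : ∫ k : ℕ, ((k : ℝ) - 1) ∂μ = 0 := by
    rw [integral_sub hInt (integrable_const 1), hmean]; simp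
  have hi : Integrable (fun k : ℕ => (k : ℝ) - 1) μ := hInt.sub (integrable_const 1)
  rw [integral_eq_zero_iff_of_nonneg_ae _ hi] at hz
  · apply hne
    have h1 : ∀ᵐ k ∂μ, k = 1 := by
      filter_upwards [hz] with k hk
      have : (k : ℝ) = 1 := by simpa [sub_eq_zero] using hk
      exact_mod_cast this
    ext s _
    have hs : μ s = μ (s ∩ {1}) := by
      refine measure_congr ?_
      filter_upwards [h1] with k hk
      exact propext ⟨fun h => ⟨h, hk⟩, fun h => h.1⟩
    have h11 : μ {1} = 1 := by
      rw [← prob_compl_eq_zero_iff (.singleton 1)]; exact h1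
    rw [hs, Measure.dirac_apply' _ .of_discrete]
    by_cases h1s : 1 ∈ s
    · rw [Set.inter_eq_right.2 (by simpa using h1s), h11]; simp [h1s]
    · rw [Set.inter_singleton_eq_empty.2 h1s]; simp [h1s]
  · filter_upwards [hpos] with k hk
    have : (1 : ℝ) ≤ k := by exact_mod_cast Nat.one_le_iff_ne_zero.2 hk
    simpa using this

variable (θ : Measure (Lattice d)) [IsProbabilityMeasure θ]

/-- The samples whose `j`-th subtree has no vertex of generation `h`. -/
def treeExtinctBy (d j h : ℕ) : Set (Sample d) := {ω | (fun v => ω.1 (j, v)) ∈ extinctBy h}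

theorem measurePreserving_offspring (j : ℕ) :
    MeasurePreserving (fun (ω : Sample d) (v : List ℕ) => ω.1 (j, v)) (brwLaw μ θ)
      (Measure.infinitePi fun _ : List ℕ => μ) := by
  refine ⟨by fun_prop, ?_⟩
  have h1 := Measure.map_infinitePi_infinitePi_of_inj (P := fun _ : Label => μ)
    (f := fun v : List ℕ => ((j, v) : Label)) (fun u v h => (Prod.ext_iff.1 h).2)
  rw [← h1]
  have h2 : (brwLaw μ θ).map Prod.fst = Measure.infinitePi fun _ : Label => μ := by
    unfold brwLaw; rw [Measure.map_fst_prod]; simp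
  rw [← h2, Measure.map_map (by fun_prop) (by fun_prop)]
  rfl

theorem treeExtinctBy_compl_le (hInt : Integrable (fun k : ℕ => (k : ℝ)) μ)
    (hmean : ∫ k, (k : ℝ) ∂μ = 1) (hne : μ ≠ Measure.dirac 1) (j h : ℕ) :
    brwLaw μ θ (treeExtinctBy d j h)ᶜ ≤ ENNReal.ofReal ((μ.real {0})⁻¹ * ((h : ℝ) + 1)⁻¹) := by
  have h1 := (measurePreserving_offspring μ θ j).measure_preimage
    (measurableSet_extinctBy h).compl.nullMeasurableSet
  have h2 : (treeExtinctBy d j h)ᶜ =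
    (fun (ω : Sample d) (v : List ℕ) => ω.1 (j, v)) ⁻¹' (extinctBy h)ᶜ := rfl
  rw [h2, h1, ← ofReal_measureReal]
  refine ENNReal.ofReal_le_ofReal ?_
  have h3 := survival_le μ hInt hmean h
  have h4 := measure_zero_pos μ hInt hmean hne
  rw [← mul_inv, ← one_div, le_div_iff₀ (by positivity)]
  linarith

/-! ### Finiteness -/

theorem IsVertex.exists_length_eq {c : List ℕ → ℕ} {u : List ℕ} (hu : IsVertex c u) {k : ℕ}
    (hk : k ≤ u.length) : ∃ v, IsVertex c v ∧ v.length = k := by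
  induction u with
  | nil => exact ⟨[], hu, by simp at hk ⊢; omega⟩
  | cons a u ih =>
    rcases Nat.lt_or_ge k (u.length + 1) with h | h
    · exact ih (isVertex_cons_iff.1 hu).1 (by omega)
    · exact ⟨a :: u, hu, le_antisymm h hk⟩

theorem length_lt_of_mem_extinctBy {c : List ℕ → ℕ} {h : ℕ} (hc : c ∈ extinctBy h) {u : List ℕ}
    (hu : IsVertex c u) : u.length < h := by
  by_contra hcon
  obtain ⟨v, hv, hvl⟩ := hu.exists_length_eq (not_lt.1 hcon)
  exact hc v hvl hv

theorem finite_isVertex_length (c : List ℕ → ℕ) (k : ℕ) :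
    {u : List ℕ | IsVertex c u ∧ u.length = k}.Finite := by
  induction k with
  | zero =>
    refine (Set.finite_singleton []).subset fun u hu => ?_
    exact List.eq_nil_of_length_eq_zero hu.2
  | succ k ih =>
    refine (ih.biUnion fun u _ => (Set.finite_lt_nat (c u)).image fun i => i :: u).subset ?_
    rintro (_ | ⟨a, u⟩) ⟨hu, hl⟩
    · simp at hl
    · obtain ⟨h1, h2⟩ := isVertex_cons_iff.1 hu
      exact Set.mem_biUnion (x := u) ⟨h1, by simpa using hl⟩ ⟨a, h2, rfl⟩

theorem finite_isVertex_of_mem_extinctBy {c : List ℕ → ℕ} {h : ℕ} (hc : c ∈ extinctBy h) :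
    {u | IsVertex c u}.Finite := by
  refine ((Set.finite_lt_nat h).biUnion fun k _ => finite_isVertex_length c k).subset ?_
  intro u hu
  exact Set.mem_biUnion (x := u.length) (length_lt_of_mem_extinctBy hc hu) ⟨hu, rfl⟩

theorem finite_range {ω : Sample d} (hω : ∀ j, ∃ h, ω ∈ treeExtinctBy d j h) (n : ℕ) :
    (range ω n).Finite := by
  have : range ω n = ⋃ j ∈ {j | j < n}, (fun u => position ω j u) '' subtree ω j := by
    ext x; simp [range]
  rw [this]
  refine (Set.finite_lt_nat n).biUnion fun j _ => ?_
  obtain ⟨h, hh⟩ := hω j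
  exact (finite_isVertex_of_mem_extinctBy hh).image _

theorem ae_exists_treeExtinctBy (hInt : Integrable (fun k : ℕ => (k : ℝ)) μ)
    (hmean : ∫ k, (k : ℝ) ∂μ = 1) (hne : μ ≠ Measure.dirac 1) :
    ∀ᵐ ω ∂brwLaw μ θ, ∀ j, ∃ h, ω ∈ treeExtinctBy d j h := by
  rw [ae_all_iff]
  intro j
  rw [ae_iff]
  refine le_antisymm ?_ zero_le
  have hlim : Tendsto (fun h : ℕ => ENNReal.ofReal ((μ.real {0})⁻¹ * ((h : ℝ) + 1)⁻¹)) atTop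
      (𝓝 0) := by
    rw [← ENNReal.ofReal_zero]
    refine ENNReal.tendsto_ofReal ?_
    have h1 : Tendsto (fun h : ℕ => ((h : ℝ) + 1)⁻¹) atTop (𝓝 0) := by
      simpa [one_div] using tendsto_one_div_add_atTop_nhds_zero_nat (𝕜 := ℝ)
    simpa using h1.const_mul ((μ.real {0})⁻¹)
  refine ge_of_tendsto' hlim fun h => ?_
  refine (measure_mono fun ω hω => ?_).trans (treeExtinctBy_compl_le μ θ hInt hmean hne j h)
  exact fun hh => hω ⟨h, hh⟩

end

section

variable {d : ℕ}

/-! ### Exponential moments of the displacements -/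

theorem exp_le_one_add_add_sq_mul (s : ℝ) : Real.exp s ≤ 1 + s + s ^ 2 * Real.exp |s| := by
  have he : 1 ≤ Real.exp |s| := Real.one_le_exp (abs_nonneg s)
  rcases le_or_gt |s| 1 with h | h
  · have h1 := (abs_le.1 (Real.abs_exp_sub_one_sub_id_le h)).2
    nlinarith [sq_nonneg s]
  · rcases lt_abs.1 h with h | h
    · have : |s| = s := abs_of_pos (by linarith)
      rw [this]
      nlinarith [Real.exp_pos s, mul_pos (by linarith : 0 < s - 1) (by linarith : 0 < s + 1)]
    · have : Real.exp s ≤ 1 := Real.exp_le_one_iff.2 (by linarith)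
      nlinarith [sq_nonneg s, mul_pos (by linarith : 0 < -s - 1) (by linarith : 0 < -s)]

/-- The Laplace transform of a coordinate of a jump. -/
def laplace (θ : Measure (Lattice d)) (e : Fin d) (t : ℝ) : ℝ≥0∞ :=
  ∫⁻ x, ENNReal.ofReal (Real.exp (t * x e)) ∂θ

theorem lintegral_exp_stepLaw (θ : Measure (Lattice d)) [IsProbabilityMeasure θ] (e : Fin d)
    (t : ℝ) (m : ℕ) :
    ∫⁻ x, ENNReal.ofReal (Real.exp (t * x e)) ∂stepLaw θ m = laplace θ e t ^ m := by
  induction m with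
  | zero => simp [lintegral_stepLaw_zero]
  | succ m ih =>
    rw [lintegral_stepLaw_succ, pow_succ', ← ih, laplace,
      ← lintegral_mul_const _ .of_discrete]
    refine lintegral_congr fun x => ?_
    rw [← lintegral_const_mul _ .of_discrete]
    refine lintegral_congr fun y => ?_
    rw [← ENNReal.ofReal_mul (Real.exp_pos _).le, ← Real.exp_add]
    congr 2; simp; ring

theorem laplace_neg (θ : Measure (Lattice d)) (hθ : ∀ x : Lattice d, θ {-x} = θ {x}) (e : Fin d)
    (t : ℝ) : laplace θ e (-t) = laplace θ e t := by
  rw [laplace, ← lintegral_neg_eq θ hθ]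
  simp [laplace]

/-- By symmetry the transform is its own average over `±t`, where the linear term cancels. Half of
`c` pays for the exponential in the remainder, the other half for the square. -/
theorem exists_laplace_le (θ : Measure (Lattice d)) [IsProbabilityMeasure θ]
    (hθ : ∀ x : Lattice d, θ {-x} = θ {x})
    (hexp : ∃ c : ℝ, 0 < c ∧ Integrable (fun x => Real.exp (c * ‖toEuclidean x‖)) θ) :
    ∃ t₀ C : ℝ, 0 < t₀ ∧ 0 < C ∧ ∀ (e : Fin d) (t : ℝ), 0 ≤ t → t ≤ t₀ →
      laplace θ e t ≤ ENNReal.ofReal (Real.exp (C * t ^ 2)) := by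
  obtain ⟨c, hc, hInt⟩ := hexp
  set B := ∫ x, Real.exp (c * ‖toEuclidean x‖) ∂θ with hB
  have hB0 : 0 ≤ B := integral_nonneg fun _ => (Real.exp_pos _).le
  refine ⟨c / 2, 8 / c ^ 2 * B + 1, by positivity, by positivity, fun e t ht0 ht => ?_⟩
  have hpt : ∀ x : Lattice d, Real.exp (t * x e) + Real.exp (-t * x e) ≤
      2 * (1 + t ^ 2 * (8 / c ^ 2) * Real.exp (c * ‖toEuclidean x‖)) := by
    intro x
    have h1 := exp_le_one_add_add_sq_mul (t * x e)
    have h2 := exp_le_one_add_add_sq_mul (-t * x e)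
    have h3 : |-t * (x e : ℝ)| = |t * x e| := by rw [neg_mul, abs_neg]
    have h4 : (-t * (x e : ℝ)) ^ 2 = (t * x e) ^ 2 := by ring
    rw [h3, h4] at h2
    set N := ‖toEuclidean x‖ with hN
    have hN0 : 0 ≤ N := norm_nonneg _
    have hxN : |(x e : ℝ)| ≤ N := abs_le_norm_toEuclidean x e
    have h5 : Real.exp |t * x e| ≤ Real.exp (c / 2 * N) := by
      rw [abs_mul, abs_of_nonneg ht0]
      exact Real.exp_le_exp.2 (mul_le_mul ht hxN (abs_nonneg _) (by positivity))
    have h6 : (x e : ℝ) ^ 2 ≤ 8 / c ^ 2 * Real.exp (c / 2 * N) := by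
      have h7 := Real.quadratic_le_exp_of_nonneg (x := c / 2 * N) (by positivity)
      have h8 : (x e : ℝ) ^ 2 ≤ N ^ 2 := by rw [← sq_abs]; exact pow_le_pow_left₀ (abs_nonneg _) hxN 2
      have h9 : N ^ 2 = 8 / c ^ 2 * ((c / 2 * N) ^ 2 / 2) := by field_simp; ring
      have h10 : (c / 2 * N) ^ 2 / 2 ≤ Real.exp (c / 2 * N) := by
        have : 0 ≤ c / 2 * N := by positivity
        linarith
      rw [h9] at h8
      exact h8.trans (by gcongr)
    have h11 : (t * x e) ^ 2 * Real.exp |t * x e| ≤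
        t ^ 2 * (8 / c ^ 2) * Real.exp (c * N) := by
      calc (t * x e) ^ 2 * Real.exp |t * x e| = t ^ 2 * ((x e : ℝ) ^ 2 * Real.exp |t * x e|) := by ring
        _ ≤ t ^ 2 * (8 / c ^ 2 * Real.exp (c / 2 * N) * Real.exp (c / 2 * N)) := by gcongr
        _ = t ^ 2 * (8 / c ^ 2) * Real.exp (c * N) := by
            rw [mul_assoc (8 / c ^ 2), ← Real.exp_add, ← mul_assoc]; congr 2; ring
    linarith
  have hsum : 2 * laplace θ e t ≤ 2 * ENNReal.ofReal (1 + t ^ 2 * (8 / c ^ 2) * B) := by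
    have hi : Integrable (fun x => t ^ 2 * (8 / c ^ 2) * Real.exp (c * ‖toEuclidean x‖)) θ :=
      hInt.const_mul _
    calc 2 * laplace θ e t = laplace θ e t + laplace θ e (-t) := by rw [laplace_neg θ hθ, two_mul]
      _ = ∫⁻ x, ENNReal.ofReal (Real.exp (t * x e) + Real.exp (-t * x e)) ∂θ := by
          rw [laplace, laplace, ← lintegral_add_left .of_discrete]
          refine lintegral_congr fun x => ?_
          rw [ENNReal.ofReal_add (Real.exp_pos _).le (Real.exp_pos _).le]
      _ ≤ ∫⁻ x, ENNReal.ofReal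
            (2 * (1 + t ^ 2 * (8 / c ^ 2) * Real.exp (c * ‖toEuclidean x‖))) ∂θ :=
          lintegral_mono fun x => ENNReal.ofReal_le_ofReal (hpt x)
      _ = 2 * ENNReal.ofReal (1 + t ^ 2 * (8 / c ^ 2) * B) := by
          have hi' : Integrable (fun x : Lattice d =>
              2 * (1 + t ^ 2 * (8 / c ^ 2) * Real.exp (c * ‖toEuclidean x‖))) θ :=
            ((integrable_const (1 : ℝ)).add hi).const_mul 2
          rw [← ofReal_integral_eq_lintegral_ofReal hi' (ae_of_all _ fun x => by positivity)]
          rw [integral_const_mul, integral_add (integrable_const _) hi, integral_const_mul,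
            ENNReal.ofReal_mul zero_le_two]
          simp [hB]
  have h1 := (ENNReal.mul_le_mul_iff_right two_ne_zero ENNReal.ofNat_ne_top).1 hsum
  refine h1.trans (ENNReal.ofReal_le_ofReal ?_)
  have := Real.add_one_le_exp ((8 / c ^ 2 * B + 1) * t ^ 2)
  nlinarith [sq_nonneg t]

/-- Chernoff's bound in the `2 * d` signed coordinate directions; `t` stays free, to be adapted to
the number of steps. -/
theorem exists_stepLaw_compl_box_le (θ : Measure (Lattice d)) [IsProbabilityMeasure θ]
    (hθ : ∀ x : Lattice d, θ {-x} = θ {x})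
    (hexp : ∃ c : ℝ, 0 < c ∧ Integrable (fun x => Real.exp (c * ‖toEuclidean x‖)) θ) :
    ∃ t₀ C : ℝ, 0 < t₀ ∧ 0 < C ∧ ∀ (m r : ℕ) (t : ℝ), 0 ≤ t → t ≤ t₀ →
      stepLaw θ m (box d r : Set (Lattice d))ᶜ ≤
        ENNReal.ofReal (2 * d * Real.exp (C * t ^ 2 * m - t * r)) := by
  obtain ⟨t₀, C, ht₀, hC, h⟩ := exists_laplace_le θ hθ hexp
  refine ⟨t₀, C, ht₀, hC, fun m r t ht0 ht => ?_⟩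
  have hone : ∀ (e : Fin d) (s : ℝ), laplace θ e s = laplace θ e t →
      stepLaw θ m {x | t * r ≤ s * x e} ≤ ENNReal.ofReal (Real.exp (C * t ^ 2 * m - t * r)) := by
    intro e s hs
    have h1 := mul_meas_ge_le_lintegral (μ := stepLaw θ m)
      (f := fun x : Lattice d => ENNReal.ofReal (Real.exp (s * x e))) .of_discrete
      (ENNReal.ofReal (Real.exp (t * r)))
    rw [lintegral_exp_stepLaw, hs] at h1
    have h2 : ENNReal.ofReal (Real.exp (t * r)) * stepLaw θ m {x | t * r ≤ s * x e} ≤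
        ENNReal.ofReal (Real.exp (t * r)) * ENNReal.ofReal (Real.exp (C * t ^ 2 * m - t * r)) := by
      refine le_trans (mul_le_mul_right (measure_mono fun x hx => ?_) _) (h1.trans ?_)
      · exact ENNReal.ofReal_le_ofReal (Real.exp_le_exp.2 hx)
      · refine (pow_le_pow_left' (h e t ht0 ht) m).trans (le_of_eq ?_)
        rw [← ENNReal.ofReal_mul (Real.exp_pos _).le, ← Real.exp_add,
          ← ENNReal.ofReal_pow (Real.exp_pos _).le, ← Real.exp_nat_mul]
        congr 2; ring
    exact (ENNReal.mul_le_mul_iff_right (by simp [Real.exp_pos]) ENNReal.ofReal_ne_top).1 h2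
  have hsub : (box d r : Set (Lattice d))ᶜ ⊆
      ⋃ e ∈ Finset.univ, ({x : Lattice d | t * r ≤ t * x e} ∪ {x | t * r ≤ -t * x e}) := by
    intro x hx
    have hx' : ¬ ∀ i, |x i| ≤ r := fun h => hx (mem_box.2 h)
    push Not at hx'
    obtain ⟨e, he⟩ := hx'
    refine Set.mem_biUnion (x := e) (by simp) ?_
    rcases lt_abs.1 he with h' | h'
    · left
      have : (r : ℝ) ≤ x e := by exact_mod_cast h'.le
      exact mul_le_mul_of_nonneg_left this ht0
    · right
      have : (r : ℝ) ≤ -x e := by exact_mod_cast h'.le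
      have := mul_le_mul_of_nonneg_left this ht0
      show t * r ≤ -t * x e
      linarith
  calc _ ≤ ∑ e : Fin d, stepLaw θ m ({x : Lattice d | t * r ≤ t * x e} ∪ {x | t * r ≤ -t * x e}) :=
        (measure_mono hsub).trans (measure_biUnion_finset_le _ _)
    _ ≤ ∑ _e : Fin d, (ENNReal.ofReal (Real.exp (C * t ^ 2 * m - t * r)) +
          ENNReal.ofReal (Real.exp (C * t ^ 2 * m - t * r))) :=
        Finset.sum_le_sum fun e _ => (measure_union_le _ _).trans
          (add_le_add (hone e t rfl) (hone e (-t) (laplace_neg θ hθ e t)))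
    _ = _ := by
        rw [Finset.sum_const, Finset.card_univ, Fintype.card_fin, ← two_mul, nsmul_eq_mul,
          ← ENNReal.ofReal_natCast, ← ENNReal.ofReal_ofNat, ← ENNReal.ofReal_mul (by norm_num),
          ← ENNReal.ofReal_mul (by positivity)]
        congr 1; ring

end

section

variable {d : ℕ}

/-! ### The occupation measure of the first subtrees -/

/-- Labels of the possible vertices of generation less than `h` of the first `n` subtrees. -/
abbrev Index (n h : ℕ) : Type := Fin n × (Σ k : Fin h, Level k)

theorem tsum_index (n h : ℕ) (F : ℕ → List ℕ → ℝ≥0∞) :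
    ∑' p : Index n h, F p.1 p.2.2.1 =
      ∑ i ∈ Finset.range n, ∑ k ∈ Finset.range h, ∑' u : Level k, F i u := by
  rw [ENNReal.tsum_prod', tsum_fintype, Fin.sum_univ_eq_sum_range
    (fun i => ∑' b : (Σ k : Fin h, Level k), F i b.2.1) n]
  refine Finset.sum_congr rfl fun i _ => ?_
  rw [ENNReal.tsum_sigma', tsum_fintype, Fin.sum_univ_eq_sum_range
    (fun k => ∑' u : Level k, F i u) h]

/-- The number of vertices of generation less than `h` of the first `n` subtrees. -/
def mass (ω : Sample d) (n h : ℕ) : ℝ≥0∞ := ∑' p : Index n h, alive ω p.1 p.2.2.1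

/-- The sum of `f` over the displacements between the vertices of generation less than `h` of the
first `n` subtrees. -/
def pairEnergy (ω : Sample d) (n h : ℕ) (f : Lattice d → ℝ≥0∞) : ℝ≥0∞ :=
  ∑' p : Index n h, ∑' q : Index n h, alive ω p.1 p.2.2.1 * alive ω q.1 q.2.2.1 *
    f (position ω q.1 q.2.2.1 - position ω p.1 p.2.2.1)

theorem measurable_mass (n h : ℕ) : Measurable fun ω : Sample d => mass ω n h :=
  Measurable.tsum fun _ => measurable_alive _ _

theorem measurable_pairEnergy (n h : ℕ) (f : Lattice d → ℝ≥0∞) :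
    Measurable fun ω : Sample d => pairEnergy ω n h f :=
  Measurable.tsum fun _ => Measurable.tsum fun _ => measurable_pair _ _ _ _ f

theorem pairEnergy_one (ω : Sample d) (n h : ℕ) :
    pairEnergy ω n h (fun _ => 1) = mass ω n h ^ 2 := by
  simp only [pairEnergy, mass, mul_one, ENNReal.tsum_mul_left, ENNReal.tsum_mul_right, sq]

variable (μ : Measure ℕ) [IsProbabilityMeasure μ] (θ : Measure (Lattice d)) [IsProbabilityMeasure θ]

theorem lintegral_mass (hμ : ∫⁻ k, (k : ℝ≥0∞) ∂μ = 1) (n h : ℕ) :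
    ∫⁻ ω, mass ω n h ∂brwLaw μ θ = n * h := by
  unfold mass
  rw [lintegral_tsum fun _ => (measurable_alive _ _).aemeasurable,
    tsum_index n h fun i u => ∫⁻ ω, alive ω i u ∂brwLaw μ θ]
  simp [tsum_lintegral_alive μ θ hμ]

theorem lintegral_pairEnergy (n h : ℕ) (f : Lattice d → ℝ≥0∞) :
    ∫⁻ ω, pairEnergy ω n h f ∂brwLaw μ θ =
      ∑ i ∈ Finset.range n, ∑ k ∈ Finset.range h, ∑ j ∈ Finset.range n, ∑ l ∈ Finset.range h,
        pairSum μ θ i j k l f := by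
  unfold pairEnergy
  have h1 : ∀ p : Index n h, ∫⁻ ω, ∑' q : Index n h, alive ω p.1 p.2.2.1 * alive ω q.1 q.2.2.1 *
      f (position ω q.1 q.2.2.1 - position ω p.1 p.2.2.1) ∂brwLaw μ θ =
      ∑ j ∈ Finset.range n, ∑ l ∈ Finset.range h, ∑' v : Level l,
        pairE μ θ p.1 p.2.2.1 j v f := by
    intro p
    rw [lintegral_tsum fun _ => (measurable_pair _ _ _ _ f).aemeasurable,
      ← tsum_index n h fun j v => pairE μ θ p.1 p.2.2.1 j v f]
    rfl
  rw [lintegral_tsum fun _ => (Measurable.tsum fun _ => measurable_pair _ _ _ _ f).aemeasurable]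
  simp only [h1]
  rw [tsum_index n h fun i u => ∑ j ∈ Finset.range n, ∑ l ∈ Finset.range h, ∑' v : Level l,
        pairE μ θ i u j v f]
  refine Finset.sum_congr rfl fun i _ => Finset.sum_congr rfl fun k _ => ?_
  rw [Summable.tsum_finsetSum fun _ _ => ENNReal.summable]
  refine Finset.sum_congr rfl fun j _ => ?_
  rw [Summable.tsum_finsetSum fun _ _ => ENNReal.summable]
  rfl

/-- The expected energy is at most the sum of an off-diagonal and a diagonal contribution. -/
theorem lintegral_pairEnergy_le (hμ : ∫⁻ k, (k : ℝ≥0∞) ∂μ = 1)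
    (hθ : ∀ x : Lattice d, θ {-x} = θ {x}) (n h : ℕ) (f : Lattice d → ℝ≥0∞) :
    ∫⁻ ω, pairEnergy ω n h f ∂brwLaw μ θ ≤
      (∑ i ∈ Finset.range n, ∑ k ∈ Finset.range h, ∑ j ∈ Finset.range n, ∑ l ∈ Finset.range h,
        avg θ (Nat.dist i j + (k + l)) f 0) +
      n * ∑ k ∈ Finset.range h, ∑ l ∈ Finset.range h, (1 + ∫⁻ k, (k : ℝ≥0∞) ^ 2 ∂μ) *
        ∑ m ∈ Finset.range h, avg θ (Nat.dist k l + 2 * m) f 0 := by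
  rw [lintegral_pairEnergy]
  set K := 1 + ∫⁻ k, (k : ℝ≥0∞) ^ 2 ∂μ with hK
  -- For `i = j` the first summand is not needed; keeping it makes the off-diagonal sum
  -- unrestricted.
  have hterm : ∀ i k j l, k ∈ Finset.range h → l ∈ Finset.range h → pairSum μ θ i j k l f ≤
      avg θ (Nat.dist i j + (k + l)) f 0 +
      if i = j then K * ∑ m ∈ Finset.range h, avg θ (Nat.dist k l + 2 * m) f 0 else 0 := by
    intro i k j l hk hl
    by_cases hij : i = j
    · subst hij
      rw [if_pos rfl]
      refine le_add_left ((pairSum_self_le μ θ hμ hθ i k l f).trans ?_)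
      refine mul_le_mul_right (Finset.sum_le_sum_of_subset ?_) _
      intro m hm
      simp only [Finset.mem_range] at *
      omega
    · rw [if_neg hij, add_zero, pairSum_of_ne μ θ hμ hθ hij]
  calc _ ≤ ∑ i ∈ Finset.range n, ∑ k ∈ Finset.range h, ∑ j ∈ Finset.range n,
        ∑ l ∈ Finset.range h, (avg θ (Nat.dist i j + (k + l)) f 0 +
        if i = j then K * ∑ m ∈ Finset.range h, avg θ (Nat.dist k l + 2 * m) f 0 else 0) :=
        Finset.sum_le_sum fun i _ => Finset.sum_le_sum fun k hk => Finset.sum_le_sum fun j _ =>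
          Finset.sum_le_sum fun l hl => hterm i k j l hk hl
    _ = _ := by
        simp only [Finset.sum_add_distrib]
        congr 1
        rw [← Finset.card_range n, ← nsmul_eq_mul, ← Finset.sum_const, Finset.card_range]
        refine Finset.sum_congr rfl fun i hi => Finset.sum_congr rfl fun k _ => ?_
        rw [Finset.sum_comm]
        refine Finset.sum_congr rfl fun l _ => ?_
        rw [Finset.sum_ite_eq, if_pos hi]

theorem lintegral_sq_mass_le (hμ : ∫⁻ k, (k : ℝ≥0∞) ∂μ = 1)
    (hθ : ∀ x : Lattice d, θ {-x} = θ {x}) (n h : ℕ) :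
    ∫⁻ ω, mass ω n h ^ 2 ∂brwLaw μ θ ≤
      (n * h) ^ 2 + (1 + ∫⁻ k, (k : ℝ≥0∞) ^ 2 ∂μ) * (n * h ^ 3) := by
  have := lintegral_pairEnergy_le μ θ hμ hθ n h fun _ => 1
  simp only [pairEnergy_one, avg_const, Finset.sum_const, Finset.card_range, nsmul_eq_mul,
    mul_one] at this
  refine this.trans (le_of_eq ?_)
  ring

/-- With high probability the first `n` subtrees have many vertices of generation less than `h`. -/
theorem mass_lt_le (hμ : ∫⁻ k, (k : ℝ≥0∞) ∂μ = 1) (hμ2 : ∫⁻ k, (k : ℝ≥0∞) ^ 2 ∂μ ≠ ∞)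
    (hθ : ∀ x : Lattice d, θ {-x} = θ {x}) {n h : ℕ} (hn : 1 ≤ n) (hh : 1 ≤ h) :
    brwLaw μ θ {ω | mass ω n h ≤ ENNReal.ofReal ((n : ℝ) * h / 2)} ≤
      ENNReal.ofReal (4 * (1 + (∫⁻ k, (k : ℝ≥0∞) ^ 2 ∂μ).toReal) * (h / n)) := by
  set K := (∫⁻ k, (k : ℝ≥0∞) ^ 2 ∂μ).toReal with hK
  have hn' : (1 : ℝ) ≤ n := by exact_mod_cast hn
  have hh' : (1 : ℝ) ≤ h := by exact_mod_cast hh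
  set X : Sample d → ℝ := fun ω => (mass ω n h).toReal with hX
  have hXm : Measurable X := (measurable_mass n h).ennreal_toReal
  have hfin : ∀ᵐ ω ∂brwLaw μ θ, mass ω n h < ∞ := by
    refine ae_lt_top (measurable_mass n h) ?_
    rw [lintegral_mass μ θ hμ]
    finiteness
  have hmean : ∫ ω, X ω ∂brwLaw μ θ = n * h := by
    rw [integral_toReal (measurable_mass n h).aemeasurable hfin, lintegral_mass μ θ hμ]
    simp
  have hsq : ∫⁻ ω, ENNReal.ofReal (X ω ^ 2) ∂brwLaw μ θ = ∫⁻ ω, mass ω n h ^ 2 ∂brwLaw μ θ := by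
    refine lintegral_congr_ae ?_
    filter_upwards [hfin] with ω hω
    rw [ENNReal.ofReal_pow ENNReal.toReal_nonneg, ENNReal.ofReal_toReal hω.ne]
  have hle := lintegral_sq_mass_le μ θ hμ hθ n h
  have hRtop : ((n : ℝ≥0∞) * h) ^ 2 + (1 + ∫⁻ k, (k : ℝ≥0∞) ^ 2 ∂μ) * (n * h ^ 3) ≠ ∞ := by
    finiteness
  have hi : Integrable (fun ω => X ω ^ 2) (brwLaw μ θ) := by
    refine ⟨(hXm.pow_const 2).aestronglyMeasurable, ?_⟩
    rw [hasFiniteIntegral_iff_ofReal (ae_of_all _ fun _ => sq_nonneg _), hsq]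
    exact lt_of_le_of_lt hle hRtop.lt_top
  have hL : MemLp X 2 (brwLaw μ θ) := (memLp_two_iff_integrable_sq hXm.aestronglyMeasurable).2 hi
  have hsq' : ∫ ω, X ω ^ 2 ∂brwLaw μ θ ≤ (n * h) ^ 2 + (1 + K) * (n * h ^ 3) := by
    rw [integral_eq_lintegral_of_nonneg_ae (ae_of_all _ fun _ => sq_nonneg _)
      (hXm.pow_const 2).aestronglyMeasurable, hsq]
    refine (ENNReal.toReal_mono hRtop hle).trans (le_of_eq ?_)
    rw [ENNReal.toReal_add (by finiteness) (by finiteness)]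
    simp only [ENNReal.toReal_mul, ENNReal.toReal_pow, ENNReal.toReal_natCast]
    rw [ENNReal.toReal_add (by finiteness) hμ2]
    simp [hK]
  -- The off-diagonal part of the second moment bound is the squared mean and cancels. Chebyshev at
  -- half the mean divides the rest by `(n * h / 2) ^ 2`, which leaves the ratio `h / n`.
  have hvar : ProbabilityTheory.variance X (brwLaw μ θ) ≤ (1 + K) * (n * h ^ 3) := by
    rw [ProbabilityTheory.variance_eq_sub hL, hmean]
    have : ∫ ω, (X ^ 2) ω ∂brwLaw μ θ = ∫ ω, X ω ^ 2 ∂brwLaw μ θ := rfl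
    rw [this]; linarith
  have hcheb := ProbabilityTheory.meas_ge_le_variance_div_sq hL (c := (n : ℝ) * h / 2)
    (by positivity)
  rw [hmean] at hcheb
  refine le_trans ?_ (hcheb.trans (ENNReal.ofReal_le_ofReal ?_))
  · refine measure_mono fun ω hω => ?_
    have h1 : X ω ≤ (n : ℝ) * h / 2 := by
      have := ENNReal.toReal_mono ENNReal.ofReal_ne_top hω
      rwa [ENNReal.toReal_ofReal (by positivity)] at this
    show (n : ℝ) * h / 2 ≤ |X ω - n * h|
    rw [abs_sub_comm]
    exact le_trans (by linarith) (le_abs_self _)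
  · rw [div_le_iff₀ (by positivity)]
    refine hvar.trans (le_of_eq ?_)
    field_simp
    ring

/-! ### The expected energy -/

/-- Each distance `s` is attained by at most two indices, `i + s` and `i - s`. -/
theorem sum_dist_le (g : ℕ → ℝ≥0∞) {n i : ℕ} (hi : i < n) :
    ∑ j ∈ Finset.range n, g (Nat.dist i j) ≤ 2 * ∑ s ∈ Finset.range n, g s := by
  calc ∑ j ∈ Finset.range n, g (Nat.dist i j)
      ≤ ∑ j ∈ Finset.range n, ∑ s ∈ Finset.range n,
          ((if j = i + s then g s else 0) + if j = i - s then g s else 0) := by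
        refine Finset.sum_le_sum fun j hj => ?_
        have hjn := Finset.mem_range.1 hj
        have hs : Nat.dist i j ∈ Finset.range n := by
          rw [Finset.mem_range, Nat.dist]; omega
        refine le_trans ?_ (Finset.single_le_sum (fun _ _ => zero_le) hs)
        rcases le_total i j with h | h
        · rw [if_pos (by rw [Nat.dist]; omega)]; exact le_add_right le_rfl
        · rw [if_pos (c := j = i - Nat.dist i j) (by rw [Nat.dist]; omega)]
          exact le_add_left le_rfl
    _ = ∑ s ∈ Finset.range n, ∑ j ∈ Finset.range n,
          ((if j = i + s then g s else 0) + if j = i - s then g s else 0) := Finset.sum_comm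
    _ ≤ ∑ s ∈ Finset.range n, 2 * g s := by
        refine Finset.sum_le_sum fun s _ => ?_
        rw [Finset.sum_add_distrib, Finset.sum_ite_eq', Finset.sum_ite_eq', two_mul]
        gcongr <;> split_ifs <;> simp
    _ = _ := by rw [Finset.mul_sum]

/-- A decreasing power of `s + 1`. -/
def invPow (b : ℝ) (s : ℕ) : ℝ≥0∞ := ENNReal.ofReal (((s : ℝ) + 1) ^ (-b))

theorem invPow_anti {b : ℝ} (hb : 0 ≤ b) {s t : ℕ} (h : s ≤ t) : invPow b t ≤ invPow b s := by
  refine ENNReal.ofReal_le_ofReal (Real.rpow_le_rpow_of_nonpos (by positivity) ?_ (by linarith))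
  have : (s : ℝ) ≤ t := by exact_mod_cast h
  linarith

theorem invPow_mul (a b : ℝ) (s : ℕ) : invPow (a + b) s = invPow a s * invPow b s := by
  rw [invPow, invPow, invPow, ← ENNReal.ofReal_mul (by positivity), neg_add,
    Real.rpow_add (by positivity)]

theorem sum_invPow_le {b : ℝ} (hb0 : 0 ≤ b) (hb : b < 1) (n : ℕ) :
    ∑ s ∈ Finset.range n, invPow b s ≤ ENNReal.ofReal ((1 - b)⁻¹ * (n : ℝ) ^ (1 - b)) := by
  unfold invPow
  rw [← ENNReal.ofReal_sum_of_nonneg fun _ _ => by positivity]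
  exact ENNReal.ofReal_le_ofReal (sum_range_rpow_le hb0 hb n)

/-- The exponent `a` is split evenly over the parts `|i - j|`, `k`, `l` of the tree distance, so the
sums separate. Each has exponent `a / 3 < 1` and order `n ^ (1 - a/3)`; the free index `i`
contributes another `n`. -/
theorem offDiagonal_sum_le {a C : ℝ} (ha0 : 0 ≤ a) (ha : a < 3) (hC : 0 ≤ C) (F : ℕ → ℝ≥0∞)
    (hF : ∀ s, F s ≤ ENNReal.ofReal C * invPow a s) {n h : ℕ} (hn : 1 ≤ n) (hh : h ≤ n) :
    ∑ i ∈ Finset.range n, ∑ k ∈ Finset.range h, ∑ j ∈ Finset.range n, ∑ l ∈ Finset.range h,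
        F (Nat.dist i j + (k + l)) ≤
      ENNReal.ofReal (2 * C * (1 - a / 3)⁻¹ ^ 3 * (n : ℝ) ^ (4 - a)) := by
  have hn0 : (0 : ℝ) < n := by exact_mod_cast hn
  set b := a / 3 with hb
  have hb0 : 0 ≤ b := by positivity
  have hb1 : b < 1 := by rw [hb]; linarith
  set S := ∑ s ∈ Finset.range n, invPow b s with hS
  have hSle := sum_invPow_le hb0 hb1 n
  have hsub : Finset.range h ⊆ Finset.range n := Finset.range_subset_range.2 hh
  have hterm : ∀ i k j l, F (Nat.dist i j + (k + l)) ≤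
      ENNReal.ofReal C * (invPow b k * (invPow b (Nat.dist i j) * invPow b l)) := by
    intro i k j l
    refine (hF _).trans (mul_le_mul_right ?_ _)
    have hab : a = b + (b + b) := by rw [hb]; ring
    rw [hab, invPow_mul, invPow_mul]
    exact mul_le_mul' (invPow_anti hb0 (by omega))
      (mul_le_mul' (invPow_anti hb0 (by omega)) (invPow_anti hb0 (by omega)))
  calc _ ≤ ∑ i ∈ Finset.range n, ∑ k ∈ Finset.range n, ∑ j ∈ Finset.range n,
        ∑ l ∈ Finset.range n,
        ENNReal.ofReal C * (invPow b k * (invPow b (Nat.dist i j) * invPow b l)) := by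
        refine Finset.sum_le_sum fun i _ => (Finset.sum_le_sum_of_subset hsub).trans
          (Finset.sum_le_sum fun k _ => Finset.sum_le_sum fun j _ =>
            (Finset.sum_le_sum_of_subset hsub).trans (Finset.sum_le_sum fun l _ => hterm i k j l))
    _ = ∑ i ∈ Finset.range n, ENNReal.ofReal C * (S *
          ((∑ j ∈ Finset.range n, invPow b (Nat.dist i j)) * S)) := by
        simp only [← Finset.mul_sum, ← Finset.sum_mul, ← hS]
    _ ≤ ∑ _i ∈ Finset.range n, ENNReal.ofReal C * (S * ((2 * S) * S)) := by
        gcongr with i hi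
        exact sum_dist_le _ (Finset.mem_range.1 hi)
    _ ≤ ∑ _i ∈ Finset.range n, ENNReal.ofReal C *
          (ENNReal.ofReal ((1 - b)⁻¹ * (n : ℝ) ^ (1 - b)) * ((2 *
          ENNReal.ofReal ((1 - b)⁻¹ * (n : ℝ) ^ (1 - b))) *
          ENNReal.ofReal ((1 - b)⁻¹ * (n : ℝ) ^ (1 - b)))) := by gcongr
    _ = _ := by
        have hb2 : 0 < 1 - b := by linarith
        rw [Finset.sum_const, Finset.card_range, nsmul_eq_mul, ← ENNReal.ofReal_natCast,
          ← ENNReal.ofReal_ofNat 2, ← ENNReal.ofReal_mul (by positivity),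
          ← ENNReal.ofReal_mul (by positivity), ← ENNReal.ofReal_mul (by positivity),
          ← ENNReal.ofReal_mul (by positivity), ← ENNReal.ofReal_mul (by positivity)]
        congr 1
        have : (n : ℝ) ^ (4 - a) = n * ((n : ℝ) ^ (1 - b)) ^ 3 := by
          rw [← Real.rpow_natCast, ← Real.rpow_mul hn0.le]
          conv_rhs => rw [← Real.rpow_one_add' hn0.le (by push_cast; linarith)]
          congr 1; rw [hb]; push_cast; ring
        rw [this]; ring

/-- As off the diagonal, but only `|k - l|` and `m` are available to share `a`, hence the
requirement `a / 2 < 1`. The subtree and `k` are free and contribute `n ^ 2`. -/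
theorem diagonal_sum_le {a C : ℝ} (ha0 : 0 ≤ a) (ha : a < 2) (hC : 0 ≤ C) (F : ℕ → ℝ≥0∞)
    (hF : ∀ s, F s ≤ ENNReal.ofReal C * invPow a s) {n h : ℕ} (hn : 1 ≤ n) (hh : h ≤ n) :
    n * ∑ k ∈ Finset.range h, ∑ l ∈ Finset.range h,
        ∑ m ∈ Finset.range h, F (Nat.dist k l + 2 * m) ≤
      ENNReal.ofReal (2 * C * (1 - a / 2)⁻¹ ^ 2 * (n : ℝ) ^ (4 - a)) := by
  have hn0 : (0 : ℝ) < n := by exact_mod_cast hn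
  set b := a / 2 with hb
  have hb0 : 0 ≤ b := by positivity
  have hb1 : b < 1 := by rw [hb]; linarith
  set S := ∑ s ∈ Finset.range n, invPow b s with hS
  have hSle := sum_invPow_le hb0 hb1 n
  have hsub : Finset.range h ⊆ Finset.range n := Finset.range_subset_range.2 hh
  have hterm : ∀ k l m, F (Nat.dist k l + 2 * m) ≤
      ENNReal.ofReal C * (invPow b (Nat.dist k l) * invPow b m) := by
    intro k l m
    refine (hF _).trans (mul_le_mul_right ?_ _)
    have hab : a = b + b := by rw [hb]; ring
    rw [hab, invPow_mul]
    exact mul_le_mul' (invPow_anti hb0 (by omega)) (invPow_anti hb0 (by omega))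
  calc _ ≤ n * ∑ k ∈ Finset.range n, ∑ l ∈ Finset.range n, ∑ m ∈ Finset.range n,
        ENNReal.ofReal C * (invPow b (Nat.dist k l) * invPow b m) := by
        refine mul_le_mul_right ?_ _
        exact (Finset.sum_le_sum_of_subset hsub).trans (Finset.sum_le_sum fun k _ =>
          (Finset.sum_le_sum_of_subset hsub).trans (Finset.sum_le_sum fun l _ =>
          (Finset.sum_le_sum_of_subset hsub).trans (Finset.sum_le_sum fun m _ => hterm k l m)))
    _ = n * ∑ k ∈ Finset.range n, ENNReal.ofReal C *
          ((∑ l ∈ Finset.range n, invPow b (Nat.dist k l)) * S) := by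
        simp only [← Finset.mul_sum, ← Finset.sum_mul, ← hS]
    _ ≤ n * ∑ _k ∈ Finset.range n, ENNReal.ofReal C * ((2 * S) * S) := by
        gcongr with i hi
        exact sum_dist_le _ (Finset.mem_range.1 hi)
    _ ≤ n * ∑ _k ∈ Finset.range n, ENNReal.ofReal C * ((2 *
          ENNReal.ofReal ((1 - b)⁻¹ * (n : ℝ) ^ (1 - b))) *
          ENNReal.ofReal ((1 - b)⁻¹ * (n : ℝ) ^ (1 - b))) := by gcongr
    _ = _ := by
        have hb2 : 0 < 1 - b := by linarith
        rw [Finset.sum_const, Finset.card_range, nsmul_eq_mul, ← ENNReal.ofReal_natCast,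
          ← ENNReal.ofReal_ofNat 2, ← ENNReal.ofReal_mul (by positivity),
          ← ENNReal.ofReal_mul (by positivity), ← ENNReal.ofReal_mul (by positivity),
          ← ENNReal.ofReal_mul (by positivity), ← ENNReal.ofReal_mul (by positivity)]
        congr 1
        have : (n : ℝ) ^ (4 - a) = n * n * ((n : ℝ) ^ (1 - b)) ^ 2 := by
          rw [← sq, ← Real.rpow_natCast, ← Real.rpow_natCast, ← Real.rpow_mul hn0.le,
            ← Real.rpow_add hn0]
          congr 1; rw [hb]; push_cast; ring
        rw [this]; ring

theorem exists_lintegral_energy_le (hμ : ∫⁻ k, (k : ℝ≥0∞) ∂μ = 1)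
    (hμ2 : ∫⁻ k, (k : ℝ≥0∞) ^ 2 ∂μ ≠ ∞) (hθ : ∀ x : Lattice d, θ {-x} = θ {x})
    (η : Measure (Lattice d)) [IsProbabilityMeasure η] (hd : 3 ≤ d) (hd5 : d ≤ 5)
    (hη : IsIrreducible η) (hθi : IsIrreducible θ) :
    ∃ C : ℝ, 0 < C ∧ ∀ n h : ℕ, 1 ≤ n → h ≤ n →
      ∫⁻ ω, pairEnergy ω n h (green η) ∂brwLaw μ θ ≤
        ENNReal.ofReal (C * (n : ℝ) ^ (4 - ((d : ℝ) - 2) / 2)) := by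
  obtain ⟨C, hC, hG⟩ := exists_lintegral_green_le η θ hd hη hθi
  have hd' : (3 : ℝ) ≤ d := by exact_mod_cast hd
  have hd5' : (d : ℝ) ≤ 5 := by exact_mod_cast hd5
  set a := ((d : ℝ) - 2) / 2 with ha
  have ha0 : 0 ≤ a := by rw [ha]; linarith
  have ha2 : a < 2 := by rw [ha]; linarith
  set K := (∫⁻ k, (k : ℝ≥0∞) ^ 2 ∂μ).toReal with hK
  have hK0 : 0 ≤ K := ENNReal.toReal_nonneg
  have hKe : 1 + ∫⁻ k, (k : ℝ≥0∞) ^ 2 ∂μ = ENNReal.ofReal (1 + K) := by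
    rw [ENNReal.ofReal_add zero_le_one hK0, ENNReal.ofReal_one, hK, ENNReal.ofReal_toReal hμ2]
  have h3 : 0 < 1 - a / 3 := by linarith
  have h2 : 0 < 1 - a / 2 := by linarith
  refine ⟨2 * C * (1 - a / 3)⁻¹ ^ 3 + (1 + K) * (2 * C * (1 - a / 2)⁻¹ ^ 2), by positivity,
    fun n h hn hh => ?_⟩
  have hF : ∀ s, avg θ s (green η) 0 ≤ ENNReal.ofReal C * invPow a s := by
    intro s
    rw [avg_zero_eq, invPow, ← ENNReal.ofReal_mul hC.le]
    exact hG s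
  refine (lintegral_pairEnergy_le μ θ hμ hθ n h (green η)).trans ?_
  rw [add_mul, ENNReal.ofReal_add (by positivity) (by positivity)]
  refine add_le_add
    (offDiagonal_sum_le ha0 (by linarith) hC.le (fun s => avg θ s (green η) 0) hF hn hh) ?_
  rw [hKe, mul_assoc (1 + K), ENNReal.ofReal_mul (by positivity)]
  simp only [← Finset.mul_sum]
  rw [mul_left_comm]
  exact mul_le_mul_right (diagonal_sum_le ha0 ha2 hC.le (fun s => avg θ s (green η) 0) hF hn hh) _

end

section

variable {d : ℕ}

/-! ### Almost sure bounds along the powers of two -/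

/-- Along powers of two any negative power of `n` is summable, so Borel–Cantelli tolerates
arbitrarily weak polynomial bounds. -/
theorem ae_eventually_notMem_of_le_geometric {Ω : Type*} [MeasurableSpace Ω] (P : Measure Ω)
    (s : ℕ → Set Ω) {C b : ℝ} (hC : 0 ≤ C) (hb : 0 < b)
    (h : ∀ k : ℕ, P (s k) ≤ ENNReal.ofReal (C * ((2 ^ k : ℕ) : ℝ) ^ (-b))) :
    ∀ᵐ ω ∂P, ∀ᶠ k in atTop, ω ∉ s k := by
  refine ae_eventually_notMem (ne_top_of_le_ne_top ?_ (ENNReal.tsum_le_tsum h))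
  have hr : ∀ k : ℕ, ((2 ^ k : ℕ) : ℝ) ^ (-b) = ((2 : ℝ) ^ (-b)) ^ k := by
    intro k
    rw [Nat.cast_pow, Nat.cast_ofNat, ← Real.rpow_natCast, ← Real.rpow_natCast,
      ← Real.rpow_mul zero_le_two, ← Real.rpow_mul zero_le_two, mul_comm]
  have hlt : (2 : ℝ) ^ (-b) < 1 := Real.rpow_lt_one_of_one_lt_of_neg one_lt_two (by linarith)
  have hs : Summable fun k : ℕ => C * ((2 ^ k : ℕ) : ℝ) ^ (-b) := by
    simp only [hr]
    exact (summable_geometric_of_lt_one (by positivity) hlt).mul_left C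
  rw [← ENNReal.ofReal_tsum_of_nonneg (fun k => by positivity) hs]
  exact ENNReal.ofReal_ne_top

variable (μ : Measure ℕ) [IsProbabilityMeasure μ] (θ : Measure (Lattice d)) [IsProbabilityMeasure θ]

/-- Lower bound for the capacity of a set that contains the range of the first `2 ^ k` subtrees. -/
theorem ae_eventually_le_capacity (hμ : ∫⁻ k, (k : ℝ≥0∞) ∂μ = 1)
    (hμ2 : ∫⁻ k, (k : ℝ≥0∞) ^ 2 ∂μ ≠ ∞) (hθ : ∀ x : Lattice d, θ {-x} = θ {x})
    (η : Measure (Lattice d)) [IsProbabilityMeasure η] (hd : 3 ≤ d) (hd5 : d ≤ 5)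
    (hη : IsIrreducible η) (hθi : IsIrreducible θ) {δ : ℝ} (hδ : 0 < δ) (hδ1 : δ ≤ 1) :
    ∀ᵐ ω ∂brwLaw μ θ, ∀ᶠ k : ℕ in atTop, ∀ A : Finset (Lattice d), range ω (2 ^ k) ⊆ A →
      64⁻¹ * ((2 ^ k : ℕ) : ℝ) ^ (((d : ℝ) - 2) / 2 - 3 * δ) ≤ capacity η A := by
  obtain ⟨C, hC, hE⟩ := exists_lintegral_energy_le μ θ hμ hμ2 hθ η hd hd5 hη hθi
  set a := ((d : ℝ) - 2) / 2 with ha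
  -- Stopping slightly below generation `n` makes the error `h / n` of `mass_lt_le` a negative power
  -- of `n`; with `h = n` the variance bound would only match the squared mean.
  set h : ℕ → ℕ := fun k => ⌊((2 ^ k : ℕ) : ℝ) ^ (1 - δ)⌋₊ with hh
  have hN1 : ∀ k : ℕ, (1 : ℝ) ≤ ((2 ^ k : ℕ) : ℝ) := fun k => by
    exact_mod_cast Nat.one_le_two_pow
  have hx1 : ∀ k : ℕ, (1 : ℝ) ≤ ((2 ^ k : ℕ) : ℝ) ^ (1 - δ) := fun k =>
    Real.one_le_rpow (hN1 k) (by linarith)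
  have hh1 : ∀ k, 1 ≤ h k := fun k => (Nat.one_le_floor_iff _).2 (hx1 k)
  have hhle : ∀ k, (h k : ℝ) ≤ ((2 ^ k : ℕ) : ℝ) ^ (1 - δ) := fun k =>
    Nat.floor_le (by positivity)
  have hhN : ∀ k, h k ≤ 2 ^ k := fun k => by
    have : (h k : ℝ) ≤ ((2 ^ k : ℕ) : ℝ) := (hhle k).trans (by
      conv_rhs => rw [← Real.rpow_one ((2 ^ k : ℕ) : ℝ)]
      exact Real.rpow_le_rpow_of_exponent_le (hN1 k) (by linarith))
    exact_mod_cast this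
  have hhge : ∀ k, ((2 ^ k : ℕ) : ℝ) ^ (1 - δ) / 2 ≤ h k := fun k => by
    have h1 := Nat.lt_floor_add_one (((2 ^ k : ℕ) : ℝ) ^ (1 - δ))
    have h2 : (1 : ℝ) ≤ h k := by exact_mod_cast hh1 k
    have h3 : ((2 ^ k : ℕ) : ℝ) ^ (1 - δ) < (h k : ℝ) + 1 := h1
    linarith
  set K := (∫⁻ k, (k : ℝ≥0∞) ^ 2 ∂μ).toReal with hK
  have hK0 : 0 ≤ K := ENNReal.toReal_nonneg
  have hmass := ae_eventually_notMem_of_le_geometric (brwLaw μ θ)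
    (fun k => {ω | mass ω (2 ^ k) (h k) ≤ ENNReal.ofReal (((2 ^ k : ℕ) : ℝ) * h k / 2)})
    (C := 4 * (1 + K)) (b := δ) (by positivity) hδ fun k => by
      refine (mass_lt_le μ θ hμ hμ2 hθ Nat.one_le_two_pow (hh1 k)).trans
        (ENNReal.ofReal_le_ofReal ?_)
      refine mul_le_mul_of_nonneg_left ?_ (by positivity)
      have hNpos : (0 : ℝ) < ((2 ^ k : ℕ) : ℝ) := lt_of_lt_of_le one_pos (hN1 k)
      rw [div_le_iff₀ hNpos]
      refine (hhle k).trans (le_of_eq ?_)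
      rw [← Real.rpow_add_one hNpos.ne']; congr 1; ring
  have henergy := ae_eventually_notMem_of_le_geometric (brwLaw μ θ)
    (fun k => {ω | ENNReal.ofReal (((2 ^ k : ℕ) : ℝ) ^ (4 - a + δ)) ≤
      pairEnergy ω (2 ^ k) (h k) (green η)})
    (C := C) (b := δ) hC.le hδ fun k => by
      have hNpos : (0 : ℝ) < ((2 ^ k : ℕ) : ℝ) := lt_of_lt_of_le one_pos (hN1 k)
      have h1 := (mul_meas_ge_le_lintegral (μ := brwLaw μ θ)
        (measurable_pairEnergy (2 ^ k) (h k) (green η))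
        (ENNReal.ofReal (((2 ^ k : ℕ) : ℝ) ^ (4 - a + δ)))).trans
          (hE _ _ Nat.one_le_two_pow (hhN k))
      have h2 : ENNReal.ofReal (C * ((2 ^ k : ℕ) : ℝ) ^ (4 - a)) =
          ENNReal.ofReal (((2 ^ k : ℕ) : ℝ) ^ (4 - a + δ)) *
            ENNReal.ofReal (C * ((2 ^ k : ℕ) : ℝ) ^ (-δ)) := by
        rw [← ENNReal.ofReal_mul (by positivity), mul_left_comm, ← Real.rpow_add hNpos]
        congr 3; ring
      rw [h2] at h1
      exact (ENNReal.mul_le_mul_iff_right (by simpa using Real.rpow_pos_of_pos hNpos _)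
        ENNReal.ofReal_ne_top).1 h1
  have hfin : ∀ᵐ ω ∂brwLaw μ θ, ∀ k, mass ω (2 ^ k) (h k) < ∞ := by
    rw [ae_all_iff]
    intro k
    refine ae_lt_top (measurable_mass _ _) ?_
    rw [lintegral_mass μ θ hμ]
    finiteness
  filter_upwards [hmass, henergy, hfin] with ω h1 h2 h3
  filter_upwards [h1, h2] with k h4 h5 A hA
  have hNpos : (0 : ℝ) < ((2 ^ k : ℕ) : ℝ) := lt_of_lt_of_le one_pos (hN1 k)
  set N : ℝ := ((2 ^ k : ℕ) : ℝ) with hN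
  have h4' := (not_le.1 h4).le
  have h5' := (not_le.1 h5).le
  have hcap := sq_tsum_le_energy_mul_capacity η (green_ne_top η hd hη) A
    (fun p : Index (2 ^ k) (h k) => alive ω p.1 p.2.2.1) (fun p => position ω p.1 p.2.2.1)
    (fun p hp => hA ⟨p.1, p.1.2, _, (alive_ne_zero_iff _ _ _).1 hp, rfl⟩) (h3 k).ne
    (E := ENNReal.ofReal (N ^ (4 - a + δ))) (by simpa using Real.rpow_pos_of_pos hNpos _)
    ENNReal.ofReal_ne_top h5'
  have hM : ENNReal.ofReal (N ^ (2 - δ) / 4) ≤ mass ω (2 ^ k) (h k) := by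
    refine le_trans (ENNReal.ofReal_le_ofReal ?_) h4'
    have h6 : N ^ (2 - δ) = N * N ^ (1 - δ) := by
      rw [mul_comm, ← Real.rpow_add_one hNpos.ne']; congr 1; ring
    rw [h6]
    nlinarith [hhge k]
  have hcap0 := capacity_nonneg η A
  have h7 : ENNReal.ofReal ((N ^ (2 - δ) / 4) ^ 2) ≤
      ENNReal.ofReal (4 * N ^ (4 - a + δ) * capacity η A) := by
    rw [ENNReal.ofReal_pow (by positivity), ENNReal.ofReal_mul (by positivity),
      ENNReal.ofReal_mul (by positivity), ENNReal.ofReal_ofNat]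
    exact (pow_le_pow_left' hM 2).trans hcap
  have h8 := (ENNReal.ofReal_le_ofReal_iff (by positivity)).1 h7
  -- Mass contributes `-2δ` and Markov's inequality for the energy `-δ`, hence `a - 3δ`; the
  -- constant is `1 / (16 * 4)`.
  have h9 : (N ^ (2 - δ) / 4) ^ 2 = 4 * N ^ (4 - a + δ) * (64⁻¹ * N ^ (a - 3 * δ)) := by
    have e1 : (N ^ (2 - δ)) ^ 2 = N ^ (4 - a + δ) * N ^ (a - 3 * δ) := by
      rw [← Real.rpow_natCast, ← Real.rpow_mul hNpos.le, ← Real.rpow_add hNpos]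
      congr 1; push_cast; ring
    rw [div_pow, e1]; ring
  rw [h9] at h8
  exact le_of_mul_le_mul_left h8 (by positivity)

/-- The cube allows for the number of pairs of a subtree and a generation in the box estimate, which
is at most `2 * N ^ 3`. -/
theorem mul_exp_neg_le {t δ : ℝ} (ht : 0 < t) (hδ : 0 < δ) :
    ∃ B : ℝ, 0 < B ∧ ∀ N : ℝ, 1 ≤ N →
      N ^ (3 : ℝ) * Real.exp (-(t * N ^ (δ / 2))) ≤ B * N ^ (-(1 : ℝ)) := by
  set m := ⌈8 / δ⌉₊ with hm
  have hmδ : 4 ≤ δ / 2 * m := by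
    have := Nat.le_ceil (8 / δ)
    rw [div_le_iff₀ hδ] at this
    linarith
  refine ⟨m.factorial / t ^ m, by positivity, fun N hN => ?_⟩
  have hN0 : 0 < N := by linarith
  have h1 := Real.pow_div_factorial_le_exp (t * N ^ (δ / 2)) (by positivity) m
  have h2 : N ^ (4 : ℝ) ≤ (N ^ (δ / 2)) ^ m := by
    rw [← Real.rpow_natCast, ← Real.rpow_mul hN0.le]
    exact Real.rpow_le_rpow_of_exponent_le hN hmδ
  have h3 : t ^ m * N ^ (4 : ℝ) ≤ m.factorial * Real.exp (t * N ^ (δ / 2)) := by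
    rw [div_le_iff₀ (by positivity), mul_pow] at h1
    have := mul_le_mul_of_nonneg_left h2 (pow_pos ht m).le
    linarith
  have h4 : N ^ (4 : ℝ) = N ^ (3 : ℝ) * N := by
    rw [← Real.rpow_add_one hN0.ne']; norm_num
  rw [Real.exp_neg, Real.rpow_neg_one, ← div_eq_mul_inv, ← div_eq_mul_inv,
    div_le_div_iff₀ (Real.exp_pos _) hN0, ← h4, div_mul_eq_mul_div, le_div_iff₀ (by positivity)]
  linarith

/-- The number of vertices of generation less than `h` of the first `n` subtrees outside of the
box of radius `r`. -/
def outsideCount (ω : Sample d) (n h r : ℕ) : ℝ≥0∞ :=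
  ∑' p : Index n h, alive ω p.1 p.2.2.1 *
    (box d r : Set (Lattice d))ᶜ.indicator 1 (position ω p.1 p.2.2.1)

theorem measurable_alive_mul (j : ℕ) (u : List ℕ) (f : Lattice d → ℝ≥0∞) :
    Measurable fun ω : Sample d => alive ω j u * f (position ω j u) := by
  have hf : Measurable f := .of_discrete
  exact (measurable_alive j u).mul (hf.comp (measurable_position j u))

theorem lintegral_outsideCount (hμ : ∫⁻ k, (k : ℝ≥0∞) ∂μ = 1) (n h r : ℕ) :
    ∫⁻ ω, outsideCount ω n h r ∂brwLaw μ θ =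
      ∑ i ∈ Finset.range n, ∑ k ∈ Finset.range h,
        stepLaw θ (i + k) (box d r : Set (Lattice d))ᶜ := by
  unfold outsideCount
  rw [lintegral_tsum fun _ => (measurable_alive_mul _ _ _).aemeasurable,
    tsum_index n h fun i u => ∫⁻ ω, alive ω i u *
      (box d r : Set (Lattice d))ᶜ.indicator 1 (position ω i u) ∂brwLaw μ θ]
  refine Finset.sum_congr rfl fun i _ => Finset.sum_congr rfl fun k _ => ?_
  rw [tsum_lintegral_alive_mul μ θ hμ, avg_zero_eq, lintegral_indicator_one .of_discrete]

theorem range_subset_box {ω : Sample d} {n h r : ℕ} (hh : ∀ j < n, ω ∈ treeExtinctBy d j h)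
    (hr : outsideCount ω n h r < 1) : range ω n ⊆ box d r := by
  rintro x ⟨j, hj, u, hu, rfl⟩
  by_contra hx
  have hlen : u.length < h := length_lt_of_mem_extinctBy (hh j hj) hu
  let p : Index n h := (⟨j, hj⟩, ⟨⟨u.length, hlen⟩, ⟨u, rfl⟩⟩)
  have h1 : alive ω p.1 p.2.2.1 *
      (box d r : Set (Lattice d))ᶜ.indicator 1 (position ω p.1 p.2.2.1) ≤ outsideCount ω n h r :=
    ENNReal.le_tsum p
  have h2 : alive ω j u = 1 := by simp [alive, hu]
  have h3 : (box d r : Set (Lattice d))ᶜ.indicator (1 : Lattice d → ℝ≥0∞) (position ω j u) = 1 :=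
    Set.indicator_of_mem (by exact hx) _
  change alive ω j u * _ ≤ _ at h1
  change alive ω j u * (box d r : Set (Lattice d))ᶜ.indicator 1 (position ω j u) ≤ _ at h1
  rw [h2, h3, one_mul] at h1
  exact absurd hr (not_lt.2 h1)

/-- The range of the first `2 ^ k` subtrees is contained in a box whose radius is barely larger
than the square root of `2 ^ k`. -/
theorem ae_eventually_range_subset_box (hInt : Integrable (fun k : ℕ => (k : ℝ)) μ)
    (hmean : ∫ k, (k : ℝ) ∂μ = 1) (hne : μ ≠ Measure.dirac 1)
    (hμ : ∫⁻ k, (k : ℝ≥0∞) ∂μ = 1) (hθ : ∀ x : Lattice d, θ {-x} = θ {x})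
    (hexp : ∃ c : ℝ, 0 < c ∧ Integrable (fun x => Real.exp (c * ‖toEuclidean x‖)) θ)
    {δ : ℝ} (hδ : 0 < δ) (hδ1 : δ ≤ 1) :
    ∀ᵐ ω ∂brwLaw μ θ, ∀ᶠ k : ℕ in atTop,
      range ω (2 ^ k) ⊆ box d ⌈((2 ^ k : ℕ) : ℝ) ^ (1 / 2 + δ)⌉₊ := by
  obtain ⟨t₀, C, ht₀, hC, hbox⟩ := exists_stepLaw_compl_box_le θ hθ hexp
  obtain ⟨B, hB, hexpB⟩ := mul_exp_neg_le ht₀ hδ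
  have hN1 : ∀ k : ℕ, (1 : ℝ) ≤ ((2 ^ k : ℕ) : ℝ) := fun k => by
    exact_mod_cast Nat.one_le_two_pow
  have hc0 := measure_zero_pos μ hInt hmean hne
  -- A union over `n` trees of survival probabilities of order `1 / H` is of order `n ^ (-δ)`.
  set H : ℕ → ℕ := fun k => ⌈((2 ^ k : ℕ) : ℝ) ^ (1 + δ)⌉₊ with hH
  have hHge : ∀ k, ((2 ^ k : ℕ) : ℝ) ^ (1 + δ) ≤ H k := fun k => Nat.le_ceil _
  have hHle : ∀ k, (H k : ℝ) ≤ 2 * ((2 ^ k : ℕ) : ℝ) ^ (1 + δ) := fun k => by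
    have h1 := Nat.ceil_lt_add_one (a := ((2 ^ k : ℕ) : ℝ) ^ (1 + δ)) (by positivity)
    have h2 : (1 : ℝ) ≤ ((2 ^ k : ℕ) : ℝ) ^ (1 + δ) := Real.one_le_rpow (hN1 k) (by linarith)
    have h3 : (H k : ℝ) < ((2 ^ k : ℕ) : ℝ) ^ (1 + δ) + 1 := h1
    linarith
  have hheight := ae_eventually_notMem_of_le_geometric (brwLaw μ θ)
    (fun k => ⋃ j ∈ Finset.range (2 ^ k), (treeExtinctBy d j (H k))ᶜ)
    (C := (μ.real {0})⁻¹) (b := δ) (by positivity) hδ fun k => by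
      have hNpos : (0 : ℝ) < ((2 ^ k : ℕ) : ℝ) := lt_of_lt_of_le one_pos (hN1 k)
      refine (measure_biUnion_finset_le _ _).trans ((Finset.sum_le_sum fun j _ =>
        treeExtinctBy_compl_le μ θ hInt hmean hne j (H k)).trans ?_)
      rw [Finset.sum_const, Finset.card_range, nsmul_eq_mul, ← ENNReal.ofReal_natCast,
        ← ENNReal.ofReal_mul (by positivity)]
      refine ENNReal.ofReal_le_ofReal ?_
      rw [mul_left_comm]
      refine mul_le_mul_of_nonneg_left ?_ (by positivity)
      have e : ((2 ^ k : ℕ) : ℝ) ^ (1 + δ) = ((2 ^ k : ℕ) : ℝ) * ((2 ^ k : ℕ) : ℝ) ^ δ := by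
        rw [Real.rpow_add hNpos, Real.rpow_one]
      have hpos : (0 : ℝ) < (H k : ℝ) + 1 := by positivity
      rw [← div_eq_mul_inv, div_le_iff₀ hpos, Real.rpow_neg hNpos.le, inv_mul_eq_div,
        le_div_iff₀ (by positivity), ← e]
      linarith [hHge k]
  have hout := ae_eventually_notMem_of_le_geometric (brwLaw μ θ)
    (fun k => {ω : Sample d | 1 ≤ outsideCount ω (2 ^ k) (H k) ⌈((2 ^ k : ℕ) : ℝ) ^ (1 / 2 + δ)⌉₊})
    (C := 4 * d * Real.exp (3 * C * t₀ ^ 2) * B) (b := 1) (by positivity) one_pos fun k => by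
      have hNpos : (0 : ℝ) < ((2 ^ k : ℕ) : ℝ) := lt_of_lt_of_le one_pos (hN1 k)
      set N : ℝ := ((2 ^ k : ℕ) : ℝ) with hN
      set r := ⌈N ^ (1 / 2 + δ)⌉₊ with hr
      have hmeas : Measurable fun ω : Sample d => outsideCount ω (2 ^ k) (H k) r :=
        Measurable.tsum fun _ => measurable_alive_mul _ _ _
      have h1 := mul_meas_ge_le_lintegral (μ := brwLaw μ θ) hmeas 1
      rw [one_mul, lintegral_outsideCount μ θ hμ] at h1
      refine h1.trans ?_
      -- This keeps `t ^ 2 * m` bounded for all tree distances `m ≤ 3 * N ^ (1 + δ)` from the root,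
      -- while `t * r` still grows like `N ^ (δ / 2)`.
      set t : ℝ := t₀ * N ^ (-((1 + δ) / 2)) with ht
      have ht0 : 0 ≤ t := by positivity
      have htt : t ≤ t₀ := by
        refine mul_le_of_le_one_right ht₀.le ?_
        exact Real.rpow_le_one_of_one_le_of_nonpos (hN1 k) (by linarith)
      have htsq : t ^ 2 * N ^ (1 + δ) = t₀ ^ 2 := by
        rw [ht, mul_pow, ← Real.rpow_natCast (N ^ _), ← Real.rpow_mul hNpos.le, mul_assoc,
          ← Real.rpow_add hNpos]
        have : -((1 + δ) / 2) * ((2 : ℕ) : ℝ) + (1 + δ) = 0 := by push_cast; ring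
        rw [this, Real.rpow_zero, mul_one]
      have htr : t₀ * N ^ (δ / 2) ≤ t * r := by
        have h2 : N ^ (1 / 2 + δ) ≤ r := Nat.le_ceil _
        have h3 : t₀ * N ^ (δ / 2) = t * N ^ (1 / 2 + δ) := by
          rw [ht, mul_assoc, ← Real.rpow_add hNpos]; congr 2; ring
        rw [h3]; exact mul_le_mul_of_nonneg_left h2 ht0
      have hNle : N ≤ N ^ (1 + δ) := by
        conv_lhs => rw [← Real.rpow_one N]
        exact Real.rpow_le_rpow_of_exponent_le (hN1 k) (by linarith)
      have hterm : ∀ i ∈ Finset.range (2 ^ k), ∀ l ∈ Finset.range (H k),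
          stepLaw θ (i + l) (box d r : Set (Lattice d))ᶜ ≤ ENNReal.ofReal
            (2 * d * (Real.exp (3 * C * t₀ ^ 2) * Real.exp (-(t₀ * N ^ (δ / 2))))) := by
        intro i hi l hl
        refine (hbox (i + l) r t ht0 htt).trans (ENNReal.ofReal_le_ofReal ?_)
        rw [← Real.exp_add]
        refine mul_le_mul_of_nonneg_left (Real.exp_le_exp.2 ?_) (by positivity)
        have hi' : (i : ℝ) ≤ N := by
          rw [hN]; exact_mod_cast (Finset.mem_range.1 hi).le
        have hl' : (l : ℝ) ≤ H k := by exact_mod_cast (Finset.mem_range.1 hl).le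
        have hil : ((i + l : ℕ) : ℝ) ≤ 3 * N ^ (1 + δ) := by
          push_cast; linarith [hHle k]
        have : C * t ^ 2 * ((i + l : ℕ) : ℝ) ≤ 3 * C * t₀ ^ 2 := by
          calc C * t ^ 2 * ((i + l : ℕ) : ℝ) ≤ C * t ^ 2 * (3 * N ^ (1 + δ)) :=
                mul_le_mul_of_nonneg_left hil (by positivity)
            _ = 3 * C * (t ^ 2 * N ^ (1 + δ)) := by ring
            _ = _ := by rw [htsq]
        linarith
      refine (Finset.sum_le_sum fun i hi => Finset.sum_le_sum fun l hl => hterm i hi l hl).trans ?_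
      rw [Finset.sum_const, Finset.sum_const, Finset.card_range, Finset.card_range, nsmul_eq_mul,
        nsmul_eq_mul, ← ENNReal.ofReal_natCast, ← ENNReal.ofReal_natCast,
        ← ENNReal.ofReal_mul (by positivity), ← ENNReal.ofReal_mul (by positivity)]
      refine ENNReal.ofReal_le_ofReal ?_
      have hNH : N * H k ≤ 2 * N ^ (3 : ℝ) := by
        have h2 : N * N ^ (1 + δ) ≤ N ^ (3 : ℝ) := by
          rw [mul_comm, ← Real.rpow_add_one hNpos.ne']
          exact Real.rpow_le_rpow_of_exponent_le (hN1 k) (by linarith)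
        have := mul_le_mul_of_nonneg_left (hHle k) hNpos.le
        linarith
      calc N * (H k * (2 * d * (Real.exp (3 * C * t₀ ^ 2) * Real.exp (-(t₀ * N ^ (δ / 2))))))
          = N * H k * (2 * d * (Real.exp (3 * C * t₀ ^ 2) * Real.exp (-(t₀ * N ^ (δ / 2))))) := by
            ring
        _ ≤ 2 * N ^ (3 : ℝ) *
            (2 * d * (Real.exp (3 * C * t₀ ^ 2) * Real.exp (-(t₀ * N ^ (δ / 2))))) :=
            mul_le_mul_of_nonneg_right hNH (by positivity)
        _ = 4 * d * Real.exp (3 * C * t₀ ^ 2) *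
            (N ^ (3 : ℝ) * Real.exp (-(t₀ * N ^ (δ / 2)))) := by ring
        _ ≤ 4 * d * Real.exp (3 * C * t₀ ^ 2) * (B * N ^ (-(1 : ℝ))) :=
            mul_le_mul_of_nonneg_left (hexpB N (hN1 k)) (by positivity)
        _ = _ := by ring
  filter_upwards [hheight, hout] with ω h1 h2
  filter_upwards [h1, h2] with k h3 h4
  refine range_subset_box (h := H k) (fun j hj => ?_) (not_le.1 h4)
  by_contra hcon
  exact h3 (Set.mem_biUnion (x := j) (Finset.mem_range.2 hj) hcon)

/-- Upper bound for the capacity of a subset of the range of the first `2 ^ k` subtrees. -/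
theorem exists_ae_eventually_capacity_le (hInt : Integrable (fun k : ℕ => (k : ℝ)) μ)
    (hmean : ∫ k, (k : ℝ) ∂μ = 1) (hne : μ ≠ Measure.dirac 1)
    (hμ : ∫⁻ k, (k : ℝ≥0∞) ∂μ = 1) (hθ : ∀ x : Lattice d, θ {-x} = θ {x})
    (hexp : ∃ c : ℝ, 0 < c ∧ Integrable (fun x => Real.exp (c * ‖toEuclidean x‖)) θ)
    (η : Measure (Lattice d)) [IsProbabilityMeasure η] (hd : 3 ≤ d) (hd5 : d ≤ 5)
    (h2 : Integrable (fun x => ‖toEuclidean x‖ ^ 2) η) (hη0 : ∫ x, toEuclidean x ∂η = 0) :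
    ∃ C : ℝ, 0 < C ∧ ∀ δ : ℝ, 0 < δ → δ ≤ 1 → ∀ᵐ ω ∂brwLaw μ θ, ∀ᶠ k : ℕ in atTop,
      ∀ A : Finset (Lattice d), (A : Set (Lattice d)) ⊆ range ω (2 ^ k) →
      capacity η A ≤ C * ((2 ^ k : ℕ) : ℝ) ^ (((d : ℝ) - 2) / 2 + 3 * δ) := by
  obtain ⟨C, hC, hcap⟩ := exists_capacity_le η h2 hη0
  have hd' : (3 : ℝ) ≤ d := by exact_mod_cast hd
  have hd5' : (d : ℝ) ≤ 5 := by exact_mod_cast hd5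
  refine ⟨C * 2 ^ ((d : ℝ) - 2), by positivity, fun δ hδ hδ1 => ?_⟩
  filter_upwards [ae_eventually_range_subset_box μ θ hInt hmean hne hμ hθ hexp hδ hδ1] with ω hω
  filter_upwards [hω] with k hk A hA
  have hN1 : (1 : ℝ) ≤ ((2 ^ k : ℕ) : ℝ) := by exact_mod_cast Nat.one_le_two_pow
  set N : ℝ := ((2 ^ k : ℕ) : ℝ) with hN
  have hNpos : 0 < N := by linarith
  set r := ⌈N ^ (1 / 2 + δ)⌉₊ with hr
  have hx1 : 1 ≤ N ^ (1 / 2 + δ) := Real.one_le_rpow hN1 (by positivity)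
  have hrge : N ^ (1 / 2 + δ) ≤ r := Nat.le_ceil _
  have hr1 : 1 ≤ r := by exact_mod_cast hx1.trans hrge
  have hr1' : (1 : ℝ) ≤ r := by exact_mod_cast hr1
  have hrle : (r : ℝ) ≤ 2 * N ^ (1 / 2 + δ) := by
    have := Nat.ceil_lt_add_one (a := N ^ (1 / 2 + δ)) (by positivity)
    have h3 : (r : ℝ) < N ^ (1 / 2 + δ) + 1 := this
    linarith
  refine (hcap r hr1 A (by exact_mod_cast hA.trans hk)).trans ?_
  rw [mul_assoc]
  refine mul_le_mul_of_nonneg_left ?_ hC.le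
  have h3 : (r : ℝ) ^ d / (r : ℝ) ^ 2 = (r : ℝ) ^ ((d : ℝ) - 2) := by
    rw [Real.rpow_sub (by linarith), Real.rpow_natCast, Real.rpow_two]
  rw [h3]
  calc (r : ℝ) ^ ((d : ℝ) - 2) ≤ (2 * N ^ (1 / 2 + δ)) ^ ((d : ℝ) - 2) :=
        Real.rpow_le_rpow (by linarith) hrle (by linarith)
    _ = 2 ^ ((d : ℝ) - 2) * N ^ ((1 / 2 + δ) * ((d : ℝ) - 2)) := by
        rw [Real.mul_rpow zero_le_two (by positivity), ← Real.rpow_mul hNpos.le]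
    _ ≤ _ := by
        refine mul_le_mul_of_nonneg_left ?_ (by positivity)
        -- The factor `3` in the exponent comes from `d - 2 ≤ 3`.
        exact Real.rpow_le_rpow_of_exponent_le hN1 (by nlinarith)

/-! ### From bounds on exponents to asymptotics -/

theorem eventually_const_mul_rpow_le {C a b : ℝ} (hab : a < b) :
    ∀ᶠ n : ℕ in atTop, C * (n : ℝ) ^ a ≤ (n : ℝ) ^ b := by
  have h1 : Tendsto (fun n : ℕ => (n : ℝ) ^ (b - a)) atTop atTop :=
    (tendsto_rpow_atTop (by linarith)).comp tendsto_natCast_atTop_atTop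
  filter_upwards [h1.eventually_ge_atTop C, eventually_gt_atTop 0] with n hn hn0
  have hn' : (0 : ℝ) < n := by exact_mod_cast hn0
  have h2 : (n : ℝ) ^ b = (n : ℝ) ^ (b - a) * (n : ℝ) ^ a := by
    rw [← Real.rpow_add hn']; congr 1; ring
  rw [h2]
  exact mul_le_mul_of_nonneg_right hn (by positivity)

theorem exists_exponent_of_bounds (x : ℕ → ℝ) (a : ℝ)
    (h : ∀ e : ℝ, 0 < e → ∀ᶠ n : ℕ in atTop, (n : ℝ) ^ (a - e) ≤ x n ∧ x n ≤ (n : ℝ) ^ (a + e)) :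
    ∃ ε : ℕ → ℝ, Tendsto ε atTop (𝓝 0) ∧ ∀ᶠ n : ℕ in atTop, x n = (n : ℝ) ^ (a + ε n) := by
  have hlog : ∀ n : ℕ, 2 ≤ n → 0 < Real.log n := fun n hn =>
    Real.log_pos (by exact_mod_cast hn)
  -- The only possible choice once `n ≥ 2` and `x n > 0`; earlier values do not matter.
  refine ⟨fun n => Real.log (x n) / Real.log n - a, ?_, ?_⟩
  · rw [Metric.tendsto_atTop']
    intro e he
    obtain ⟨M, hM⟩ := eventually_atTop.1 ((h (e / 2) (by positivity)).and (eventually_ge_atTop 2))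
    refine ⟨M, fun n hn => ?_⟩
    obtain ⟨⟨h1, h2⟩, h3⟩ := hM n hn.le
    have hn0 : (0 : ℝ) < n := by exact_mod_cast (by omega : 0 < n)
    have hl := hlog n h3
    have hx : 0 < x n := lt_of_lt_of_le (Real.rpow_pos_of_pos hn0 _) h1
    have h4 := Real.log_le_log (Real.rpow_pos_of_pos hn0 _) h1
    have h5 := Real.log_le_log hx h2
    rw [Real.log_rpow hn0] at h4 h5
    have h6 : a - e / 2 ≤ Real.log (x n) / Real.log n := (le_div_iff₀ hl).2 h4
    have h7 : Real.log (x n) / Real.log n ≤ a + e / 2 := (div_le_iff₀ hl).2 h5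
    rw [Real.dist_eq, sub_zero, abs_lt]
    constructor <;> linarith
  · filter_upwards [h 1 one_pos, eventually_ge_atTop 2] with n h1 h3
    have hn0 : (0 : ℝ) < n := by exact_mod_cast (by omega : 0 < n)
    have hx : 0 < x n := lt_of_lt_of_le (Real.rpow_pos_of_pos hn0 _) h1.1
    rw [add_sub_cancel, Real.rpow_def_of_pos hn0, mul_div_cancel₀ _ (hlog n h3).ne',
      Real.exp_log hx]

theorem range_mono {ω : Sample d} {m n : ℕ} (h : m ≤ n) : range ω m ⊆ range ω n :=
  fun _ ⟨j, hj, hx⟩ => ⟨j, hj.trans_le h, hx⟩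

theorem tendsto_log_two : Tendsto (Nat.log 2) atTop atTop :=
  tendsto_atTop.2 fun b => (eventually_ge_atTop (2 ^ b)).mono fun _ hn =>
    Nat.le_log_of_pow_le one_lt_two hn

end

end

end BRW

/-! ### Assembly of the theorem -/

open BRW in
theorem theorem1p1 (d : ℕ) (hd : d = 3 ∨ d = 4 ∨ d = 5)
    -- the offspring law: mean one, finite variance, not the Dirac mass at one
    (μ : Measure ℕ) [IsProbabilityMeasure μ]
    (hμ_mean : ∫ k, (k : ℝ) ∂μ = 1)
    (hμ_var : MemLp (fun k : ℕ => (k : ℝ)) 2 μ)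
    (hμ_ne : μ ≠ Measure.dirac 1)
    -- the jump law that defines the capacity
    (η : Measure (BRW.Lattice d)) [IsProbabilityMeasure η]
    (hη_aper : BRW.IsAperiodic η) (hη_irr : BRW.IsIrreducible η)
    (hη_moment : Integrable (fun x => ‖BRW.toEuclidean x‖ ^ (d + 1)) η)
    (hη_mean : ∫ x, BRW.toEuclidean x ∂η = 0)
    -- the displacement law of the branching random walk
    (θ : Measure (BRW.Lattice d)) [IsProbabilityMeasure θ]
    (hθ_symm : ∀ x : BRW.Lattice d, θ {-x} = θ {x}) (hθ_irr : BRW.IsIrreducible θ)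
    (hθ_exp : ∃ c : ℝ, 0 < c ∧ Integrable (fun x => Real.exp (c * ‖BRW.toEuclidean x‖)) θ) :
    ∀ᵐ ω ∂(BRW.brwLaw μ θ),
      (∀ n : ℕ, (BRW.range ω n).Finite) ∧
      ∃ ε : ℕ → ℝ, Tendsto ε atTop (𝓝 0) ∧
        ∀ᶠ n : ℕ in atTop,
          BRW.capacity η (BRW.range ω n) = (n : ℝ) ^ (((d : ℝ) - 2) / 2 + ε n) := by
  have hd3 : 3 ≤ d := by omega
  have hd5 : d ≤ 5 := by omega
  have hd3' : (3 : ℝ) ≤ d := by exact_mod_cast hd3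
  have hInt : Integrable (fun k : ℕ => (k : ℝ)) μ := hμ_var.integrable one_le_two
  have hμ1 : ∫⁻ k, (k : ℝ≥0∞) ∂μ = 1 := by
    have := ofReal_integral_eq_lintegral_ofReal hInt (ae_of_all _ fun k => Nat.cast_nonneg k)
    simpa [hμ_mean] using this.symm
  have hμ2 : ∫⁻ k, (k : ℝ≥0∞) ^ 2 ∂μ ≠ ∞ := by
    have h := hμ_var.integrable_sq.lintegral_lt_top
    refine ne_of_lt (lt_of_le_of_lt (le_of_eq ?_) h)
    refine lintegral_congr fun k => ?_
    rw [ENNReal.ofReal_pow (Nat.cast_nonneg k), ENNReal.ofReal_natCast]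
  have hη2 : Integrable (fun x => ‖toEuclidean x‖ ^ 2) η := by
    refine (hη_moment.add (integrable_const 1)).mono' Measurable.of_discrete.aestronglyMeasurable ?_
    refine ae_of_all _ fun x => ?_
    rw [Real.norm_of_nonneg (by positivity)]
    have h0 : 0 ≤ ‖toEuclidean x‖ := norm_nonneg _
    simp only [Pi.add_apply]
    rcases le_total ‖toEuclidean x‖ 1 with h | h
    · have h1 := pow_le_one₀ (n := 2) h0 h
      have h2 : 0 ≤ ‖toEuclidean x‖ ^ (d + 1) := by positivity
      linarith
    · have := pow_le_pow_right₀ h (by omega : 2 ≤ d + 1)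
      linarith
  set a := ((d : ℝ) - 2) / 2 with ha
  have ha0 : 1 / 2 ≤ a := by rw [ha]; linarith
  obtain ⟨C, hC, hupper⟩ := exists_ae_eventually_capacity_le μ θ hInt hμ_mean hμ_ne hμ1 hθ_symm
    hθ_exp η hd3 hd5 hη2 hη_mean
  -- A countable family tending to zero, so that one null set serves every `e`. The bound `1 / 7`
  -- keeps `a - 3 * δ m` nonnegative, as `a ≥ 1 / 2`.
  set δ : ℕ → ℝ := fun m => 1 / ((m : ℝ) + 7) with hδ
  have hδ0 : ∀ m, 0 < δ m := fun m => by simp only [hδ]; positivity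
  have hδ7 : ∀ m, δ m ≤ 1 / 7 := fun m => by
    simp only [hδ]
    exact one_div_le_one_div_of_le (by norm_num) (by linarith [(Nat.cast_nonneg m : (0 : ℝ) ≤ m)])
  have hδ1 : ∀ m, δ m ≤ 1 := fun m => (hδ7 m).trans (by norm_num)
  have hlow := ae_all_iff.2 fun m => ae_eventually_le_capacity μ θ hμ1 hμ2 hθ_symm η hd3 hd5
    hη_irr hθ_irr (hδ0 m) (hδ1 m)
  have hup := ae_all_iff.2 fun m => hupper (δ m) (hδ0 m) (hδ1 m)
  filter_upwards [hlow, hup, ae_exists_treeExtinctBy μ θ hInt hμ_mean hμ_ne] with ω hl hu hfin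
  have hF : ∀ n, (range ω n).Finite := finite_range hfin
  refine ⟨hF, exists_exponent_of_bounds _ _ fun e he => ?_⟩
  obtain ⟨m, hm⟩ : ∃ m, 3 * δ m < e := by
    obtain ⟨m, hm⟩ := exists_nat_gt (3 / e)
    refine ⟨m, ?_⟩
    simp only [hδ]
    rw [div_lt_iff₀ he] at hm
    rw [mul_one_div, div_lt_iff₀ (by positivity)]
    nlinarith
  set k : ℕ → ℕ := Nat.log 2 with hk
  have hk1 : Tendsto (fun n => k n + 1) atTop atTop :=
    tendsto_atTop_mono (fun n => Nat.le_succ (k n)) tendsto_log_two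
  -- The gap between `3 * δ m` and `e` absorbs all constants, including the factor two between `n`
  -- and the neighbouring powers of two.
  have hClow := eventually_const_mul_rpow_le (C := 64 * 2 ^ (a - 3 * δ m)) (a := a - e)
    (b := a - 3 * δ m) (by linarith)
  have hCup := eventually_const_mul_rpow_le (C := C * 2 ^ (a + 3 * δ m)) (a := a + 3 * δ m)
    (b := a + e) (by linarith)
  filter_upwards [tendsto_log_two.eventually (hl m), hk1.eventually (hu m), hClow, hCup,
    eventually_ge_atTop 1] with n h1 h2 h3 h4 hn
  have hn0 : (0 : ℝ) < n := by exact_mod_cast hn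
  have hcoe : ((hF n).toFinset : Set (Lattice d)) = range ω n := (hF n).coe_toFinset
  have hkn : 2 ^ k n ≤ n := Nat.pow_log_le_self 2 (by omega)
  have hnk : n < 2 ^ (k n + 1) := Nat.lt_pow_succ_log_self one_lt_two n
  -- Both bounds are applied to `range ω n` itself, seen as containing the range at `2 ^ k n` and
  -- contained in the one at `2 ^ (k n + 1)`; monotonicity of the capacity is not needed.
  have h1' := h1 (hF n).toFinset (by rw [hcoe]; exact range_mono hkn)
  have h2' := h2 (hF n).toFinset (by rw [hcoe]; exact range_mono hnk.le)
  rw [hcoe] at h1' h2'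
  have hexp0 : 0 ≤ a - 3 * δ m := by linarith [hδ7 m]
  constructor
  · refine le_trans ?_ h1'
    have h5 : (n : ℝ) / 2 ≤ ((2 ^ k n : ℕ) : ℝ) := by
      have : (n : ℝ) < ((2 ^ (k n + 1) : ℕ) : ℝ) := by exact_mod_cast hnk
      rw [pow_succ] at this; push_cast at this ⊢; linarith
    have h6 := Real.rpow_le_rpow (by positivity) h5 hexp0
    rw [Real.div_rpow hn0.le zero_le_two] at h6
    have h7 : 64 * 2 ^ (a - 3 * δ m) * (n : ℝ) ^ (a - e) ≤
        64 * 2 ^ (a - 3 * δ m) * (64⁻¹ * ((n : ℝ) ^ (a - 3 * δ m) / 2 ^ (a - 3 * δ m))) := by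
      refine h3.trans (le_of_eq ?_)
      have : (0 : ℝ) < 2 ^ (a - 3 * δ m) := by positivity
      field_simp
    exact (le_of_mul_le_mul_left h7 (by positivity)).trans
      (mul_le_mul_of_nonneg_left h6 (by norm_num))
  · refine h2'.trans (le_trans ?_ h4)
    rw [mul_assoc, ← Real.mul_rpow zero_le_two hn0.le]
    refine mul_le_mul_of_nonneg_left ?_ hC.le
    refine Real.rpow_le_rpow (by positivity) ?_ (by linarith [hδ0 m])
    rw [pow_succ, mul_comm]; push_cast
    have : ((2 ^ k n : ℕ) : ℝ) ≤ n := by exact_mod_cast hkn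
    push_cast at this; linarith
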